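/- Let $N\ge 1$, $1\le p<\infty$ and $\gamma\in\mathbb R\setminus\{0\}$. Let $\nu_\gamma$ be the measure on $\mathbb R^N\times\mathbb R^N$ given by $\nu_\gamma(E)=\iint_{(x,y)\in E,\,x\ne y}|x-y|^{\gamma-N}\,dx\,dy$, and for measurable $u:\mathbb R^N\to\mathbb R$, $b\in\mathbb R$ and $\lambda>0$ let $$E_{\lambda,b}[u]=\Big\{(x,y)\in\mathbb R^N\times\mathbb R^N:\ x\ne y,\ \frac{|u(x)-u(y)|}{|x-y|^{1+b}}>\lambda\Big\}.$$ Let $\dot W^{1,p}(\mathbb R^N)$ be the space of real-valued $u\in L^1_{\rm loc}(\mathbb R^N)$ whose distributional gradient $\nabla u$ belongs to $L^p(\mathbb R^N)$, with the seminorm $\|\nabla u\|_{L^p(\mathbb R^N)}$, and let $\kappa(p,N)=\int_{\mathbb S^{N-1}}|e\cdot\omega|^p\,d\omega$, where $e$ is any unit vector in $\mathbb R^N$ and $d\omega$ is the surface measure. (a) If $\gamma>0$, then for all $u\in\dot W^{1,p}(\mathbb R^N)$ $$\lim_{\lambda\to+\infty}\lambda^p\,\nu_\gamma(E_{\lambda,\gamma/p}[u])=\frac{\kappa(p,N)}{|\gamma|}\,\|\nabla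 u\|_{L^p(\mathbb R^N)}^p.$$ (b) If either $\gamma<0$ and $p>1$, or $\gamma<-1$ and $p=1$, then for all $u\in\dot W^{1,p}(\mathbb R^N)$ $$\lim_{\lambda\searrow 0}\lambda^p\,\nu_\gamma(E_{\lambda,\gamma/p}[u])=\frac{\kappa(p,N)}{|\gamma|}\,\|\nabla u\|_{L^p(\mathbb R^N)}^p.\qquad(*)$$ (c) If $p=1$ and $-1\le\gamma<0$, then $(*)$ holds for all $u\in C^1_c(\mathbb R^N)$, but it fails for generic $u\in\dot W^{1,1}(\mathbb R^N)$ in the sense of Baire category: the set of $u\in\dot W^{1,1}(\mathbb R^N)$ for which $(*)$ holds is meager in $\dot W^{1,1}(\mathbb R^N)$, with the topology given by the seminorm $\|\nabla u\|_{L^1(\mathbb R^N)}$. However, for all $u\in\dot W^{1,1}(\mathbb R^N)$ $$\liminf_{\lambda\searrow 0}\lambda\,\nu_\gamma(E_{\lambda,\gamma}[u])\ge\frac{\kappa(1,N)}{|\gamma|}\,\|\nabla u\|_{L^1(\mathbb R^N)}.$$ -/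

import Mathlib

open MeasureTheory Filter Topology
open scoped ENNReal NNReal ContDiff

noncomputable section

namespace WeightedReverse

/-- Euclidean space `ℝ^N`. -/
abbrev Euc (N : ℕ) : Type := EuclideanSpace ℝ (Fin N)

/-- The measure `ν_γ` on `ℝ^N × ℝ^N`, with density `|x - y|^(γ - N)` on `{x ≠ y}` with respect to
Lebesgue measure. -/
def nu (N : ℕ) (γ : ℝ) : Measure (Euc N × Euc N) :=
  ((volume : Measure (Euc N × Euc N)).restrict {z | z.1 ≠ z.2}).withDensity
    (fun z => ENNReal.ofReal (‖z.1 - z.2‖ ^ (γ - (N : ℝ))))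

/-- The difference quotient `Q_b u(x, y) = (u(x) - u(y)) / |x - y|^(1 + b)`. -/
def diffQuot {N : ℕ} (b : ℝ) (u : Euc N → ℝ) (x y : Euc N) : ℝ :=
  (u x - u y) / ‖x - y‖ ^ (1 + b)

/-- The superlevel set `E_{lam, b}[u]`. -/
def superlevel {N : ℕ} (lam b : ℝ) (u : Euc N → ℝ) : Set (Euc N × Euc N) :=
  {z | z.1 ≠ z.2 ∧ lam < |diffQuot b u z.1 z.2|}

/-- The quantity `lam^p ν_γ(E_{lam, γ/p}[u])`, with values in `[0, ∞]`. -/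
def levelFunctional {N : ℕ} (p γ : ℝ) (u : Euc N → ℝ) (lam : ℝ) : ℝ≥0∞ :=
  ENNReal.ofReal (lam ^ p) * nu N γ (superlevel lam (γ / p) u)

/-- `∫_{S^{N-1}} |e · θ|^p dθ` for the surface measure on the unit sphere; for a unit vector `e`
this is the constant `κ(p, N)`. -/
def kappa {N : ℕ} (p : ℝ) (e : Euc N) : ℝ :=
  ∫ θ : Metric.sphere (0 : Euc N) 1, |inner ℝ e (θ : Euc N)| ^ p
    ∂((volume : Measure (Euc N)).toSphere)

/-- The locally integrable vector field `g` is the distributional gradient of the locally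
integrable function `u`. -/
structure HasWeakGradient {N : ℕ} (u : Euc N → ℝ) (g : Euc N → Euc N) : Prop where
  locallyIntegrable : LocallyIntegrable u volume
  locallyIntegrable_grad : LocallyIntegrable g volume
  integral_eq : ∀ φ : Euc N → ℝ, ContDiff ℝ ∞ φ → HasCompactSupport φ →
    ∫ x, u x • gradient φ x = -∫ x, φ x • g x

open Classical in
/-- The distributional gradient of `u` (unique almost everywhere); zero if there is none that is a
locally integrable vector field. -/
def weakGrad {N : ℕ} (u : Euc N → ℝ) : Euc N → Euc N :=
  if h : ∃ g, HasWeakGradient u g then h.choose else 0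

/-- `‖∇u‖_{L^p(ℝ^N)}`. -/
def gradNorm {N : ℕ} (p : ℝ≥0∞) (u : Euc N → ℝ) : ℝ≥0∞ :=
  eLpNorm (weakGrad u) p volume

/-- `u` belongs to the homogeneous Sobolev space: it is locally integrable and its distributional
gradient is in `L^p`. -/
def MemHomSobolev {N : ℕ} (p : ℝ≥0∞) (u : Euc N → ℝ) : Prop :=
  ∃ g : Euc N → Euc N, HasWeakGradient u g ∧ MemLp g p volume

section Basic

variable {N : ℕ}

theorem continuous_gradient {φ : Euc N → ℝ} (hφ : ContDiff ℝ ∞ φ) :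
    Continuous (gradient φ) :=
  (InnerProductSpace.toDual ℝ (Euc N)).symm.continuous.comp
    (hφ.continuous_fderiv (by simp))

theorem hasCompactSupport_gradient {φ : Euc N → ℝ} (hφ : HasCompactSupport φ) :
    HasCompactSupport (gradient φ) :=
  (hφ.fderiv (𝕜 := ℝ)).comp_left (g := (InnerProductSpace.toDual ℝ (Euc N)).symm) (map_zero _)

theorem integrable_smul_gradient {u φ : Euc N → ℝ} (hu : LocallyIntegrable u volume)
    (hφ : ContDiff ℝ ∞ φ) (hc : HasCompactSupport φ) :
    Integrable (fun x => u x • gradient φ x) volume :=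
  hu.integrable_smul_right_of_hasCompactSupport (continuous_gradient hφ)
    (hasCompactSupport_gradient hc)

theorem integrable_smul_field {φ : Euc N → ℝ} {g : Euc N → Euc N}
    (hg : LocallyIntegrable g volume)
    (hφ : ContDiff ℝ ∞ φ) (hc : HasCompactSupport φ) :
    Integrable (fun x => φ x • g x) volume :=
  hg.integrable_smul_left_of_hasCompactSupport hφ.continuous hc

theorem HasWeakGradient.add {u v : Euc N → ℝ} {g h : Euc N → Euc N}
    (hu : HasWeakGradient u g) (hv : HasWeakGradient v h) :
    HasWeakGradient (u + v) (g + h) := by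
  refine ⟨hu.1.add hv.1, hu.2.add hv.2, fun φ hφ hc => ?_⟩
  simp only [Pi.add_apply, add_smul, smul_add]
  rw [integral_add (integrable_smul_gradient hu.1 hφ hc) (integrable_smul_gradient hv.1 hφ hc),
    integral_add (integrable_smul_field hu.2 hφ hc) (integrable_smul_field hv.2 hφ hc),
    hu.3 φ hφ hc, hv.3 φ hφ hc, neg_add]

theorem HasWeakGradient.const_smul {u : Euc N → ℝ} {g : Euc N → Euc N}
    (hu : HasWeakGradient u g) (c : ℝ) : HasWeakGradient (c • u) (c • g) := by
  refine ⟨hu.1.smul c, hu.2.smul c, fun φ hφ hc => ?_⟩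
  simp only [Pi.smul_apply, smul_comm _ c, smul_assoc]
  rw [integral_smul, integral_smul, hu.3 φ hφ hc, smul_neg]

theorem HasWeakGradient.zero : HasWeakGradient (0 : Euc N → ℝ) 0 :=
  ⟨locallyIntegrable_zero, locallyIntegrable_zero, fun φ _ _ => by simp⟩

theorem HasWeakGradient.ae_unique {u : Euc N → ℝ} {g h : Euc N → Euc N}
    (hg : HasWeakGradient u g) (hh : HasWeakGradient u h) : g =ᵐ[volume] h :=
  ae_eq_of_integral_contDiff_smul_eq hg.2 hh.2 fun φ hφ hc =>
    neg_injective (by rw [← hg.3 φ hφ hc, ← hh.3 φ hφ hc])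

theorem HasWeakGradient.weakGrad_ae_eq {u : Euc N → ℝ} {g : Euc N → Euc N}
    (hg : HasWeakGradient u g) : weakGrad u =ᵐ[volume] g := by
  have h : ∃ g, HasWeakGradient u g := ⟨g, hg⟩
  rw [weakGrad, dif_pos h]
  exact h.choose_spec.ae_unique hg

theorem HasWeakGradient.gradNorm_eq {u : Euc N → ℝ} {g : Euc N → Euc N}
    (hg : HasWeakGradient u g) (p : ℝ≥0∞) : gradNorm p u = eLpNorm g p volume :=
  eLpNorm_congr_ae hg.weakGrad_ae_eq

theorem gradNorm_zero (p : ℝ≥0∞) : gradNorm p (0 : Euc N → ℝ) = 0 := by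
  rw [HasWeakGradient.zero.gradNorm_eq]
  exact eLpNorm_zero

theorem MemHomSobolev.gradNorm_ne_top {p : ℝ≥0∞} {u : Euc N → ℝ} (hu : MemHomSobolev p u) :
    gradNorm p u ≠ ⊤ := by
  obtain ⟨g, hg, hgp⟩ := hu
  rw [hg.gradNorm_eq]
  exact hgp.2.ne

theorem gradNorm_add_le {p : ℝ≥0∞} (hp : 1 ≤ p) {u v : Euc N → ℝ}
    (hu : MemHomSobolev p u) (hv : MemHomSobolev p v) :
    gradNorm p (u + v) ≤ gradNorm p u + gradNorm p v := by
  obtain ⟨g, hg, hgp⟩ := hu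
  obtain ⟨h, hh, hhp⟩ := hv
  rw [hg.gradNorm_eq, hh.gradNorm_eq, (hg.add hh).gradNorm_eq]
  exact eLpNorm_add_le hgp.1 hhp.1 hp

theorem gradNorm_neg {p : ℝ≥0∞} {u : Euc N → ℝ} (hu : MemHomSobolev p u) :
    gradNorm p (-u) = gradNorm p u := by
  obtain ⟨g, hg, -⟩ := hu
  have h := hg.const_smul (-1)
  rw [neg_one_smul, neg_one_smul] at h
  rw [hg.gradNorm_eq, h.gradNorm_eq, eLpNorm_neg]

end Basic

/-- The vector space of functions in the homogeneous Sobolev space. -/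
def homSobolevSubmodule (N : ℕ) (p : ℝ≥0∞) : Submodule ℝ (Euc N → ℝ) where
  carrier := {u | MemHomSobolev p u}
  add_mem' := by
    rintro u v ⟨g, hg, hgp⟩ ⟨h, hh, hhp⟩
    exact ⟨g + h, hg.add hh, hgp.add hhp⟩
  zero_mem' := ⟨0, HasWeakGradient.zero, MemLp.zero⟩
  smul_mem' := by
    rintro c u ⟨g, hg, hgp⟩
    exact ⟨c • g, hg.const_smul c, hgp.const_smul c⟩

/-- The homogeneous Sobolev space as a type of its own; it is topologized below by the seminorm
`‖∇u‖_{L^p}` (and not by pointwise convergence). -/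
def HomSobolev (N : ℕ) (p : ℝ≥0∞) : Type := ↥(homSobolevSubmodule N p)

instance HomSobolev.instAddCommGroup (N : ℕ) (p : ℝ≥0∞) : AddCommGroup (HomSobolev N p) :=
  inferInstanceAs (AddCommGroup ↥(homSobolevSubmodule N p))

instance HomSobolev.instModule (N : ℕ) (p : ℝ≥0∞) : Module ℝ (HomSobolev N p) :=
  inferInstanceAs (Module ℝ ↥(homSobolevSubmodule N p))

/-- The function underlying an element of the homogeneous Sobolev space. -/
def HomSobolev.toFun {N : ℕ} {p : ℝ≥0∞} (u : HomSobolev N p) : Euc N → ℝ := u.1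

theorem HomSobolev.mem {N : ℕ} {p : ℝ≥0∞} (u : HomSobolev N p) : MemHomSobolev p u.toFun := u.2

/-- The seminorm `‖∇u‖_{L^p}` on the homogeneous Sobolev space. -/
def homSobolevSeminorm (N : ℕ) (p : ℝ≥0∞) [hp : Fact (1 ≤ p)] :
    AddGroupSeminorm (HomSobolev N p) where
  toFun u := (gradNorm p u.toFun).toReal
  map_zero' := by
    change (gradNorm p (0 : Euc N → ℝ)).toReal = 0
    rw [gradNorm_zero, ENNReal.toReal_zero]
  add_le' u v := by
    change (gradNorm p (u.toFun + v.toFun)).toReal ≤ _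
    rw [← ENNReal.toReal_add u.mem.gradNorm_ne_top v.mem.gradNorm_ne_top]
    exact ENNReal.toReal_mono
      (ENNReal.add_ne_top.2 ⟨u.mem.gradNorm_ne_top, v.mem.gradNorm_ne_top⟩)
      (gradNorm_add_le hp.out u.mem v.mem)
  neg' u := by
    change (gradNorm p (-u.toFun)).toReal = _
    exact congrArg ENNReal.toReal (gradNorm_neg u.mem)

instance HomSobolev.instSeminormedAddCommGroup (N : ℕ) (p : ℝ≥0∞) [Fact (1 ≤ p)] :
    SeminormedAddCommGroup (HomSobolev N p) :=
  (homSobolevSeminorm N p).toSeminormedAddCommGroup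

end WeightedReverse

end

/-! The problem splits into one-dimensional ones. If `g` is the weak gradient of `u` and `h` is
fixed, then for almost every `x` the increment u(x + h) - u(x) is the average of ⟨g, h⟩ over the
segment from x to x + h (`HasWeakGradient.ae_sub_eq`). Polar coordinates h = rθ then write the level
functional as an integral over θ of `lineFun`, which only sees averages of f = ⟨g, θ⟩ over segments
of length r. The substitution t = λ r^(γ/p) (`lineFun_eq`) turns it into (p/|γ|) ∫ t^(p-1)
|{|average of f over length (t/λ)^(p/γ)| > t}| dt. In both regimes (γ > 0 with λ → ∞, γ < 0 with λ ↘
0) the length tends to 0 for each fixed t, the averages converge to f in measure, and the layer cake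
formula predicts the limit (1/|γ|) ∫ |f|^p. Integrating over θ produces κ, by rotation invariance.

Fatou's lemma makes the lower bound unconditional (`le_liminf_lineFun`). The upper bound needs an
estimate `lineFun` ≤ C ∫ |f|^p uniform in λ, after which f can be replaced by a continuous compactly
supported function, for which dominated convergence applies (`tendsto_lineFun`). For p > 1 the
estimate follows by truncating f at height t/2 (`lineFun_le_of_one_lt`); for p = 1 and γ outside
[-1, 0] it follows from a Vitali selection of intervals on each line
(`exists_lintegral_bad_intervals_le`).

For p = 1 and -1 ≤ γ < 0 no such estimate exists. For u in C¹ with compact support the limit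
survives because an increment vanishes unless an endpoint lies in the support. In general, sublevel
sets of the level functional are closed in the seminorm topology (`isClosed_levelFunctional_le`), so
Baire's argument only requires functions of bounded energy and arbitrarily large level functional at
arbitrarily small levels (`isMeagre_bounded_levelFunctional`). These come from monotone profiles on
the line: approximations of a Cantor function of dimension 1 + γ if γ > -1, a steep step if γ = -1.
They are cut off in the remaining variables, and then dilated if γ > -1 or compared across levels if
γ = -1. -/

noncomputable section

namespace WeightedReverse

/-! ### Averages over segments -/

/-- Lebesgue measure on the unit interval `(0, 1]`, as a measure on `ℝ`. -/
abbrev unitMeas : Measure ℝ := volume.restrict (Set.Ioc (0 : ℝ) 1)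

instance : IsProbabilityMeasure unitMeas := ⟨by simp [unitMeas]⟩

/-- The average of `f` over the segment from `x` to `x + h`. -/
def lineAvg {N : ℕ} (f : Euc N → ℝ) (h x : Euc N) : ℝ := ∫ s, f (x + s • h) ∂unitMeas

section LineAvg

variable {N : ℕ} {f : Euc N → ℝ}

theorem measurable_lineAvg_uncurry (hf : Measurable f) :
    Measurable (fun z : Euc N × Euc N => lineAvg f z.1 z.2) := by
  have : StronglyMeasurable (fun z : (Euc N × Euc N) × ℝ => f (z.1.2 + z.2 • z.1.1)) :=
    (hf.comp (by fun_prop)).stronglyMeasurable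
  exact (this.integral_prod_right (ν := unitMeas)).measurable

theorem measurable_lineAvg (hf : Measurable f) (h : Euc N) : Measurable (lineAvg f h) :=
  (measurable_lineAvg_uncurry hf).comp (measurable_const.prodMk measurable_id)

/-- By Tonelli and translation invariance each `s` contributes ∫ G, and the `s`-measure has total
mass one. -/
theorem lintegral_segment {G : Euc N → ℝ≥0∞} (hG : Measurable G) (h : Euc N) :
    ∫⁻ x, ∫⁻ s, G (x + s • h) ∂unitMeas = ∫⁻ x, G x := by
  rw [lintegral_lintegral_swap (by
    have : Measurable (fun z : Euc N × ℝ => G (z.1 + z.2 • h)) := hG.comp (by fun_prop)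
    exact this.aemeasurable)]
  simp_rw [lintegral_add_right_eq_self]
  simp

/-- Jensen's inequality on a probability space, in the form of monotonicity of L^q norms in q. -/
theorem enorm_lineAvg_rpow_le (hf : Measurable f) {p : ℝ} (hp : 1 ≤ p) (h x : Euc N) :
    ‖lineAvg f h x‖ₑ ^ p ≤ ∫⁻ s, ‖f (x + s • h)‖ₑ ^ p ∂unitMeas := by
  have h0 : 0 < p := by linarith
  have hm : AEStronglyMeasurable (fun s : ℝ => f (x + s • h)) unitMeas :=
    (hf.comp (by fun_prop)).aestronglyMeasurable
  have h1 : ‖lineAvg f h x‖ₑ ≤ eLpNorm (fun s : ℝ => f (x + s • h)) (ENNReal.ofReal p) unitMeas := by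
    refine (enorm_integral_le_lintegral_enorm _).trans ?_
    rw [← eLpNorm_one_eq_lintegral_enorm]
    exact eLpNorm_le_eLpNorm_of_exponent_le (by simpa using hp) hm
  rw [eLpNorm_eq_lintegral_rpow_enorm_toReal (by simpa using h0) (by simp),
    ENNReal.toReal_ofReal h0.le] at h1
  calc _ ≤ _ := ENNReal.rpow_le_rpow h1 h0.le
    _ = _ := by rw [← ENNReal.rpow_mul, one_div_mul_cancel h0.ne', ENNReal.rpow_one]

/-- Averaging over segments is a contraction in `L^p`. -/
theorem lintegral_lineAvg_rpow_le (hf : Measurable f) {p : ℝ} (hp : 1 ≤ p) (h : Euc N) :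
    ∫⁻ x, ‖lineAvg f h x‖ₑ ^ p ≤ ∫⁻ x, ‖f x‖ₑ ^ p := by
  rw [← lintegral_segment (G := fun x => ‖f x‖ₑ ^ p) (by fun_prop) h]
  exact lintegral_mono fun x => enorm_lineAvg_rpow_le hf hp h x

/-- The Bochner integral is zero off the integrable functions, so additivity of `lineAvg` is only
available where the restriction to the segment is integrable. Finite L^p mass gives this for almost
every segment, since L^p ⊆ L¹ on a probability space. -/
theorem ae_integrable_segment (hf : Measurable f) {p : ℝ} (hp : 1 ≤ p)
    (hfp : ∫⁻ x, ‖f x‖ₑ ^ p ≠ ⊤) (h : Euc N) :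
    ∀ᵐ x, Integrable (fun s : ℝ => f (x + s • h)) unitMeas := by
  have h0 : 0 < p := by linarith
  have hG : Measurable (fun x => ‖f x‖ₑ ^ p) := by fun_prop
  have hm : Measurable fun x => ∫⁻ s, ‖f (x + s • h)‖ₑ ^ p ∂unitMeas :=
    Measurable.lintegral_prod_right' (f := fun z : Euc N × ℝ => ‖f (z.1 + z.2 • h)‖ₑ ^ p)
      (hG.comp (by fun_prop : Measurable fun z : Euc N × ℝ => z.1 + z.2 • h))
  rw [← lintegral_segment hG h] at hfp
  filter_upwards [ae_lt_top hm hfp] with x hx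
  have hmx : AEStronglyMeasurable (fun s : ℝ => f (x + s • h)) unitMeas :=
    (hf.comp (by fun_prop)).aestronglyMeasurable
  have : MemLp (fun s : ℝ => f (x + s • h)) (ENNReal.ofReal p) unitMeas := by
    refine ⟨hmx, ?_⟩
    rw [eLpNorm_lt_top_iff_lintegral_rpow_enorm_lt_top (by simpa using h0) (by simp),
      ENNReal.toReal_ofReal h0.le]
    exact hx
  exact this.integrable (by simpa using hp)

theorem ae_lineAvg_add {f₁ f₂ : Euc N → ℝ} (hf₁ : Measurable f₁) (hf₂ : Measurable f₂)
    {p : ℝ} (hp : 1 ≤ p) (h1 : ∫⁻ x, ‖f₁ x‖ₑ ^ p ≠ ⊤) (h2 : ∫⁻ x, ‖f₂ x‖ₑ ^ p ≠ ⊤) (h : Euc N) :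
    ∀ᵐ x, lineAvg (fun x => f₁ x + f₂ x) h x = lineAvg f₁ h x + lineAvg f₂ h x := by
  filter_upwards [ae_integrable_segment hf₁ hp h1 h, ae_integrable_segment hf₂ hp h2 h]
    with x hx1 hx2
  exact integral_add hx1 hx2

end LineAvg

/-! ### Increments as averages of the weak gradient -/

section WeakGradient

variable {N : ℕ}

theorem enorm_inner_le (v w : Euc N) : ‖(inner ℝ v w : ℝ)‖ₑ ≤ ‖v‖ₑ * ‖w‖ₑ := by
  simp only [enorm_eq_nnnorm]
  exact_mod_cast nnnorm_inner_le_nnnorm (𝕜 := ℝ) v w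

theorem HasWeakGradient.congr {u u' : Euc N → ℝ} {g g' : Euc N → Euc N} (hg : HasWeakGradient u g)
    (hu : u =ᵐ[volume] u') (hgg : g =ᵐ[volume] g') : HasWeakGradient u' g' := by
  refine ⟨hg.1.congr hu, hg.2.congr hgg, fun φ hφ hc => ?_⟩
  have h1 : ∫ x, u' x • gradient φ x = ∫ x, u x • gradient φ x :=
    integral_congr_ae (by filter_upwards [hu] with x hx; rw [hx])
  have h2 : ∫ x, φ x • g' x = ∫ x, φ x • g x :=
    integral_congr_ae (by filter_upwards [hgg] with x hx; rw [hx])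
  rw [h1, h2, hg.3 φ hφ hc]

/-- The shear along `h`, with the translation parameter in the unit interval. -/
theorem measurePreserving_shear (h : Euc N) :
    MeasurePreserving (fun z : Euc N × ℝ => (z.1 + z.2 • h, z.2))
      ((volume : Measure (Euc N)).prod unitMeas) ((volume : Measure (Euc N)).prod unitMeas) := by
  have := (MeasurePreserving.id unitMeas).skew_product (μc := (volume : Measure (Euc N)))
    (μd := (volume : Measure (Euc N))) (g := fun (s : ℝ) (x : Euc N) => x + s • h)
    (by fun_prop) (ae_of_all _ fun s => (measurePreserving_add_right volume (s • h)).map_eq)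
  exact Measure.measurePreserving_swap.comp (this.comp Measure.measurePreserving_swap)

/-- Justifies Fubini for merely locally integrable `f`: the integrand vanishes unless `z.1` lies in
the compact set swept out by the translates of the support of `k`. -/
theorem integrable_mul_shift {f k : Euc N → ℝ} (hf : LocallyIntegrable f volume)
    (hk : Continuous k) (hc : HasCompactSupport k) (h : Euc N) :
    Integrable (fun z : Euc N × ℝ => k (z.1 - z.2 • h) * f z.1)
      ((volume : Measure (Euc N)).prod unitMeas) := by
  obtain ⟨C, hC⟩ := hk.bounded_above_of_compact_support hc
  set K : Set (Euc N) := (fun z : Euc N × ℝ => z.1 + z.2 • h) '' (tsupport k ×ˢ Set.Icc (0 : ℝ) 1)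
  have hK : IsCompact K := (hc.isCompact.prod isCompact_Icc).image (by fun_prop)
  have hfK : Integrable (K.indicator f) volume :=
    (hf.integrableOn_isCompact hK).integrable_indicator hK.measurableSet
  have hdom := (hfK.norm.const_mul C).comp_fst unitMeas
  refine hdom.mono' ?_ ?_
  · exact (((hk.comp (by fun_prop : Continuous fun z : Euc N × ℝ =>
      z.1 - z.2 • h)).aestronglyMeasurable).mul hf.aestronglyMeasurable.comp_fst)
  · have hs : ∀ᵐ z : Euc N × ℝ ∂((volume : Measure (Euc N)).prod unitMeas),
        z.2 ∈ Set.Ioc (0 : ℝ) 1 :=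
      Measure.quasiMeasurePreserving_snd.ae (ae_restrict_mem measurableSet_Ioc)
    filter_upwards [hs] with z hz
    by_cases hzk : k (z.1 - z.2 • h) = 0
    · rw [hzk, zero_mul, norm_zero]
      exact mul_nonneg ((norm_nonneg _).trans (hC 0)) (norm_nonneg _)
    · have hzK : z.1 ∈ K :=
        ⟨(z.1 - z.2 • h, z.2), ⟨subset_tsupport _ hzk, hz.1.le, hz.2⟩, by simp⟩
      rw [Set.indicator_of_mem hzK, norm_mul]
      gcongr
      exact hC _

/-- A function is recovered from its weak gradient along almost every translate of a segment. -/
theorem HasWeakGradient.ae_sub_eq {u : Euc N → ℝ} {g : Euc N → Euc N} (hg : HasWeakGradient u g)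
    (hgm : Measurable g) {p : ℝ} (hp : 1 ≤ p) (hgp : ∫⁻ x, ‖g x‖ₑ ^ p ≠ ⊤) (h : Euc N) :
    ∀ᵐ x, u (x + h) - u x = lineAvg (fun y => inner ℝ (g y) h) h x := by
  set f : Euc N → ℝ := fun y => inner ℝ (g y) h with hfdef
  have hfm : Measurable f := by fun_prop
  have h0 : 0 < p := by linarith
  have hfloc : LocallyIntegrable f volume := by
    intro x
    obtain ⟨s, hs, hi⟩ := hg.2 x
    exact ⟨s, hs, hi.inner_const h⟩
  have hfp : ∫⁻ x, ‖f x‖ₑ ^ p ≠ ⊤ := by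
    refine ne_top_of_le_ne_top (ENNReal.mul_ne_top (b := ‖h‖ₑ ^ p) hgp (by simp [h0.le])) ?_
    rw [← lintegral_mul_const' _ _ (by simp [h0.le])]
    refine lintegral_mono fun x => ?_
    rw [← ENNReal.mul_rpow_of_nonneg _ _ h0.le]
    gcongr
    exact enorm_inner_le _ _
  have hAp : MemLp (lineAvg f h) (ENNReal.ofReal p) volume := by
    refine ⟨(measurable_lineAvg hfm h).aestronglyMeasurable, ?_⟩
    rw [eLpNorm_lt_top_iff_lintegral_rpow_enorm_lt_top (by simpa using h0) (by simp),
      ENNReal.toReal_ofReal h0.le]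
    exact (lintegral_lineAvg_rpow_le hfm hp h).trans_lt hfp.lt_top
  have hush : LocallyIntegrable (fun x => u (x + h)) volume := by
    intro x
    obtain ⟨s, hs, hi⟩ := hg.1 (x + h)
    refine ⟨(fun x => x + h) ⁻¹' s, (continuous_add_const h).continuousAt hs, ?_⟩
    exact ((measurePreserving_add_right volume h).integrableOn_comp_preimage
      (measurableEmbedding_addRight h)).2 hi
  -- Both sides are locally integrable, so it suffices to test against `φ`; the increment is moved
  -- onto `φ` by translation.
  refine ae_eq_of_integral_contDiff_smul_eq (hush.sub hg.1)
    (hAp.locallyIntegrable (by simpa using hp)) fun φ hφ hc => ?_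
  have hφs : ∀ s : ℝ, ContDiff ℝ ∞ (fun x => φ (x - s • h)) := fun s =>
    hφ.comp (contDiff_id.sub contDiff_const)
  have hcs : ∀ s : ℝ, HasCompactSupport (fun x => φ (x - s • h)) := fun s =>
    hc.comp_homeomorph (Homeomorph.subRight (s • h))
  have hgrad : ∀ (s : ℝ) x, gradient (fun x => φ (x - s • h)) x = gradient φ (x - s • h) := by
    intro s x
    have h1 : HasFDerivAt φ (fderiv ℝ φ (x - s • h)) (x - s • h) :=
      (hφ.differentiable (by simp) _).hasFDerivAt
    have h2 := h1.comp x ((hasFDerivAt_id x).sub_const (s • h))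
    simp only [gradient]
    congr 1
    exact h2.fderiv
  have hcont : Continuous fun x => inner ℝ (gradient φ x) h :=
    (continuous_gradient hφ).inner continuous_const
  have hcomp : HasCompactSupport fun x => (inner ℝ (gradient φ x) h : ℝ) :=
    (hasCompactSupport_gradient hc).comp_left (g := fun v => (inner ℝ v h : ℝ)) (by simp)
  -- the fundamental theorem of calculus for the test function
  have hftc : ∀ x, φ x - φ (x - h) = ∫ s, inner ℝ (gradient φ (x - s • h)) h ∂unitMeas := by
    intro x
    have hd : ∀ s : ℝ, HasDerivAt (fun s : ℝ => -φ (x - s • h))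
        (inner ℝ (gradient φ (x - s • h)) h) s := by
      intro s
      have h1 : HasFDerivAt φ (fderiv ℝ φ (x - s • h)) (x - s • h) :=
        (hφ.differentiable (by simp) _).hasFDerivAt
      have h2 : HasDerivAt (fun s : ℝ => x - s • h) (-h) s := by
        simpa using ((hasDerivAt_id s).smul_const h).const_sub x
      have h3 := (h1.comp_hasDerivAt s h2).neg
      refine h3.congr_deriv ?_
      simp [gradient, InnerProductSpace.toDual_symm_apply]
    have := intervalIntegral.integral_eq_sub_of_hasDerivAt (a := 0) (b := 1) (fun s _ => hd s)
      ((hcont.comp (by fun_prop : Continuous fun s : ℝ => x - s • h)).intervalIntegrable _ _)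
    rw [intervalIntegral.integral_of_le zero_le_one] at this
    refine Eq.trans ?_ this.symm
    simp; ring
  -- both sides equal `∫ s, ∫ x, φ (x - s h) f x`
  have hR : ∫ x, φ x • lineAvg f h x = ∫ s, (∫ x, φ (x - s • h) * f x) ∂unitMeas := by
    have hi : Integrable (fun z : Euc N × ℝ => φ z.1 * f (z.1 + z.2 • h))
        ((volume : Measure (Euc N)).prod unitMeas) := by
      have := (measurePreserving_shear h).integrable_comp_of_integrable
        (integrable_mul_shift hfloc hφ.continuous hc h)
      simpa [Function.comp_def] using this
    calc ∫ x, φ x • lineAvg f h x = ∫ x, ∫ s, φ x * f (x + s • h) ∂unitMeas := by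
          simp only [lineAvg, smul_eq_mul, integral_const_mul]
      _ = ∫ s, (∫ x, φ x * f (x + s • h)) ∂unitMeas := integral_integral_swap hi
      _ = _ := by
          congr 1 with s
          rw [← integral_add_right_eq_self (fun x => φ (x - s • h) * f x) (s • h)]
          simp
  have hL : ∫ x, φ x • (u (x + h) - u x) = ∫ s, (∫ x, φ (x - s • h) * f x) ∂unitMeas := by
    have hi := integrable_mul_shift hg.1 hcont hcomp h
    have hi1 : Integrable (fun x => φ x * u (x + h)) := by
      simpa using hush.integrable_smul_left_of_hasCompactSupport hφ.continuous hc
    have hi2 : Integrable (fun x => φ x * u x) := by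
      simpa using hg.1.integrable_smul_left_of_hasCompactSupport hφ.continuous hc
    have hi3 : Integrable (fun x => φ (x - h) * u x) := by
      simpa using hg.1.integrable_smul_left_of_hasCompactSupport (hφs 1).continuous (hcs 1)
    have e1 : ∫ x, φ x * u (x + h) = ∫ x, φ (x - h) * u x := by
      rw [← integral_add_right_eq_self (fun x => φ (x - h) * u x) h]; simp
    calc ∫ x, φ x • (u (x + h) - u x) = (∫ x, φ (x - h) * u x) - ∫ x, φ x * u x := by
          rw [← e1, ← integral_sub hi1 hi2]; simp [mul_sub]
      _ = ∫ x, -∫ s, inner ℝ (gradient φ (x - s • h)) h * u x ∂unitMeas := by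
          rw [← integral_sub hi3 hi2]
          congr 1 with x
          rw [integral_mul_const, ← hftc]; ring
      _ = -∫ s, (∫ x, inner ℝ (gradient φ (x - s • h)) h * u x) ∂unitMeas := by
          rw [integral_neg, integral_integral_swap hi]
      _ = _ := by
          rw [← integral_neg]
          congr 1 with s
          -- The vector identity defining the weak gradient, for the test function φ(· - s h),
          -- contracted with `h`.
          have := hg.3 _ (hφs s) (hcs s)
          have e2 := congrArg (fun v => (inner ℝ h v : ℝ)) this
          simp only [inner_neg_right] at e2
          rw [← integral_inner (integrable_smul_gradient hg.1 (hφs s) (hcs s)),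
            ← integral_inner (integrable_smul_field hg.2 (hφs s) (hcs s))] at e2
          simp only [hgrad, real_inner_comm _ h, real_inner_smul_left] at e2
          simp only [hfdef]
          rw [neg_eq_iff_eq_neg, ← e2]
          simp only [mul_comm]
  rw [hL, hR]

end WeakGradient

/-! ### The level functional in polar coordinates -/

section Polar

variable {N : ℕ}

theorem superlevel_ae_eq {u v : Euc N → ℝ} (h : u =ᵐ[volume] v) (lam b : ℝ) :
    superlevel lam b u =ᵐ[(volume : Measure (Euc N × Euc N))] superlevel lam b v := by
  have h1 : ∀ᵐ z : Euc N × Euc N, u z.1 = v z.1 := Measure.quasiMeasurePreserving_fst.ae h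
  have h2 : ∀ᵐ z : Euc N × Euc N, u z.2 = v z.2 := Measure.quasiMeasurePreserving_snd.ae h
  filter_upwards [h1, h2] with z hz1 hz2
  change (z ∈ superlevel lam b u) = (z ∈ superlevel lam b v)
  simp only [superlevel, diffQuot, Set.mem_ofPred_eq, hz1, hz2]

theorem nu_absolutelyContinuous (N : ℕ) (γ : ℝ) :
    nu N γ ≪ (volume : Measure (Euc N × Euc N)) :=
  (withDensity_absolutelyContinuous _ _).trans Measure.absolutelyContinuous_restrict

/-- Allows `u` to be replaced by a Borel representative. -/
theorem levelFunctional_congr {u v : Euc N → ℝ} (h : u =ᵐ[volume] v) (p γ : ℝ) :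
    levelFunctional p γ u = levelFunctional p γ v := by
  ext lam
  unfold levelFunctional
  rw [measure_congr ((nu_absolutelyContinuous N γ).ae_le (superlevel_ae_eq h lam (γ / p)))]

theorem measurableSet_superlevel {u : Euc N → ℝ} (hu : Measurable u) (lam b : ℝ) :
    MeasurableSet (superlevel lam b u) := by
  refine MeasurableSet.inter ?_ ?_
  · exact (measurableSet_eq_fun measurable_fst measurable_snd).compl
  · have : Measurable fun z : Euc N × Euc N => |diffQuot b u z.1 z.2| := by
      unfold diffQuot; fun_prop
    exact measurableSet_lt measurable_const this

theorem lt_abs_diffQuot_iff {u : Euc N → ℝ} {lam b : ℝ} {x y : Euc N} (hxy : x ≠ y) :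
    lam < |diffQuot b u x y| ↔ lam * ‖x - y‖ ^ (1 + b) < |u x - u y| := by
  have : 0 < ‖x - y‖ ^ (1 + b) := Real.rpow_pos_of_pos (norm_pos_iff.2 (sub_ne_zero.2 hxy)) _
  rw [diffQuot, abs_div, abs_of_pos this, lt_div_iff₀ this]

/-- The shear (x, h) ↦ (x, x + h) preserves Lebesgue measure, and the density depends on `h` alone.
-/
theorem nu_superlevel_eq {u : Euc N → ℝ} (hu : Measurable u) (γ b : ℝ) {lam : ℝ} (hl : 0 ≤ lam) :
    nu N γ (superlevel lam b u) = ∫⁻ h : Euc N, ENNReal.ofReal (‖h‖ ^ (γ - (N : ℝ))) *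
      volume {x | lam * ‖h‖ ^ (1 + b) < |u (x + h) - u x|} := by
  set d : Euc N × Euc N → ℝ≥0∞ := fun z => ENNReal.ofReal (‖z.1 - z.2‖ ^ (γ - (N : ℝ)))
  have hE := measurableSet_superlevel hu lam b
  have hd : Measurable d := by fun_prop
  have hsub : superlevel lam b u ∩ {z : Euc N × Euc N | z.1 ≠ z.2} = superlevel lam b u :=
    Set.inter_eq_left.2 fun z hz => hz.1
  rw [nu, withDensity_apply _ hE, Measure.restrict_restrict hE, hsub, ← lintegral_indicator hE]
  change ∫⁻ z, (superlevel lam b u).indicator d z ∂(volume.prod volume) = _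
  rw [← (measurePreserving_prod_add (volume : Measure (Euc N)) volume).lintegral_comp
      (hd.indicator hE), lintegral_prod_symm' (fun z : Euc N × Euc N =>
        (superlevel lam b u).indicator d (z.1, z.1 + z.2)) ((hd.indicator hE).comp (by fun_prop))]
  refine lintegral_congr fun h => ?_
  have hS : MeasurableSet {x | lam * ‖h‖ ^ (1 + b) < |u (x + h) - u x|} :=
    measurableSet_lt measurable_const (by fun_prop)
  rw [← lintegral_indicator_const hS]
  refine lintegral_congr fun x => ?_
  -- At `h = 0` the left set excludes the diagonal, and the right one is empty because the threshold
  -- is nonnegative.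
  by_cases hh : h = 0
  · have h1 : (x, x + h) ∉ superlevel lam b u := fun hx => hx.1 (by simp [hh])
    have h2 : x ∉ {x | lam * ‖h‖ ^ (1 + b) < |u (x + h) - u x|} := by
      simp only [Set.mem_ofPred_eq, hh, add_zero, sub_self, abs_zero, not_lt]
      positivity
    rw [Set.indicator_of_notMem h1, Set.indicator_of_notMem h2]
  · have hne : x ≠ x + h := by simpa using hh
    have hiff : (x, x + h) ∈ superlevel lam b u ↔
        x ∈ {x | lam * ‖h‖ ^ (1 + b) < |u (x + h) - u x|} := by
      simp only [superlevel, Set.mem_ofPred_eq, lt_abs_diffQuot_iff hne]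
      rw [abs_sub_comm (u x)]
      simp [hh]
    by_cases hx : (x, x + h) ∈ superlevel lam b u
    · rw [Set.indicator_of_mem hx, Set.indicator_of_mem (hiff.1 hx)]
      simp [d]
    · rw [Set.indicator_of_notMem hx, Set.indicator_of_notMem (fun h => hx (hiff.2 h))]

/-- Integration in polar coordinates. -/
theorem lintegral_polar (hN : 1 ≤ N) {G : Euc N → ℝ≥0∞} (hG : Measurable G) :
    ∫⁻ h, G h = ∫⁻ θ : Metric.sphere (0 : Euc N) 1, (∫⁻ r in Set.Ioi (0 : ℝ),
      ENNReal.ofReal (r ^ (N - 1)) * G (r • (θ : Euc N)))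
      ∂((volume : Measure (Euc N)).toSphere) := by
  have : Nonempty (Fin N) := ⟨⟨0, hN⟩⟩
  have hmp := (volume : Measure (Euc N)).measurePreserving_homeomorphUnitSphereProd
  have hG' : Measurable fun z : Metric.sphere (0 : Euc N) 1 × Set.Ioi (0 : ℝ) =>
      G ((z.2 : ℝ) • (z.1 : Euc N)) := hG.comp (by fun_prop)
  calc ∫⁻ h, G h = ∫⁻ h in ({0}ᶜ : Set (Euc N)), G h := by rw [restrict_compl_singleton]
    _ = ∫⁻ h : ({0}ᶜ : Set (Euc N)), G h ∂(volume.comap Subtype.val) := by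
        rw [lintegral_subtype_comap (measurableSet_singleton _).compl]
    _ = ∫⁻ z, G ((z.2 : ℝ) • (z.1 : Euc N)) ∂((volume : Measure (Euc N)).toSphere.prod
          (.volumeIoiPow (Module.finrank ℝ (Euc N) - 1))) := by
        rw [← hmp.lintegral_comp hG']
        refine lintegral_congr fun h => ?_
        congr 1
        simp [smul_smul, mul_inv_cancel₀ (norm_ne_zero_iff.2 h.2)]
    _ = ∫⁻ θ, ∫⁻ r, G ((r : ℝ) • (θ : Euc N))
          ∂(Measure.volumeIoiPow (Module.finrank ℝ (Euc N) - 1))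
          ∂((volume : Measure (Euc N)).toSphere) := lintegral_prod _ hG'.aemeasurable
    _ = _ := by
        refine lintegral_congr fun θ => ?_
        have hGθ : Measurable fun r : Set.Ioi (0 : ℝ) => G ((r : ℝ) • (θ : Euc N)) :=
          hG.comp (by fun_prop)
        rw [Measure.volumeIoiPow, lintegral_withDensity_eq_lintegral_mul _ (by fun_prop) hGθ,
          ← lintegral_subtype_comap measurableSet_Ioi]
        simp

/-- The Jacobian r^(N-1) turns the weight r^(γ-N) into r^(γ-1), which no longer involves the
dimension. -/
theorem levelFunctional_eq_polar (hN : 1 ≤ N) {u : Euc N → ℝ} (hu : Measurable u) (p γ : ℝ)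
    {lam : ℝ} (hl : 0 ≤ lam) :
    levelFunctional p γ u lam = ∫⁻ θ : Metric.sphere (0 : Euc N) 1, (∫⁻ r in Set.Ioi (0 : ℝ),
      ENNReal.ofReal (lam ^ p * r ^ (γ - 1)) *
        volume {x | lam * r ^ (1 + γ / p) < |u (x + r • (θ : Euc N)) - u x|})
      ∂((volume : Measure (Euc N)).toSphere) := by
  have hm : Measurable fun h : Euc N => volume {x | lam * ‖h‖ ^ (1 + γ / p) < |u (x + h) - u x|} := by
    have hS : MeasurableSet {z : Euc N × Euc N |
        lam * ‖z.1‖ ^ (1 + γ / p) < |u (z.2 + z.1) - u z.2|} :=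
      measurableSet_lt (by fun_prop) (by fun_prop)
    exact measurable_measure_prodMk_left hS
  rw [levelFunctional, nu_superlevel_eq hu _ _ hl, lintegral_polar hN (by fun_prop),
    ← lintegral_const_mul' _ _ ENNReal.ofReal_ne_top]
  refine lintegral_congr fun θ => ?_
  rw [← lintegral_const_mul' _ _ ENNReal.ofReal_ne_top]
  refine setLIntegral_congr_fun measurableSet_Ioi fun r hr => ?_
  have hr : 0 < r := hr
  have hnorm : ‖r • (θ : Euc N)‖ = r := by rw [norm_smul, norm_eq_of_mem_sphere]; simp [hr.le]
  simp only [hnorm]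
  rw [← mul_assoc, ← mul_assoc, ← ENNReal.ofReal_mul (by positivity),
    ← ENNReal.ofReal_mul (by positivity)]
  congr 2
  rw [mul_assoc, ← Real.rpow_natCast, ← Real.rpow_add hr, Nat.cast_sub hN]
  congr 2
  push_cast; ring

theorem measurable_polar_inner {u : Euc N → ℝ} (hu : Measurable u) (p γ lam : ℝ) :
    Measurable fun θ : Metric.sphere (0 : Euc N) 1 => ∫⁻ r in Set.Ioi (0 : ℝ),
      ENNReal.ofReal (lam ^ p * r ^ (γ - 1)) *
        volume {x | lam * r ^ (1 + γ / p) < |u (x + r • (θ : Euc N)) - u x|} := by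
  have hm : Measurable fun z : Metric.sphere (0 : Euc N) 1 × ℝ =>
      volume {x | lam * z.2 ^ (1 + γ / p) < |u (x + z.2 • (z.1 : Euc N)) - u x|} := by
    have hS : MeasurableSet {z : (Metric.sphere (0 : Euc N) 1 × ℝ) × Euc N |
        lam * z.1.2 ^ (1 + γ / p) < |u (z.2 + z.1.2 • (z.1.1 : Euc N)) - u z.2|} :=
      measurableSet_lt (by fun_prop) (by fun_prop)
    exact measurable_measure_prodMk_left hS
  exact Measurable.lintegral_prod_right' (f := fun z : Metric.sphere (0 : Euc N) 1 × ℝ =>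
    ENNReal.ofReal (lam ^ p * z.2 ^ (γ - 1)) *
      volume {x | lam * z.2 ^ (1 + γ / p) < |u (x + z.2 • (z.1 : Euc N)) - u x|}) (by fun_prop)

end Polar

/-! ### Rotation invariance and the constant κ -/

section Kappa

variable {N : ℕ}

/-- The reflection in the hyperplane orthogonal to `v - w`. -/
theorem exists_isometry_map {v w : Euc N} (h : ‖v‖ = ‖w‖) :
    ∃ A : Euc N ≃ₗᵢ[ℝ] Euc N, A v = w :=
  ⟨_, Submodule.reflection_sub h⟩

/-- Rotation invariance is available for Lebesgue measure on the ball. The ball integral is the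
sphere integral times a radial factor `c`, which is positive and finite and hence cancels. -/
theorem lintegral_sphere_inner_eq (hN : 1 ≤ N) {p : ℝ} (hp : 0 < p) {v w : Euc N} (h : ‖v‖ = ‖w‖) :
    ∫⁻ θ : Metric.sphere (0 : Euc N) 1, ‖(inner ℝ v (θ : Euc N) : ℝ)‖ₑ ^ p
      ∂((volume : Measure (Euc N)).toSphere) =
    ∫⁻ θ : Metric.sphere (0 : Euc N) 1, ‖(inner ℝ w (θ : Euc N) : ℝ)‖ₑ ^ p
      ∂((volume : Measure (Euc N)).toSphere) := by
  set c : ℝ≥0∞ := ∫⁻ r in Set.Ioo (0 : ℝ) 1, ENNReal.ofReal (r ^ (N - 1)) * ‖r‖ₑ ^ p with hc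
  have key : ∀ v : Euc N, ∫⁻ x in Metric.ball (0 : Euc N) 1, ‖(inner ℝ v x : ℝ)‖ₑ ^ p =
      (∫⁻ θ : Metric.sphere (0 : Euc N) 1, ‖(inner ℝ v (θ : Euc N) : ℝ)‖ₑ ^ p
        ∂((volume : Measure (Euc N)).toSphere)) * c := by
    intro v
    have hm : Measurable fun θ : Metric.sphere (0 : Euc N) 1 =>
        ‖(inner ℝ v (θ : Euc N) : ℝ)‖ₑ ^ p := by fun_prop
    rw [← lintegral_indicator Metric.isOpen_ball.measurableSet,
      lintegral_polar hN (Measurable.indicator (by fun_prop) Metric.isOpen_ball.measurableSet),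
      ← lintegral_mul_const _ hm]
    refine lintegral_congr fun θ => ?_
    rw [hc, ← lintegral_const_mul _ (by fun_prop), ← lintegral_indicator measurableSet_Ioi,
      ← lintegral_indicator measurableSet_Ioo]
    refine lintegral_congr fun r => ?_
    by_cases hr : 0 < r
    · have hnorm : ‖r • (θ : Euc N)‖ = r := by
        rw [norm_smul, norm_eq_of_mem_sphere]; simp [hr.le]
      by_cases hr1 : r < 1
      · rw [Set.indicator_of_mem (by exact hr), Set.indicator_of_mem (by simpa [hnorm] using hr1),
          Set.indicator_of_mem (show r ∈ Set.Ioo (0 : ℝ) 1 from ⟨hr, hr1⟩), real_inner_smul_right, enorm_mul,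
          ENNReal.mul_rpow_of_nonneg _ _ hp.le]
        ring
      · rw [Set.indicator_of_mem (by exact hr),
          Set.indicator_of_notMem (by simpa [hnorm] using hr1),
          Set.indicator_of_notMem (fun h => hr1 h.2), mul_zero]
    · rw [Set.indicator_of_notMem (by exact hr), Set.indicator_of_notMem (fun h => hr h.1)]
  have hc0 : c ≠ 0 := by
    rw [hc, ← pos_iff_ne_zero, setLIntegral_pos_iff (by fun_prop)]
    refine lt_of_lt_of_le (by simp : 0 < volume (Set.Ioo (0 : ℝ) 1))
      (measure_mono fun r hr => ⟨?_, hr⟩)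
    have hr0 : 0 < r := hr.1
    have h1 : ENNReal.ofReal (r ^ (N - 1)) ≠ 0 := by simpa using pow_pos hr0 _
    have h2 : ‖r‖ₑ ^ p ≠ 0 := by simp [hr0.ne']
    exact mul_ne_zero h1 h2
  have hct : c ≠ ⊤ := by
    refine ne_top_of_le_ne_top (b := ∫⁻ r in Set.Ioo (0 : ℝ) 1, 1) (by simp) ?_
    refine setLIntegral_mono measurable_const fun r hr => ?_
    have h1 : ‖r‖ₑ ≤ 1 := by
      rw [Real.enorm_eq_ofReal hr.1.le]; simpa using hr.2.le
    calc _ ≤ (1 : ℝ≥0∞) * 1 := by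
          gcongr
          · simpa using pow_le_one₀ hr.1.le hr.2.le
          · exact ENNReal.rpow_le_one h1 hp.le
      _ = 1 := one_mul 1
  obtain ⟨A, hA⟩ := exists_isometry_map h
  have hball : ∫⁻ x in Metric.ball (0 : Euc N) 1, ‖(inner ℝ v x : ℝ)‖ₑ ^ p =
      ∫⁻ x in Metric.ball (0 : Euc N) 1, ‖(inner ℝ w x : ℝ)‖ₑ ^ p := by
    rw [← (A.measurePreserving.setLIntegral_comp_preimage Metric.isOpen_ball.measurableSet
      (by fun_prop : Measurable fun x => ‖(inner ℝ w x : ℝ)‖ₑ ^ p))]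
    simp [← hA]
  rw [key, key] at hball
  exact (ENNReal.mul_left_inj hc0 hct).1 hball

/-- The constant `κ(p, N)` computed with an arbitrary vector. -/
theorem lintegral_sphere_inner (hN : 1 ≤ N) {p : ℝ} (hp : 0 < p) {e : Euc N} (he : ‖e‖ = 1)
    (v : Euc N) :
    ∫⁻ θ : Metric.sphere (0 : Euc N) 1, ‖(inner ℝ v (θ : Euc N) : ℝ)‖ₑ ^ p
      ∂((volume : Measure (Euc N)).toSphere) = ENNReal.ofReal (kappa p e) * ‖v‖ₑ ^ p := by
  -- Replacing `v` by the multiple of `e` of the same length lets the scalar be pulled out by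
  -- homogeneity.
  have h1 : ‖v‖ = ‖‖v‖ • e‖ := by simp [norm_smul, he]
  rw [lintegral_sphere_inner_eq hN hp h1]
  simp only [real_inner_smul_left, enorm_mul, ENNReal.mul_rpow_of_nonneg _ _ hp.le, enorm_norm]
  rw [lintegral_const_mul' _ _ (by simp [hp.le]), mul_comm, kappa,
    ofReal_integral_eq_lintegral_ofReal]
  · congr 1
    refine lintegral_congr fun θ => ?_
    rw [Real.enorm_eq_ofReal_abs, ENNReal.ofReal_rpow_of_nonneg (abs_nonneg _) hp.le]
  · refine Integrable.of_bound (C := 1)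
      (by have := hp.le; fun_prop (disch := assumption)) (ae_of_all _ fun θ => ?_)
    rw [Real.norm_of_nonneg (by positivity)]
    refine Real.rpow_le_one (abs_nonneg _) ?_ hp.le
    simpa [he] using abs_real_inner_le_norm e (θ : Euc N)
  · exact ae_of_all _ fun _ => by positivity

end Kappa

/-! ### The directional functional and its change of variables -/

/-- The radius at which the height `t` is tested at level `lam`. -/
def scale (p γ lam t : ℝ) : ℝ := (t / lam) ^ (p / γ)

/-- The contribution of the direction `θ` to the level functional, in terms of the
derivative `f` in that direction. -/
def lineFun {N : ℕ} (p γ : ℝ) (f : Euc N → ℝ) (θ : Euc N) (lam : ℝ) : ℝ≥0∞ :=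
  ∫⁻ r in Set.Ioi (0 : ℝ), ENNReal.ofReal (lam ^ p * r ^ (γ - 1)) *
    volume {x | lam * r ^ (γ / p) < |lineAvg f (r • θ) x|}

theorem scale_pos {p γ lam t : ℝ} (hl : 0 < lam) (ht : 0 < t) : 0 < scale p γ lam t :=
  Real.rpow_pos_of_pos (div_pos ht hl) _

theorem mul_scale_rpow {p γ lam t : ℝ} (hp : p ≠ 0) (hγ : γ ≠ 0) (hl : 0 < lam) (ht : 0 < t) :
    lam * scale p γ lam t ^ (γ / p) = t := by
  rw [scale, ← Real.rpow_mul (by positivity), div_mul_div_cancel₀ hγ, div_self hp, Real.rpow_one]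
  field_simp

theorem scale_mul_rpow {p γ lam r : ℝ} (hp : p ≠ 0) (hγ : γ ≠ 0) (hl : 0 < lam) (hr : 0 < r) :
    scale p γ lam (lam * r ^ (γ / p)) = r := by
  rw [scale, mul_div_cancel_left₀ _ hl.ne', ← Real.rpow_mul hr.le, div_mul_div_cancel₀ hp,
    div_self hγ, Real.rpow_one]

theorem measurable_scale (p γ lam : ℝ) : Measurable (scale p γ lam) := by
  unfold scale; fun_prop

/-- Substitution r = (t/λ)^(p/γ), a bijection of (0, ∞) that is decreasing when γ < 0, whence the
absolute value. All powers of λ cancel in the weight. -/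
theorem lintegral_scale {p γ lam : ℝ} (hp : 0 < p) (hγ : γ ≠ 0) (hl : 0 < lam)
    (H : ℝ → ℝ → ℝ≥0∞) :
    ∫⁻ r in Set.Ioi (0 : ℝ), ENNReal.ofReal (lam ^ p * r ^ (γ - 1)) * H r (lam * r ^ (γ / p)) =
      ∫⁻ t in Set.Ioi (0 : ℝ), ENNReal.ofReal (p / |γ| * t ^ (p - 1)) *
        H (scale p γ lam t) t := by
  have himg : scale p γ lam '' Set.Ioi 0 = Set.Ioi 0 := by
    ext r
    constructor
    · rintro ⟨t, ht, rfl⟩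
      exact scale_pos hl ht
    · intro hr
      have hr : 0 < r := hr
      exact ⟨lam * r ^ (γ / p), by simp only [Set.mem_Ioi]; positivity,
        scale_mul_rpow hp.ne' hγ hl hr⟩
  have hinj : Set.InjOn (scale p γ lam) (Set.Ioi 0) := by
    intro a ha b hb hab
    rw [← mul_scale_rpow hp.ne' hγ hl ha, hab, mul_scale_rpow hp.ne' hγ hl hb]
  have hder : ∀ t ∈ Set.Ioi (0 : ℝ), HasDerivWithinAt (scale p γ lam)
      (lam⁻¹ * (p / γ) * (t / lam) ^ (p / γ - 1)) (Set.Ioi 0) t := by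
    intro t ht
    have ht : 0 < t := ht
    have h1 : HasDerivAt (fun t => t / lam) (lam⁻¹) t := by
      simpa using (hasDerivAt_id t).div_const lam
    exact (h1.rpow_const (Or.inl (by positivity))).hasDerivWithinAt
  rw [← himg, lintegral_image_eq_lintegral_abs_deriv_mul measurableSet_Ioi hder hinj, himg]
  refine setLIntegral_congr_fun measurableSet_Ioi fun t ht => ?_
  have ht : 0 < t := ht
  simp only [mul_scale_rpow hp.ne' hγ hl ht]
  rw [← mul_assoc, ← ENNReal.ofReal_mul (abs_nonneg _)]
  congr 2
  have hq : 0 < t / lam := by positivity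
  rw [abs_mul, abs_mul, abs_div, abs_of_pos hp, abs_of_pos (inv_pos.2 hl),
    abs_of_pos (Real.rpow_pos_of_pos hq _), scale, ← Real.rpow_mul hq.le]
  have e1 : (t / lam) ^ (p / γ - 1) * (t / lam) ^ (p / γ * (γ - 1)) = (t / lam) ^ (p - 1) := by
    rw [← Real.rpow_add hq]; congr 1; field_simp; ring
  have e2 : lam ^ p * lam⁻¹ = lam ^ (p - 1) := by
    rw [Real.rpow_sub_one hl.ne']; rfl
  calc _ = p / |γ| * (lam ^ p * lam⁻¹) *
        ((t / lam) ^ (p / γ - 1) * (t / lam) ^ (p / γ * (γ - 1))) := by ring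
    _ = p / |γ| * t ^ (p - 1) := by
        rw [e1, e2, Real.div_rpow ht.le hl.le]
        have : lam ^ (p - 1) ≠ 0 := (Real.rpow_pos_of_pos hl _).ne'
        field_simp

/-- The form in which limits are taken: λ enters only through the length of the averaging segment.
-/
theorem lineFun_eq {N : ℕ} {p γ lam : ℝ} (hp : 0 < p) (hγ : γ ≠ 0) (hl : 0 < lam)
    (f : Euc N → ℝ) (θ : Euc N) :
    lineFun p γ f θ lam = ∫⁻ t in Set.Ioi (0 : ℝ), ENNReal.ofReal (p / |γ| * t ^ (p - 1)) *
      volume {x | t < |lineAvg f (scale p γ lam t • θ) x|} :=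
  lintegral_scale hp hγ hl fun r t => volume {x | t < |lineAvg f (r • θ) x|}

theorem lineAvg_const_mul {N : ℕ} (c : ℝ) (f : Euc N → ℝ) (h x : Euc N) :
    lineAvg (fun y => c * f y) h x = c * lineAvg f h x :=
  integral_const_mul c _

/-- The level functional is the integral over the sphere of its directional contributions. -/
theorem polar_inner_eq_lineFun {N : ℕ} {u : Euc N → ℝ} {g : Euc N → Euc N}
    (hg : HasWeakGradient u g) (hgm : Measurable g) {p : ℝ} (hp : 1 ≤ p)
    (hgp : ∫⁻ x, ‖g x‖ₑ ^ p ≠ ⊤) (γ : ℝ) (lam : ℝ) (θ : Euc N) :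
    ∫⁻ r in Set.Ioi (0 : ℝ), ENNReal.ofReal (lam ^ p * r ^ (γ - 1)) *
        volume {x | lam * r ^ (1 + γ / p) < |u (x + r • θ) - u x|} =
      lineFun p γ (fun y => inner ℝ (g y) θ) θ lam := by
  refine setLIntegral_congr_fun measurableSet_Ioi fun r hr => ?_
  have hr : 0 < r := hr
  congr 1
  refine measure_congr ?_
  filter_upwards [hg.ae_sub_eq hgm hp hgp (r • θ)] with x hx
  change (_ < _) = (_ < _)
  rw [hx]
  simp only [real_inner_smul_right]
  -- One factor r of r^(1 + γ/p) cancels against the length of the vector rθ.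
  rw [lineAvg_const_mul, abs_mul, abs_of_pos hr, Real.rpow_add hr, Real.rpow_one, mul_left_comm,
    mul_lt_mul_iff_right₀ hr]

theorem levelFunctional_eq_lineFun {N : ℕ} (hN : 1 ≤ N) {u : Euc N → ℝ} {g : Euc N → Euc N}
    (hg : HasWeakGradient u g) (hu : Measurable u) (hgm : Measurable g) {p : ℝ} (hp : 1 ≤ p)
    (hgp : ∫⁻ x, ‖g x‖ₑ ^ p ≠ ⊤) (γ : ℝ) {lam : ℝ} (hl : 0 ≤ lam) :
    levelFunctional p γ u lam = ∫⁻ θ : Metric.sphere (0 : Euc N) 1,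
      lineFun p γ (fun y => inner ℝ (g y) (θ : Euc N)) θ lam
      ∂((volume : Measure (Euc N)).toSphere) := by
  rw [levelFunctional_eq_polar hN hu p γ hl]
  exact lintegral_congr fun θ => polar_inner_eq_lineFun hg hgm hp hgp γ lam θ

/-- Here the function being averaged varies with `θ`; measurability is read off from the expression
through increments of `u`. -/
theorem measurable_lineFun {N : ℕ} {u : Euc N → ℝ} {g : Euc N → Euc N}
    (hg : HasWeakGradient u g) (hu : Measurable u) (hgm : Measurable g) {p : ℝ} (hp : 1 ≤ p)
    (hgp : ∫⁻ x, ‖g x‖ₑ ^ p ≠ ⊤) (γ lam : ℝ) :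
    Measurable fun θ : Metric.sphere (0 : Euc N) 1 =>
      lineFun p γ (fun y => inner ℝ (g y) (θ : Euc N)) θ lam := by
  simp_rw [← polar_inner_eq_lineFun hg hgm hp hgp γ lam]
  exact measurable_polar_inner hu p γ lam

/-! ### Superlevel sets: Chebyshev, semicontinuity, layer cake -/

section Measure

variable {α : Type*} [MeasurableSpace α] {μ : Measure α}

theorem ofReal_rpow_mul_meas_lt_abs_le {F : α → ℝ} (hF : Measurable F) {p ε : ℝ} (hp : 0 ≤ p)
    (hε : 0 ≤ ε) : ENNReal.ofReal (ε ^ p) * μ {x | ε < |F x|} ≤ ∫⁻ x, ‖F x‖ₑ ^ p ∂μ := by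
  refine le_trans ?_ (mul_meas_ge_le_lintegral (by fun_prop) (ENNReal.ofReal (ε ^ p)))
  gcongr with x
  intro hx
  have hx : ε < |F x| := hx
  rw [Real.enorm_eq_ofReal_abs, ENNReal.ofReal_rpow_of_nonneg (abs_nonneg _) hp]
  gcongr

theorem meas_lt_abs_le {F : α → ℝ} (hF : Measurable F) {p ε : ℝ} (hp : 0 ≤ p)
    (hε : 0 < ε) : μ {x | ε < |F x|} ≤ (∫⁻ x, ‖F x‖ₑ ^ p ∂μ) / ENNReal.ofReal (ε ^ p) := by
  rw [ENNReal.le_div_iff_mul_le (Or.inl (by simpa using Real.rpow_pos_of_pos hε p))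
    (Or.inl ENNReal.ofReal_ne_top), mul_comm]
  exact ofReal_rpow_mul_meas_lt_abs_le hF hp hε.le

/-- The measure of strict superlevel sets is lower semicontinuous under convergence in measure. -/
theorem meas_lt_abs_le_liminf {ι : Type*} {l : Filter ι} {F : ι → α → ℝ} {f : α → ℝ}
    (hF : ∀ ε : ℝ, 0 < ε → Tendsto (fun i => μ {x | ε < |F i x - f x|}) l (𝓝 0)) (t : ℝ) :
    μ {x | t < |f x|} ≤ liminf (fun i => μ {x | t < |F i x|}) l := by
  have hU : {x | t < |f x|} = ⋃ n : ℕ, {x | t + 1 / ((n : ℝ) + 1) < |f x|} := by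
    ext x
    simp only [Set.mem_ofPred_eq, Set.mem_iUnion]
    constructor
    · intro hx
      obtain ⟨n, hn⟩ := exists_nat_one_div_lt (sub_pos.2 hx)
      exact ⟨n, by linarith⟩
    · rintro ⟨n, hn⟩
      have : (0 : ℝ) < 1 / ((n : ℝ) + 1) := by positivity
      linarith
  have hmono : Monotone fun n : ℕ => {x | t + 1 / ((n : ℝ) + 1) < |f x|} := by
    intro m n hmn x hx
    have hx : t + 1 / ((m : ℝ) + 1) < |f x| := hx
    have : 1 / ((n : ℝ) + 1) ≤ 1 / ((m : ℝ) + 1) := by gcongr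
    change t + 1 / ((n : ℝ) + 1) < |f x|
    linarith
  rw [hU, hmono.measure_iUnion]
  refine iSup_le fun n => ?_
  set ε : ℝ := 1 / ((n : ℝ) + 1)
  have hε : 0 < ε := by positivity
  -- The measures may be infinite, so nothing is subtracted: the margin `c` absorbs the error set
  -- and `d` keeps the final inequality strict.
  refine le_of_forall_lt fun b hb => ?_
  obtain ⟨c, hc0, hc⟩ := ENNReal.lt_iff_exists_add_pos_lt.1 hb
  obtain ⟨b', hbb', hb'⟩ := exists_between hc
  obtain ⟨d, hd0, hd⟩ := ENNReal.lt_iff_exists_add_pos_lt.1 hc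
  have key : b + d ≤ liminf (fun i => μ {x | t < |F i x|}) l := by
    refine le_liminf_of_le (by isBoundedDefault) ?_
    have hc0' : (0 : ℝ≥0∞) < c := by exact_mod_cast hc0
    filter_upwards [(hF ε hε).eventually (gt_mem_nhds hc0')] with i hi
    have h1 : μ {x | t + ε < |f x|} ≤ μ {x | t < |F i x|} + μ {x | ε < |F i x - f x|} := by
      refine (measure_mono fun x hx => ?_).trans (measure_union_le _ _)
      have hx : t + ε < |f x| := hx
      by_contra hcon
      simp only [Set.mem_union, Set.mem_ofPred_eq, not_or, not_lt] at hcon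
      have := abs_sub_abs_le_abs_sub (f x) (F i x)
      rw [abs_sub_comm] at this
      linarith [hcon.1, hcon.2]
    have h2 : b + d + c < μ {x | t < |F i x|} + c := by
      calc b + d + c = b + c + d := by ring
        _ < _ := hd
        _ ≤ _ := h1
        _ ≤ _ := by gcongr
    exact (lt_of_add_lt_add_right h2).le
  have hb_top : b ≠ ⊤ := ne_top_of_lt hb
  exact (ENNReal.lt_add_right hb_top (by exact_mod_cast hd0.ne')).trans_le key

theorem lintegral_layercake_lt {f : α → ℝ} (hf : Measurable f) {p γ : ℝ} (hp : 0 < p) :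
    ∫⁻ t in Set.Ioi (0 : ℝ), ENNReal.ofReal (p / |γ| * t ^ (p - 1)) * μ {x | t < |f x|} =
      ENNReal.ofReal (1 / |γ|) * ∫⁻ x, ‖f x‖ₑ ^ p ∂μ := by
  have h := lintegral_rpow_eq_lintegral_meas_lt_mul μ (f := fun x => |f x|)
    (ae_of_all _ fun x => abs_nonneg _) (by fun_prop) hp
  have h' : ∫⁻ x, ‖f x‖ₑ ^ p ∂μ = ∫⁻ x, ENNReal.ofReal (|f x| ^ p) ∂μ := by
    refine lintegral_congr fun x => ?_
    rw [Real.enorm_eq_ofReal_abs, ENNReal.ofReal_rpow_of_nonneg (abs_nonneg _) hp.le]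
  rw [h', h, ← mul_assoc, ← ENNReal.ofReal_mul (by positivity),
    ← lintegral_const_mul' _ _ ENNReal.ofReal_ne_top]
  refine lintegral_congr fun t => ?_
  rw [ENNReal.ofReal_mul (by positivity)]
  have : 1 / |γ| * p = p / |γ| := by ring
  rw [this]; ring

end Measure

/-! ### Convergence of averages and of the directional functional -/

section Limits

variable {N : ℕ} {f : Euc N → ℝ}

theorem exists_continuous_lintegral_sub_le (hf : Measurable f) {p : ℝ} (hp : 1 ≤ p)
    (hfp : ∫⁻ x, ‖f x‖ₑ ^ p ≠ ⊤) {η : ℝ≥0∞} (hη : η ≠ 0) :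
    ∃ k : Euc N → ℝ, Continuous k ∧ HasCompactSupport k ∧ ∫⁻ x, ‖k x‖ₑ ^ p ≠ ⊤ ∧
      ∫⁻ x, ‖f x - k x‖ₑ ^ p ≤ η := by
  have h0 : 0 < p := by linarith
  have hq0 : ENNReal.ofReal p ≠ 0 := by simpa using h0
  have hfL : MemLp f (ENNReal.ofReal p) volume := by
    refine ⟨hf.aestronglyMeasurable, ?_⟩
    rw [eLpNorm_lt_top_iff_lintegral_rpow_enorm_lt_top hq0 (by simp), ENNReal.toReal_ofReal h0.le]
    exact hfp.lt_top
  have hη' : η ^ (1 / p) ≠ 0 := by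
    simp [ENNReal.rpow_eq_zero_iff, hη, h0.le, h0]
  obtain ⟨k, hkc, hk, hkcont, hkL⟩ :=
    hfL.exists_hasCompactSupport_eLpNorm_sub_le (by simp) hη'
  refine ⟨k, hkcont, hkc, ?_, ?_⟩
  · have := hkL.2
    rw [eLpNorm_lt_top_iff_lintegral_rpow_enorm_lt_top hq0 (by simp),
      ENNReal.toReal_ofReal h0.le] at this
    exact this.ne
  · rw [eLpNorm_eq_lintegral_rpow_enorm_toReal hq0 (by simp), ENNReal.toReal_ofReal h0.le] at hk
    simpa using (ENNReal.rpow_le_rpow_iff (by positivity : 0 < 1 / p)).1 hk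

/-- Uniform continuity of `k`: every point of a short segment is close to its starting point. -/
theorem eventually_abs_lineAvg_sub_le {k : Euc N → ℝ} (hk : Continuous k)
    (hc : HasCompactSupport k) {ε : ℝ} (hε : 0 < ε) :
    ∀ᶠ h : Euc N in 𝓝 0, ∀ x, |lineAvg k h x - k x| ≤ ε := by
  have huc := hc.uniformContinuous_of_continuous hk
  obtain ⟨δ, hδ, hk'⟩ := Metric.uniformContinuous_iff.1 huc ε hε
  filter_upwards [Metric.ball_mem_nhds (0 : Euc N) hδ] with h hh x
  have hh : ‖h‖ < δ := by simpa using hh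
  have hint : Integrable (fun s : ℝ => k (x + s • h)) unitMeas :=
    ((hk.comp (by fun_prop : Continuous fun s : ℝ => x + s • h)).continuousOn.integrableOn_Icc
      (a := 0) (b := 1)).mono_set Set.Ioc_subset_Icc_self
  have hx : lineAvg k h x - k x = ∫ s, (k (x + s • h) - k x) ∂unitMeas := by
    rw [integral_sub hint (integrable_const _)]
    simp [lineAvg]
  rw [hx, ← Real.norm_eq_abs]
  refine (norm_integral_le_of_norm_le_const (C := ε) ?_).trans (by simp)
  filter_upwards [ae_restrict_mem measurableSet_Ioc] with s hs
  rw [← dist_eq_norm]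
  refine (hk' ?_).le
  rw [dist_eq_norm]
  simp only [add_sub_cancel_left, norm_smul]
  rw [Real.norm_of_nonneg hs.1.le]
  nlinarith [hs.1, hs.2, norm_nonneg h]

/-- Averages over shrinking segments converge in measure. -/
theorem tendsto_meas_lineAvg_sub (hf : Measurable f) {p : ℝ} (hp : 1 ≤ p)
    (hfp : ∫⁻ x, ‖f x‖ₑ ^ p ≠ ⊤) {ε : ℝ} (hε : 0 < ε) :
    Tendsto (fun h : Euc N => volume {x | ε < |lineAvg f h x - f x|}) (𝓝 0) (𝓝 0) := by
  have h0 : 0 < p := by linarith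
  rw [ENNReal.tendsto_nhds_zero]
  intro η hη
  -- Three errors of size ε/3: the average of f - k, the average of k minus k, and k - f. The middle
  -- one is eventually absent; dividing by Chebyshev's constant `c` leaves η/2 for each of the
  -- others.
  set c : ℝ≥0∞ := ENNReal.ofReal ((ε / 3) ^ p)
  have hc0 : c ≠ 0 := by simpa [c] using Real.rpow_pos_of_pos (by positivity : 0 < ε / 3) p
  have hη2 : η / 2 * c ≠ 0 := mul_ne_zero (by simpa using hη.ne') hc0
  obtain ⟨k, hk, hkc, hkp, hfk⟩ := exists_continuous_lintegral_sub_le hf hp hfp hη2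
  have hd : Measurable fun x => f x - k x := hf.sub hk.measurable
  have hdp : ∫⁻ x, ‖f x - k x‖ₑ ^ p ≤ η / 2 * c := hfk
  have hdiv : ∫⁻ x, ‖f x - k x‖ₑ ^ p ≠ ⊤ ∨ η = ⊤ := by
    by_cases h : η = ⊤
    · exact Or.inr h
    · exact Or.inl (ne_top_of_le_ne_top (ENNReal.mul_ne_top (ENNReal.div_ne_top h (by simp))
        ENNReal.ofReal_ne_top) hfk)
  rcases hdiv with hdfin | rfl
  swap
  · exact Eventually.of_forall fun _ => le_top
  filter_upwards [eventually_abs_lineAvg_sub_le hk hkc (by positivity : 0 < ε / 3)] with h hh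
  have hadd : ∀ᵐ x, lineAvg f h x = lineAvg (fun x => f x - k x) h x + lineAvg k h x := by
    filter_upwards [ae_lineAvg_add hd hk.measurable hp hdfin hkp h] with x hx
    rw [← hx]; simp
  have hle : volume {x | ε < |lineAvg f h x - f x|} ≤
      volume {x | ε / 3 < |lineAvg (fun x => f x - k x) h x|} +
        volume {x | ε / 3 < |f x - k x|} := by
    refine (measure_mono_ae ?_).trans (measure_union_le _ _)
    filter_upwards [hadd] with x hx (hεx : ε < |lineAvg f h x - f x|)
    by_contra hcon
    have h1 : ¬ (ε / 3 < |lineAvg (fun x => f x - k x) h x|) := fun h => hcon (Or.inl h)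
    have h2 : ¬ (ε / 3 < |f x - k x|) := fun h => hcon (Or.inr h)
    push Not at h1 h2
    have h3 := hh x
    rw [hx] at hεx
    rw [abs_le] at h1 h2 h3
    rcases lt_abs.1 hεx with h4 | h4 <;> linarith [h1.1, h1.2, h2.1, h2.2, h3.1, h3.2]
  have hdiv : ∀ I : ℝ≥0∞, I ≤ η / 2 * c → I / c ≤ η / 2 := fun I hI =>
    ENNReal.div_le_of_le_mul hI
  calc _ ≤ _ := hle
    _ ≤ η / 2 + η / 2 := by
        gcongr
        · exact (meas_lt_abs_le (measurable_lineAvg hd h) h0.le (by positivity)).trans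
            (hdiv _ ((lintegral_lineAvg_rpow_le hd hp h).trans hfk))
        · exact (meas_lt_abs_le hd h0.le (by positivity)).trans (hdiv _ hfk)
    _ = η := ENNReal.add_halves η

theorem measurable_meas_lineAvg (hf : Measurable f) (p γ lam : ℝ) (θ : Euc N) :
    Measurable fun t : ℝ => volume {x | t < |lineAvg f (scale p γ lam t • θ) x|} := by
  have hS : MeasurableSet {z : ℝ × Euc N | z.1 < |lineAvg f (scale p γ lam z.1 • θ) z.2|} := by
    refine measurableSet_lt measurable_fst (Measurable.abs ?_)
    exact (measurable_lineAvg_uncurry hf).comp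
      ((((measurable_scale p γ lam).comp measurable_fst).smul_const θ).prodMk measurable_snd)
  exact measurable_measure_prodMk_left hS

/-- The directional contributions are asymptotically at least the directional energy. -/
theorem le_liminf_lineFun (hf : Measurable f) {p γ : ℝ} (hp : 1 ≤ p) (hγ : γ ≠ 0)
    (hfp : ∫⁻ x, ‖f x‖ₑ ^ p ≠ ⊤) (θ : Euc N) {l : Filter ℝ} [l.NeBot] [l.IsCountablyGenerated]
    (hpos : ∀ᶠ lam in l, 0 < lam)
    (hscale : ∀ t : ℝ, 0 < t → Tendsto (fun lam => scale p γ lam t) l (𝓝 0)) :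
    ENNReal.ofReal (1 / |γ|) * ∫⁻ x, ‖f x‖ₑ ^ p ≤ liminf (lineFun p γ f θ) l := by
  have h0 : 0 < p := by linarith
  have hev : lineFun p γ f θ =ᶠ[l] fun lam =>
      ∫⁻ t in Set.Ioi (0 : ℝ), ENNReal.ofReal (p / |γ| * t ^ (p - 1)) *
        volume {x | t < |lineAvg f (scale p γ lam t • θ) x|} := by
    filter_upwards [hpos] with lam hl using lineFun_eq h0 hγ hl f θ
  rw [liminf_congr hev, ← lintegral_layercake_lt hf h0]
  -- Fatou in `t`, then lower semicontinuity of superlevel measures for each fixed `t`.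
  refine le_trans ?_ (lintegral_liminf_le fun lam =>
    (by fun_prop : Measurable fun t : ℝ => ENNReal.ofReal (p / |γ| * t ^ (p - 1))).mul
      (measurable_meas_lineAvg hf p γ lam θ))
  refine setLIntegral_mono' measurableSet_Ioi fun t ht => ?_
  rw [ENNReal.liminf_const_mul_of_ne_top ENNReal.ofReal_ne_top]
  gcongr
  refine meas_lt_abs_le_liminf (fun ε hε => ?_) t
  have hs : Tendsto (fun lam => scale p γ lam t • θ) l (𝓝 0) := by
    simpa using (hscale t ht).smul_const θ
  exact (tendsto_meas_lineAvg_sub hf hp hfp hε).comp hs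

/-- For continuous compactly supported functions the directional contributions converge to the
directional energy, provided that the superlevel sets are dominated. -/
theorem tendsto_lineFun_of_dominated {k : Euc N → ℝ} (hk : Continuous k)
    (hkc : HasCompactSupport k) {p γ : ℝ} (hp : 1 ≤ p) (hγ : γ ≠ 0) (θ : Euc N)
    {l : Filter ℝ} [l.NeBot] [l.IsCountablyGenerated] (hpos : ∀ᶠ lam in l, 0 < lam)
    (hscale : ∀ t : ℝ, 0 < t → Tendsto (fun lam => scale p γ lam t) l (𝓝 0))
    (B : ℝ → ℝ≥0∞)
    (hB : ∀ᶠ lam in l, ∀ t, 0 < t → volume {x | t < |lineAvg k (scale p γ lam t • θ) x|} ≤ B t)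
    (hBint : ∫⁻ t in Set.Ioi (0 : ℝ), ENNReal.ofReal (p / |γ| * t ^ (p - 1)) * B t ≠ ⊤) :
    Tendsto (lineFun p γ k θ) l (𝓝 (ENNReal.ofReal (1 / |γ|) * ∫⁻ x, ‖k x‖ₑ ^ p)) := by
  have h0 : 0 < p := by linarith
  have hkm := hk.measurable
  have hev : lineFun p γ k θ =ᶠ[l] fun lam =>
      ∫⁻ t in Set.Ioi (0 : ℝ), ENNReal.ofReal (p / |γ| * t ^ (p - 1)) *
        volume {x | t < |lineAvg k (scale p γ lam t • θ) x|} := by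
    filter_upwards [hpos] with lam hl using lineFun_eq h0 hγ hl k θ
  refine Tendsto.congr' hev.symm ?_
  rw [← lintegral_layercake_lt hkm h0]
  refine tendsto_lintegral_filter_of_dominated_convergence
    (fun t => ENNReal.ofReal (p / |γ| * t ^ (p - 1)) * B t) (Eventually.of_forall fun lam =>
    (by fun_prop : Measurable fun t : ℝ => ENNReal.ofReal (p / |γ| * t ^ (p - 1))).mul
      (measurable_meas_lineAvg hkm p γ lam θ)) ?_ hBint ?_
  · filter_upwards [hB] with lam hlam
    filter_upwards [ae_restrict_mem measurableSet_Ioi] with t ht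
    gcongr
    exact hlam t ht
  -- For almost every `t` the sets where |k| ≥ t and |k| > t have equal measure, so semicontinuity
  -- from both sides gives a limit.
  · filter_upwards [ae_restrict_mem measurableSet_Ioi,
      meas_le_ae_eq_meas_lt volume (volume.restrict (Set.Ioi 0)) fun x => |k x|] with t ht hteq
    have ht : 0 < t := ht
    refine ENNReal.Tendsto.const_mul ?_ (Or.inr ENNReal.ofReal_ne_top)
    have hs : Tendsto (fun lam => scale p γ lam t • θ) l (𝓝 0) := by
      simpa using (hscale t ht).smul_const θ
    refine tendsto_of_le_liminf_of_limsup_le ?_ ?_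
    · refine meas_lt_abs_le_liminf (fun ε hε => ?_) t
      refine tendsto_const_nhds.congr' ?_
      filter_upwards [hs.eventually (eventually_abs_lineAvg_sub_le hk hkc hε)] with lam hlam
      have : {x | ε < |lineAvg k (scale p γ lam t • θ) x - k x|} = ∅ :=
        Set.eq_empty_of_forall_notMem fun x (hx : _ < _) => not_lt.2 (hlam x) hx
      rw [this, measure_empty]
    · -- upper bound by continuity from above
      rw [← hteq]
      have hfin : volume {x | t / 2 ≤ |k x|} ≠ ⊤ := by
        refine ne_top_of_le_ne_top hkc.isCompact.measure_lt_top.ne (measure_mono fun x hx => ?_)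
        refine subset_tsupport _ fun h0 => ?_
        have hx : t / 2 ≤ |k x| := hx
        rw [h0, abs_zero] at hx; linarith
      -- The approximating levels start at t/2 > 0, where the superlevel set has finite measure;
      -- continuity from above needs this.
      have hI : {x | t ≤ |k x|} = ⋂ n : ℕ, {x | t - t / 2 / ((n : ℝ) + 1) ≤ |k x|} := by
        ext x
        simp only [Set.mem_ofPred_eq, Set.mem_iInter]
        constructor
        · intro hx n
          have : 0 ≤ t / 2 / ((n : ℝ) + 1) := by positivity
          linarith
        · intro hx
          refine le_of_tendsto' (f := fun n : ℕ => t - t / 2 / ((n : ℝ) + 1)) (x := atTop) ?_ hx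
          have h1 : Tendsto (fun n : ℕ => t / 2 * (1 / ((n : ℝ) + 1))) atTop (𝓝 (t / 2 * 0)) :=
            tendsto_one_div_add_atTop_nhds_zero_nat.const_mul _
          simpa [div_eq_mul_inv] using h1.const_sub t
      have hanti : Antitone fun n : ℕ => {x | t - t / 2 / ((n : ℝ) + 1) ≤ |k x|} := by
        intro m n hmn x hx
        have hx : t - t / 2 / ((n : ℝ) + 1) ≤ |k x| := hx
        have : t / 2 / ((n : ℝ) + 1) ≤ t / 2 / ((m : ℝ) + 1) := by gcongr
        change t - t / 2 / ((m : ℝ) + 1) ≤ |k x|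
        linarith
      rw [hI, hanti.measure_iInter (fun n =>
        (measurableSet_le measurable_const (by fun_prop)).nullMeasurableSet)
        ⟨0, by simpa [show t - t / 2 = t / 2 by ring] using hfin⟩]
      refine le_iInf fun n => ?_
      have hε : 0 < t / 2 / ((n : ℝ) + 1) := by positivity
      refine limsup_le_of_le (by isBoundedDefault) ?_
      filter_upwards [hs.eventually (eventually_abs_lineAvg_sub_le hk hkc hε)] with lam hlam
      refine measure_mono fun x hx => ?_
      have hx : t < |lineAvg k (scale p γ lam t • θ) x| := hx
      have h1 := hlam x
      have h2 := abs_sub_abs_le_abs_sub (lineAvg k (scale p γ lam t • θ) x) (k x)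
      change t - t / 2 / ((n : ℝ) + 1) ≤ |k x|
      linarith

end Limits

/-! ### Integrals of powers -/

section Powers

theorem lintegral_Ioc_rpow {q : ℝ} (hq : -1 < q) {a : ℝ} (ha : 0 ≤ a) :
    ∫⁻ t in Set.Ioc 0 a, ENNReal.ofReal (t ^ q) = ENNReal.ofReal (a ^ (q + 1) / (q + 1)) := by
  have hi := (intervalIntegral.intervalIntegrable_rpow' (a := 0) (b := a) hq).1
  rw [← ofReal_integral_eq_lintegral_ofReal hi ?_, ← intervalIntegral.integral_of_le ha,
    integral_rpow (Or.inl hq), Real.zero_rpow (by linarith), sub_zero]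
  filter_upwards [ae_restrict_mem measurableSet_Ioc] with t ht
  exact Real.rpow_nonneg ht.1.le _

theorem lintegral_Ioi_rpow {q : ℝ} (hq : q < -1) {a : ℝ} (ha : 0 < a) :
    ∫⁻ t in Set.Ioi a, ENNReal.ofReal (t ^ q) = ENNReal.ofReal (-a ^ (q + 1) / (q + 1)) := by
  rw [← ofReal_integral_eq_lintegral_ofReal (integrableOn_Ioi_rpow_of_lt hq ha) ?_,
    integral_Ioi_rpow_of_lt hq ha]
  filter_upwards [ae_restrict_mem measurableSet_Ioi] with t ht
  exact Real.rpow_nonneg (ha.trans ht).le _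

end Powers

/-! ### The uniform bound for p > 1 -/

section LargeExponent

variable {N : ℕ} {f : Euc N → ℝ}

/-- Values of |f| up to t/2 contribute at most t/2 to an average, so where the average exceeds t the
part of |f| above t/2 has average at least t/2. Chebyshev applies, and averaging preserves the
integral of that part. -/
theorem ofReal_half_mul_meas_lineAvg_le (hf : Measurable f) (h : Euc N) {t : ℝ} (ht : 0 < t) :
    ENNReal.ofReal (t / 2) * volume {x | t < |lineAvg f h x|} ≤
      ∫⁻ x, {x | t / 2 < |f x|}.indicator (fun x => ‖f x‖ₑ) x := by
  set G : Euc N → ℝ≥0∞ := {x | t / 2 < |f x|}.indicator fun x => ‖f x‖ₑ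
  have hG : Measurable G :=
    (by fun_prop : Measurable fun x => ‖f x‖ₑ).indicator
      (measurableSet_lt measurable_const (by fun_prop))
  have hGm : Measurable fun x => ∫⁻ s, G (x + s • h) ∂unitMeas :=
    Measurable.lintegral_prod_right' (f := fun z : Euc N × ℝ => G (z.1 + z.2 • h))
      (hG.comp (by fun_prop))
  rw [← lintegral_segment hG h]
  refine le_trans ?_ (mul_meas_ge_le_lintegral hGm (ENNReal.ofReal (t / 2)))
  gcongr with x
  intro hx
  have hx : t < |lineAvg f h x| := hx
  have h1 : ENNReal.ofReal t ≤ ‖lineAvg f h x‖ₑ := by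
    rw [Real.enorm_eq_ofReal_abs]; gcongr
  have h2 : ∀ y, ‖f y‖ₑ ≤ G y + ENNReal.ofReal (t / 2) := by
    intro y
    by_cases hy : t / 2 < |f y|
    · rw [show G y = ‖f y‖ₑ from Set.indicator_of_mem (by exact hy) _]
      exact le_self_add
    · rw [Real.enorm_eq_ofReal_abs]
      exact (ENNReal.ofReal_le_ofReal (not_lt.1 hy)).trans le_add_self
  have h3 : ‖lineAvg f h x‖ₑ ≤ (∫⁻ s, G (x + s • h) ∂unitMeas) + ENNReal.ofReal (t / 2) := by
    calc _ ≤ ∫⁻ s, ‖f (x + s • h)‖ₑ ∂unitMeas := enorm_integral_le_lintegral_enorm _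
      _ ≤ ∫⁻ s, (G (x + s • h) + ENNReal.ofReal (t / 2)) ∂unitMeas :=
          lintegral_mono fun s => h2 _
      _ = _ := by rw [lintegral_add_right _ measurable_const]; simp
  have h4 := h1.trans h3
  have h5 : ENNReal.ofReal t = ENNReal.ofReal (t / 2) + ENNReal.ofReal (t / 2) := by
    rw [← ENNReal.ofReal_add (by positivity) (by positivity), add_halves]
  rw [h5] at h4
  exact (ENNReal.add_le_add_iff_right ENNReal.ofReal_ne_top).1 h4

/-- The truncated weak-type bound is uniform in the segment, so the length may depend on `t` without
any maximal function. After Tonelli there remains ∫ t^(p-2) dt over (0, 2|f(x)|], finite because p >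
1. -/
theorem lineFun_le_of_one_lt {p γ : ℝ} (hp : 1 < p) (hγ : γ ≠ 0) (hf : Measurable f)
    (θ : Euc N) {lam : ℝ} (hl : 0 < lam) :
    lineFun p γ f θ lam ≤ ENNReal.ofReal (2 ^ p * p / |γ| / (p - 1)) * ∫⁻ x, ‖f x‖ₑ ^ p := by
  have h0 : 0 < p := by linarith
  have hγ' : 0 < |γ| := abs_pos.2 hγ
  rw [lineFun_eq h0 hγ hl]
  set c : ℝ := 2 * p / |γ|
  have hc : 0 ≤ c := by positivity
  calc _ ≤ ∫⁻ t in Set.Ioi (0 : ℝ), ∫⁻ x, ENNReal.ofReal (c * t ^ (p - 2)) *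
        {x | t / 2 < |f x|}.indicator (fun x => ‖f x‖ₑ) x := by
        refine setLIntegral_mono' measurableSet_Ioi fun t ht => ?_
        have ht : 0 < t := ht
        have e1 : p / |γ| * t ^ (p - 1) = c * t ^ (p - 2) * (t / 2) := by
          rw [show p - 1 = (p - 2) + 1 by ring, Real.rpow_add_one ht.ne']; ring
        rw [lintegral_const_mul' _ _ ENNReal.ofReal_ne_top, e1,
          ENNReal.ofReal_mul (by positivity), mul_assoc]
        gcongr
        exact ofReal_half_mul_meas_lineAvg_le hf _ ht
    _ = ∫⁻ x, ∫⁻ t in Set.Ioi (0 : ℝ), ENNReal.ofReal (c * t ^ (p - 2)) *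
        {x | t / 2 < |f x|}.indicator (fun x => ‖f x‖ₑ) x := by
        refine lintegral_lintegral_swap (Measurable.aemeasurable ?_)
        have hS : MeasurableSet {z : ℝ × Euc N | z.1 / 2 < |f z.2|} :=
          measurableSet_lt (by fun_prop) (by fun_prop)
        have hm : Measurable ({z : ℝ × Euc N | z.1 / 2 < |f z.2|}.indicator
          fun z => ENNReal.ofReal (c * z.1 ^ (p - 2)) * ‖f z.2‖ₑ) :=
          Measurable.indicator (by fun_prop) hS
        refine (congrArg Measurable (funext fun z => ?_)).mp hm
        by_cases hz : z.1 / 2 < |f z.2| <;> simp [Function.uncurry, Set.indicator, hz]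
    _ ≤ ∫⁻ x, ENNReal.ofReal (2 ^ p * p / |γ| / (p - 1)) * ‖f x‖ₑ ^ p := by
        refine lintegral_mono fun x => ?_
        have hA : 0 ≤ 2 * |f x| := by positivity
        calc _ ≤ ∫⁻ t in Set.Ioi (0 : ℝ), (Set.Ioc 0 (2 * |f x|)).indicator
              (fun t => (ENNReal.ofReal c * ‖f x‖ₑ) * ENNReal.ofReal (t ^ (p - 2))) t := by
              refine setLIntegral_mono' measurableSet_Ioi fun t ht => ?_
              by_cases hx : t / 2 < |f x|
              · rw [Set.indicator_of_mem (show x ∈ {x | t / 2 < |f x|} from hx),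
                  Set.indicator_of_mem (show t ∈ Set.Ioc 0 (2 * |f x|) from
                    ⟨ht, by linarith⟩), ENNReal.ofReal_mul hc]
                exact le_of_eq (by ring)
              · rw [Set.indicator_of_notMem (show x ∉ {x | t / 2 < |f x|} from hx), mul_zero]
                exact zero_le
          _ ≤ ∫⁻ t, (Set.Ioc 0 (2 * |f x|)).indicator
              (fun t => (ENNReal.ofReal c * ‖f x‖ₑ) * ENNReal.ofReal (t ^ (p - 2))) t :=
              setLIntegral_le_lintegral _ _
          _ = _ := by
              rw [lintegral_indicator measurableSet_Ioc, lintegral_const_mul' _ _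
                (ENNReal.mul_ne_top ENNReal.ofReal_ne_top (by simp)),
                lintegral_Ioc_rpow (by linarith) hA, Real.enorm_eq_ofReal_abs,
                ENNReal.ofReal_rpow_of_nonneg (abs_nonneg _) h0.le, ← ENNReal.ofReal_mul hc,
                ← ENNReal.ofReal_mul (by positivity), ← ENNReal.ofReal_mul (by
                  have : 0 < p - 1 := by linarith
                  positivity)]
              congr 1
              have hp1 : p - 1 ≠ 0 := by linarith
              rw [show p - 2 + 1 = p - 1 by ring, Real.mul_rpow (by norm_num) (abs_nonneg _)]
              have e2 : (2 : ℝ) ^ p = 2 ^ (p - 1) * 2 := by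
                rw [← Real.rpow_add_one (by norm_num)]; congr 1; ring
              have e3 : |f x| ^ p = |f x| ^ (p - 1) * |f x| := by
                rw [← Real.rpow_add_one' (abs_nonneg _) (by linarith)]; congr 1; ring
              rw [e2, e3]
              simp only [c]
              field_simp
    _ = _ := lintegral_const_mul' _ _ ENNReal.ofReal_ne_top

end LargeExponent

/-! ### The covering estimate on the line for p = 1 -/

section Covering

theorem lintegral_Icc_eq {φ : ℝ → ℝ≥0∞} (x : ℝ) {r : ℝ} (hr : 0 < r) :
    ∫⁻ y in Set.Icc x (x + r), φ y = ENNReal.ofReal r * ∫⁻ s, φ (x + s * r) ∂unitMeas := by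
  have himg : (fun s => x + s * r) '' Set.Ioc 0 1 = Set.Ioc x (x + r) := by
    ext y
    constructor
    · rintro ⟨s, hs, rfl⟩
      exact ⟨by nlinarith [hs.1], by nlinarith [hs.2]⟩
    · intro hy
      refine ⟨(y - x) / r, ⟨div_pos (by linarith [hy.1]) hr, ?_⟩, by field_simp; ring⟩
      rw [div_le_one hr]; linarith [hy.2]
  have hd : ∀ s ∈ Set.Ioc (0 : ℝ) 1, HasDerivWithinAt (fun s => x + s * r) r (Set.Ioc 0 1) s := by
    intro s _
    simpa using (((hasDerivAt_id s).mul_const r).const_add x).hasDerivWithinAt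
  have hinj : Set.InjOn (fun s => x + s * r) (Set.Ioc 0 1) := by
    intro a _ b _ hab
    simpa [hr.ne'] using hab
  rw [Measure.restrict_congr_set Ioc_ae_eq_Icc.symm, ← himg,
    lintegral_image_eq_lintegral_abs_deriv_mul measurableSet_Ioc hd hinj, abs_of_pos hr,
    lintegral_const_mul' _ _ ENNReal.ofReal_ne_top]

/-- This is where γ ∈ [-1, 0] is excluded. For γ > 0 the constraint forces r ≤ 2ℓ, and r^(γ-1) is
integrable at 0; for γ < -1 it forces r ≥ cℓ, and r^(γ-1) (r + ℓ) is comparable to r^γ, integrable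
at infinity. -/
theorem lintegral_comparable_scales_le {γ : ℝ} (hγ : 0 < γ ∨ γ < -1) :
    ∃ K : ℝ, 0 < K ∧ ∀ ℓ : ℝ, 0 < ℓ →
      ∫⁻ r in Set.Ioi (0 : ℝ), ENNReal.ofReal (r ^ (γ - 1)) *
        {r : ℝ | r ^ (γ + 1) ≤ 2 * ℓ ^ (γ + 1)}.indicator (fun r => ENNReal.ofReal (r + ℓ)) r ≤
      ENNReal.ofReal (K * ℓ ^ (γ + 1)) := by
  rcases hγ with hγ | hγ
  · refine ⟨3 * 2 ^ γ / γ, by positivity, fun ℓ hℓ => ?_⟩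
    calc _ ≤ ∫⁻ r in Set.Ioi (0 : ℝ), (Set.Ioc 0 (2 * ℓ)).indicator
          (fun r => ENNReal.ofReal (3 * ℓ) * ENNReal.ofReal (r ^ (γ - 1))) r := by
          refine setLIntegral_mono' measurableSet_Ioi fun r hr => ?_
          have hr : 0 < r := hr
          by_cases h : r ^ (γ + 1) ≤ 2 * ℓ ^ (γ + 1)
          · have hr2 : r ≤ 2 * ℓ := by
              refine (Real.rpow_le_rpow_iff hr.le (by positivity) (by linarith : 0 < γ + 1)).1 ?_
              refine h.trans ?_
              rw [Real.mul_rpow (by norm_num) hℓ.le]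
              gcongr
              exact Real.self_le_rpow_of_one_le (by norm_num) (by linarith)
            rw [Set.indicator_of_mem (show r ∈ {r : ℝ | r ^ (γ + 1) ≤ 2 * ℓ ^ (γ + 1)} from h),
              Set.indicator_of_mem (show r ∈ Set.Ioc 0 (2 * ℓ) from ⟨hr, hr2⟩), mul_comm]
            gcongr
            linarith
          · rw [Set.indicator_of_notMem
              (show r ∉ {r : ℝ | r ^ (γ + 1) ≤ 2 * ℓ ^ (γ + 1)} from h), mul_zero]
            exact zero_le
      _ ≤ ∫⁻ r, (Set.Ioc 0 (2 * ℓ)).indicator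
          (fun r => ENNReal.ofReal (3 * ℓ) * ENNReal.ofReal (r ^ (γ - 1))) r :=
          setLIntegral_le_lintegral _ _
      _ = _ := by
          rw [lintegral_indicator measurableSet_Ioc, lintegral_const_mul' _ _
            ENNReal.ofReal_ne_top, lintegral_Ioc_rpow (by linarith) (by positivity),
            ← ENNReal.ofReal_mul (by positivity), sub_add_cancel,
            Real.mul_rpow (by norm_num) hℓ.le, Real.rpow_add_one hℓ.ne']
          congr 1; ring
  -- Chosen so that (cℓ)^(γ+1) = 2 ℓ^(γ+1); the exponent is negative, which reverses the inequality.
  · set c : ℝ := 2 ^ (1 / (γ + 1))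
    have hγ1 : γ + 1 < 0 := by linarith
    have hc : 0 < c := by positivity
    refine ⟨(1 + 1 / c) * c ^ (γ + 1) / (-(γ + 1)), by
      have : 0 < -(γ + 1) := by linarith
      positivity, fun ℓ hℓ => ?_⟩
    calc _ ≤ ∫⁻ r in Set.Ioi (0 : ℝ), (Set.Ici (c * ℓ)).indicator
          (fun r => ENNReal.ofReal (1 + 1 / c) * ENNReal.ofReal (r ^ γ)) r := by
          refine setLIntegral_mono' measurableSet_Ioi fun r hr => ?_
          have hr : 0 < r := hr
          by_cases h : r ^ (γ + 1) ≤ 2 * ℓ ^ (γ + 1)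
          · have hcl : (c * ℓ) ^ (γ + 1) = 2 * ℓ ^ (γ + 1) := by
              rw [Real.mul_rpow hc.le hℓ.le, ← Real.rpow_mul (by norm_num),
                one_div_mul_cancel hγ1.ne, Real.rpow_one]
            have hr2 : c * ℓ ≤ r := by
              rw [← hcl] at h
              exact (Real.rpow_le_rpow_iff_of_neg hr (by positivity) hγ1).1 h
            rw [Set.indicator_of_mem (show r ∈ {r : ℝ | r ^ (γ + 1) ≤ 2 * ℓ ^ (γ + 1)} from h),
              Set.indicator_of_mem (show r ∈ Set.Ici (c * ℓ) from hr2),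
              ← ENNReal.ofReal_mul (by positivity), ← ENNReal.ofReal_mul (by positivity)]
            refine ENNReal.ofReal_le_ofReal ?_
            have e : r ^ γ = r ^ (γ - 1) * r := by
              rw [← Real.rpow_add_one hr.ne']; congr 1; ring
            have h3 : ℓ ≤ 1 / c * r := by
              rw [one_div, inv_mul_eq_div, le_div_iff₀ hc]; linarith
            have h4 : 0 ≤ r ^ (γ - 1) := by positivity
            rw [e]
            nlinarith
          · rw [Set.indicator_of_notMem
              (show r ∉ {r : ℝ | r ^ (γ + 1) ≤ 2 * ℓ ^ (γ + 1)} from h), mul_zero]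
            exact zero_le
      _ ≤ ∫⁻ r, (Set.Ici (c * ℓ)).indicator
          (fun r => ENNReal.ofReal (1 + 1 / c) * ENNReal.ofReal (r ^ γ)) r :=
          setLIntegral_le_lintegral _ _
      _ = _ := by
          rw [lintegral_indicator measurableSet_Ici, Measure.restrict_congr_set Ioi_ae_eq_Ici.symm,
            lintegral_const_mul' _ _ ENNReal.ofReal_ne_top,
            lintegral_Ioi_rpow hγ (by positivity), ← ENNReal.ofReal_mul (by positivity),
            Real.mul_rpow hc.le hℓ.le]
          congr 1
          field_simp

/-- The one-dimensional covering estimate: intervals on which the integral of `φ` beats a power of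
the length carry little mass. -/
theorem exists_lintegral_bad_intervals_le {γ : ℝ} (hγ : 0 < γ ∨ γ < -1) :
    ∃ K : ℝ, 0 < K ∧ ∀ φ : ℝ → ℝ≥0∞, Measurable φ →
      ∫⁻ r in Set.Ioi (0 : ℝ), ENNReal.ofReal (r ^ (γ - 1)) *
        volume {x : ℝ | ENNReal.ofReal (r ^ γ) < ∫⁻ s, φ (x + s * r) ∂unitMeas} ≤
      ENNReal.ofReal K * ∫⁻ x, φ x := by
  obtain ⟨K, hK, hKb⟩ := lintegral_comparable_scales_le hγ
  refine ⟨K, hK, fun φ hφ => ?_⟩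
  by_cases hfin : ∫⁻ x, φ x = ⊤
  · rw [hfin, ENNReal.mul_top (by simpa using hK)]
    exact le_top
  set bad : Set (ℝ × ℝ) := {b | 0 < b.2 ∧
    ENNReal.ofReal (b.2 ^ γ) < ∫⁻ s, φ (b.1 + s * b.2) ∂unitMeas}
  set I : ℝ × ℝ → Set ℝ := fun b => Set.Icc b.1 (b.1 + b.2)
  -- An interval of length r on which the average beats r^γ carries mass at least r^(γ+1).
  have hbad : ∀ b ∈ bad, ENNReal.ofReal (b.2 ^ (γ + 1)) ≤ ∫⁻ y in I b, φ y := by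
    rintro b ⟨hb0, hb⟩
    simp only [I]
    rw [lintegral_Icc_eq b.1 hb0, Real.rpow_add_one hb0.ne', mul_comm,
      ENNReal.ofReal_mul hb0.le]
    gcongr
  -- Vitali selection with size r^(γ+1) instead of length: this size is bounded by the total mass,
  -- and for γ < -1 it favours short intervals.
  obtain ⟨u, hut, hdisj, hcov⟩ := Vitali.exists_disjoint_subfamily_covering_enlargement I bad
    (fun b => b.2 ^ (γ + 1)) 2 (by norm_num) (fun b hb => Real.rpow_nonneg hb.1.le _)
    (∫⁻ x, φ x).toReal (fun b hb => by
      rw [← ENNReal.ofReal_le_iff_le_toReal hfin]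
      exact (hbad b hb).trans (setLIntegral_le_lintegral _ _))
    (fun b hb => ⟨b.1, le_rfl, by linarith [hb.1]⟩)
  have hucount : u.Countable := by
    refine hdisj.countable_of_nonempty_interior fun b hb => ?_
    simp only [I, interior_Icc]
    exact Set.nonempty_Ioo.2 (by linarith [(hut hb).1])
  have := hucount.to_subtype
  calc _ ≤ ∫⁻ r in Set.Ioi (0 : ℝ), ∑' b : u, ENNReal.ofReal (r ^ (γ - 1)) *
        {r : ℝ | r ^ (γ + 1) ≤ 2 * b.1.2 ^ (γ + 1)}.indicator
          (fun r => ENNReal.ofReal (r + b.1.2)) r := by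
        refine setLIntegral_mono' measurableSet_Ioi fun r hr => ?_
        have hr : 0 < r := hr
        rw [ENNReal.tsum_mul_left]
        gcongr
        -- A bad interval [x, x + r] meeting a selected one of length ℓ has its left end in an
        -- interval of length r + ℓ.
        calc _ ≤ volume (⋃ b : u, {x : ℝ | r ^ (γ + 1) ≤ 2 * b.1.2 ^ (γ + 1) ∧
              x ∈ Set.Icc (b.1.1 - r) (b.1.1 + b.1.2)}) := by
              refine measure_mono fun x hx => ?_
              obtain ⟨b, hb, ⟨y, hy1, hy2⟩, hle⟩ := hcov (x, r) ⟨hr, hx⟩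
              refine Set.mem_iUnion.2 ⟨⟨b, hb⟩, hle, ?_, ?_⟩
              · linarith [hy1.2, hy2.1]
              · linarith [hy1.1, hy2.2]
          _ ≤ ∑' b : u, volume {x : ℝ | r ^ (γ + 1) ≤ 2 * b.1.2 ^ (γ + 1) ∧
              x ∈ Set.Icc (b.1.1 - r) (b.1.1 + b.1.2)} := measure_iUnion_le _
          _ ≤ _ := by
              refine ENNReal.tsum_le_tsum fun b => ?_
              by_cases h : r ^ (γ + 1) ≤ 2 * b.1.2 ^ (γ + 1)
              · rw [Set.indicator_of_mem
                  (show r ∈ {r : ℝ | r ^ (γ + 1) ≤ 2 * b.1.2 ^ (γ + 1)} from h)]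
                refine (measure_mono fun x hx => hx.2).trans ?_
                rw [Real.volume_Icc]
                exact ENNReal.ofReal_le_ofReal (by linarith)
              · simp [h]
    _ = ∑' b : u, ∫⁻ r in Set.Ioi (0 : ℝ), ENNReal.ofReal (r ^ (γ - 1)) *
        {r : ℝ | r ^ (γ + 1) ≤ 2 * b.1.2 ^ (γ + 1)}.indicator
          (fun r => ENNReal.ofReal (r + b.1.2)) r := by
        refine lintegral_tsum fun b => Measurable.aemeasurable ?_
        exact (by fun_prop : Measurable fun r : ℝ => ENNReal.ofReal (r ^ (γ - 1))).mul
          ((by fun_prop : Measurable fun r : ℝ => ENNReal.ofReal (r + b.1.2)).indicator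
            (measurableSet_le (by fun_prop) measurable_const))
    _ ≤ ∑' b : u, ENNReal.ofReal K * ∫⁻ y in I b, φ y := by
        refine ENNReal.tsum_le_tsum fun b => (hKb _ (hut b.2).1).trans ?_
        rw [ENNReal.ofReal_mul hK.le]
        gcongr
        exact hbad _ (hut b.2)
    _ = ENNReal.ofReal K * ∫⁻ y in ⋃ b ∈ u, I b, φ y := by
        rw [ENNReal.tsum_mul_left, lintegral_biUnion hucount (fun b _ => measurableSet_Icc) hdisj]
    _ ≤ _ := by
        gcongr
        exact Measure.restrict_le_self

end Covering

/-! ### Slicing space by lines parallel to θ -/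

section Lines

/-- The splitting of `ℝ^(n+1)` into the first coordinate and the others. -/
def consCoord (n : ℕ) (z : ℝ × (Fin n → ℝ)) : Euc (n + 1) := WithLp.toLp 2 (Fin.cons z.1 z.2)

theorem consCoord_eq (n : ℕ) : consCoord n = fun z => MeasurableEquiv.toLp 2 (Fin (n + 1) → ℝ)
    ((MeasurableEquiv.piFinSuccAbove (fun _ : Fin (n + 1) => ℝ) 0).symm z) := by
  ext z i
  refine Fin.cases ?_ (fun j => ?_) i <;>
    simp [consCoord, MeasurableEquiv.piFinSuccAbove, Fin.consEquiv]

theorem measurePreserving_consCoord (n : ℕ) : MeasurePreserving (consCoord n) := by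
  rw [consCoord_eq]
  exact (PiLp.volume_preserving_toLp _).comp
    (volume_preserving_piFinSuccAbove (fun _ : Fin (n + 1) => ℝ) 0).symm

theorem measurableEmbedding_consCoord (n : ℕ) : MeasurableEmbedding (consCoord n) := by
  rw [consCoord_eq]
  exact (MeasurableEquiv.toLp 2 (Fin (n + 1) → ℝ)).measurableEmbedding.comp
    (MeasurableEquiv.piFinSuccAbove (fun _ : Fin (n + 1) => ℝ) 0).symm.measurableEmbedding

/-- Coordinates adapted to a unit vector `θ`: the first one runs along `θ`. -/
theorem exists_line_coordinates {n : ℕ} {θ : Euc (n + 1)} (hθ : ‖θ‖ = 1) :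
    ∃ T : ℝ × (Fin n → ℝ) → Euc (n + 1), MeasurePreserving T ∧ MeasurableEmbedding T ∧
      ∀ a σ z, T (a + σ, z) = T (a, z) + σ • θ := by
  set e₀ : Euc (n + 1) := EuclideanSpace.single 0 1 with he₀def
  have he₀ : ‖e₀‖ = ‖θ‖ := by simp [e₀, hθ]
  obtain ⟨A, hA⟩ := exists_isometry_map he₀
  refine ⟨fun z => A (consCoord n z), A.measurePreserving.comp (measurePreserving_consCoord n),
    A.toHomeomorph.measurableEmbedding.comp (measurableEmbedding_consCoord n), ?_⟩
  intro a σ z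
  have : consCoord n (a + σ, z) = consCoord n (a, z) + σ • e₀ := by
    ext i
    refine Fin.cases ?_ (fun j => ?_) i <;> simp [consCoord, he₀def]
  simp only [this, map_add, map_smul, hA]

/-- On each line parallel to `θ` the superlevel set lies in the bad set of φ = |f|/λ; the covering
estimate is applied line by line and integrated. The prefactor λ cancels the normalization. -/
theorem exists_lineFun_one_le {N : ℕ} (hN : 1 ≤ N) {γ : ℝ} (hγ : 0 < γ ∨ γ < -1) :
    ∃ K : ℝ, 0 < K ∧ ∀ f : Euc N → ℝ, Measurable f → ∀ θ : Euc N, ‖θ‖ = 1 → ∀ lam : ℝ, 0 < lam →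
      lineFun 1 γ f θ lam ≤ ENNReal.ofReal K * ∫⁻ x, ‖f x‖ₑ := by
  obtain ⟨K, hK, hKb⟩ := exists_lintegral_bad_intervals_le hγ
  refine ⟨K, hK, fun f hf θ hθ lam hl => ?_⟩
  obtain ⟨n, rfl⟩ : ∃ n, N = n + 1 := ⟨N - 1, by omega⟩
  obtain ⟨T, hT, hTe, hTadd⟩ := exists_line_coordinates hθ
  have hl0 : ENNReal.ofReal lam ≠ 0 := by simpa using hl
  set φ : Euc (n + 1) → ℝ≥0∞ := fun x => ‖f x‖ₑ / ENNReal.ofReal lam with hφdef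
  have hφ : Measurable φ := by fun_prop
  have hφT : Measurable fun z => φ (T z) := hφ.comp hT.measurable
  have hAm : Measurable fun w : ((ℝ × (Fin n → ℝ)) × ℝ) =>
      ∫⁻ s, φ (T (w.1.1 + s * w.2, w.1.2)) ∂unitMeas :=
    Measurable.lintegral_prod_right'
      (f := fun v : ((ℝ × (Fin n → ℝ)) × ℝ) × ℝ => φ (T (v.1.1.1 + v.2 * v.1.2, v.1.1.2)))
      (hφT.comp (by fun_prop))
  calc lineFun 1 γ f θ lam
      ≤ ∫⁻ r in Set.Ioi (0 : ℝ), ENNReal.ofReal lam * ∫⁻ z : Fin n → ℝ,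
        (ENNReal.ofReal (r ^ (γ - 1)) * volume {a : ℝ | ENNReal.ofReal (r ^ γ) <
          ∫⁻ s, φ (T (a + s * r, z)) ∂unitMeas}) := by
        refine setLIntegral_mono' measurableSet_Ioi fun r hr => ?_
        have hr : 0 < r := hr
        rw [Real.rpow_one, ENNReal.ofReal_mul hl.le, mul_assoc,
          lintegral_const_mul' _ _ ENNReal.ofReal_ne_top, div_one]
        gcongr
        have hS : MeasurableSet {w : ℝ × (Fin n → ℝ) | ENNReal.ofReal (r ^ γ) <
            ∫⁻ s, φ (T (w.1 + s * r, w.2)) ∂unitMeas} :=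
          measurableSet_lt measurable_const (hAm.comp (by fun_prop :
            Measurable fun w : ℝ × (Fin n → ℝ) => (w, r)))
        have hV : volume {x | lam * r ^ γ < |lineAvg f (r • θ) x|} ≤
            volume {w : ℝ × (Fin n → ℝ) | ENNReal.ofReal (r ^ γ) <
              ∫⁻ s, φ (T (w.1 + s * r, w.2)) ∂unitMeas} := by
          rw [← hT.measure_preimage_emb hTe]
          refine measure_mono fun w hw => ?_
          have hw : lam * r ^ γ < |lineAvg f (r • θ) (T w)| := hw
          change ENNReal.ofReal (r ^ γ) < ∫⁻ s, φ (T (w.1 + s * r, w.2)) ∂unitMeas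
          simp only [hTadd, hφdef, ENNReal.div_eq_inv_mul]
          rw [lintegral_const_mul' _ _ (ENNReal.inv_ne_top.2 hl0), ← ENNReal.div_eq_inv_mul,
            ENNReal.lt_div_iff_mul_lt (Or.inl hl0) (Or.inl ENNReal.ofReal_ne_top),
            ← ENNReal.ofReal_mul (by positivity), mul_comm]
          refine lt_of_lt_of_le ?_ (le_trans
            (enorm_integral_le_lintegral_enorm (μ := unitMeas) fun s => f (T w + s • r • θ)) ?_)
          · rw [Real.enorm_eq_ofReal_abs]
            exact (ENNReal.ofReal_lt_ofReal_iff_of_nonneg (by positivity)).2 hw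
          · simp only [smul_smul, Prod.mk.eta]
            exact le_rfl
        refine hV.trans (le_of_eq ?_)
        rw [Measure.volume_eq_prod, Measure.prod_apply_symm hS]
        rfl
    _ = ENNReal.ofReal lam * ∫⁻ z : Fin n → ℝ, ∫⁻ r in Set.Ioi (0 : ℝ),
        (ENNReal.ofReal (r ^ (γ - 1)) * volume {a : ℝ | ENNReal.ofReal (r ^ γ) <
          ∫⁻ s, φ (T (a + s * r, z)) ∂unitMeas}) := by
        rw [lintegral_const_mul' _ _ ENNReal.ofReal_ne_top, lintegral_lintegral_swap]
        refine Measurable.aemeasurable ?_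
        have hS : MeasurableSet {w : (ℝ × (Fin n → ℝ)) × ℝ | ENNReal.ofReal (w.1.1 ^ γ) <
            ∫⁻ s, φ (T (w.2 + s * w.1.1, w.1.2)) ∂unitMeas} :=
          measurableSet_lt (by fun_prop) (hAm.comp (by fun_prop :
            Measurable fun w : (ℝ × (Fin n → ℝ)) × ℝ => ((w.2, w.1.2), w.1.1)))
        exact (by fun_prop : Measurable fun w : ℝ × (Fin n → ℝ) =>
          ENNReal.ofReal (w.1 ^ (γ - 1))).mul (measurable_measure_prodMk_left hS)
    _ ≤ ENNReal.ofReal lam * ∫⁻ z : Fin n → ℝ, ENNReal.ofReal K * ∫⁻ a, φ (T (a, z)) := by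
        gcongr with z
        exact hKb (fun a => φ (T (a, z))) (hφT.comp (by fun_prop))
    _ = ENNReal.ofReal K * (ENNReal.ofReal lam * ∫⁻ x, φ x) := by
        rw [lintegral_const_mul' _ _ ENNReal.ofReal_ne_top, ← hT.lintegral_comp hφ,
          Measure.volume_eq_prod, lintegral_prod_symm' _ hφT]
        ring
    _ = _ := by
        congr 1
        simp only [hφdef, ENNReal.div_eq_inv_mul]
        rw [lintegral_const_mul' _ _ (ENNReal.inv_ne_top.2 hl0), ← mul_assoc,
          ENNReal.mul_inv_cancel hl0 ENNReal.ofReal_ne_top, one_mul]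

theorem exists_lineFun_le {N : ℕ} (hN : 1 ≤ N) {p γ : ℝ} (hγ : γ ≠ 0)
    (h : 1 < p ∨ p = 1 ∧ (0 < γ ∨ γ < -1)) :
    ∃ C : ℝ≥0∞, C ≠ ⊤ ∧ ∀ f : Euc N → ℝ, Measurable f → ∀ θ : Euc N, ‖θ‖ = 1 →
      ∀ lam : ℝ, 0 < lam → lineFun p γ f θ lam ≤ C * ∫⁻ x, ‖f x‖ₑ ^ p := by
  rcases h with hp | ⟨rfl, hγ'⟩
  · exact ⟨_, ENNReal.ofReal_ne_top, fun f hf θ _ lam hl => lineFun_le_of_one_lt hp hγ hf θ hl⟩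
  · obtain ⟨K, -, hK⟩ := exists_lineFun_one_le hN hγ'
    exact ⟨_, ENNReal.ofReal_ne_top, fun f hf θ hθ lam hl => by simpa using hK f hf θ hθ lam hl⟩

end Lines

/-! ### The two limiting regimes -/

/-- The limits `lam → ∞` for `γ > 0` and `lam ↘ 0` for `γ < 0` share these properties. -/
structure ScaleFilter (p γ : ℝ) (l : Filter ℝ) : Prop where
  pos : ∀ᶠ lam in l, 0 < lam
  scale_le : ∀ᶠ lam in l, ∀ t : ℝ, 0 < t → scale p γ lam t ≤ t ^ (p / γ)
  tendsto_scale : ∀ t : ℝ, 0 < t → Tendsto (fun lam => scale p γ lam t) l (𝓝 0)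
  tendsto_mul : ∀ c : ℝ, 0 < c → Tendsto (fun lam => c * lam) l l

theorem scaleFilter_atTop {p γ : ℝ} (hp : 0 < p) (hγ : 0 < γ) : ScaleFilter p γ atTop where
  pos := eventually_gt_atTop 0
  scale_le := by
    filter_upwards [eventually_ge_atTop 1] with lam hl t ht
    exact Real.rpow_le_rpow (by positivity) (div_le_self ht.le hl) (by positivity)
  tendsto_scale t _ := by
    have h1 : Tendsto (fun lam : ℝ => t / lam) atTop (𝓝 0) := tendsto_const_nhds.div_atTop tendsto_id
    have h2 := (Real.continuousAt_rpow_const 0 (p / γ) (Or.inr (by positivity))).tendsto.comp h1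
    rwa [Real.zero_rpow (by positivity)] at h2
  tendsto_mul c hc := tendsto_id.const_mul_atTop hc

/-- Now p/γ < 0, so t/λ → ∞ makes the scale tend to 0, and λ < 1 makes it at most t^(p/γ). -/
theorem scaleFilter_nhdsGT {p γ : ℝ} (hp : 0 < p) (hγ : γ < 0) : ScaleFilter p γ (𝓝[>] 0) where
  pos := self_mem_nhdsWithin
  scale_le := by
    filter_upwards [Ioo_mem_nhdsGT one_pos] with lam hl t ht
    refine Real.rpow_le_rpow_of_nonpos ht ?_ (div_neg_of_pos_of_neg hp hγ).le
    rw [le_div_iff₀ hl.1]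
    nlinarith [hl.2]
  tendsto_scale t ht := by
    have h1 : Tendsto (fun lam : ℝ => t / lam) (𝓝[>] 0) atTop := by
      simpa [div_eq_mul_inv] using tendsto_inv_nhdsGT_zero.const_mul_atTop ht
    have h2 := (tendsto_rpow_neg_atTop (y := -(p / γ)) (by
      have := div_neg_of_pos_of_neg hp hγ; linarith)).comp h1
    simpa [scale, Function.comp_def] using h2
  tendsto_mul c hc := by
    refine tendsto_nhdsWithin_iff.2 ⟨?_, ?_⟩
    · have : Tendsto (fun lam : ℝ => c * lam) (𝓝 0) (𝓝 (c * 0)) := tendsto_id.const_mul c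
      rw [mul_zero] at this
      exact this.mono_left nhdsWithin_le_nhds
    · filter_upwards [self_mem_nhdsWithin] with lam hl
      exact mul_pos hc hl

/-! ### Dominating functions for continuous compactly supported data -/

section Domination

variable {N : ℕ}

theorem abs_lineAvg_le {k : Euc N → ℝ} {M : ℝ} (hM : ∀ x, |k x| ≤ M) (h x : Euc N) :
    |lineAvg k h x| ≤ M := by
  rw [← Real.norm_eq_abs]
  exact (norm_integral_le_of_norm_le_const (C := M) (ae_of_all _ fun s => hM _)).trans (by simp)

theorem meas_lineAvg_eq_zero {k : Euc N → ℝ} {M : ℝ} (hM : ∀ x, |k x| ≤ M) (h : Euc N) {t : ℝ}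
    (ht : M < t) : volume {x | t < |lineAvg k h x|} = 0 := by
  have : {x | t < |lineAvg k h x|} = ∅ := by
    refine Set.eq_empty_of_forall_notMem fun x hx => ?_
    have hx : t < |lineAvg k h x| := hx
    linarith [abs_lineAvg_le hM h x]
  rw [this, measure_empty]

/-- A nonzero average requires the segment to meet the ball of radius R. Rounding the position s r
of the meeting point down to an integer j places x within R + 1 of -jθ, so about r + 1 balls
suffice. The linear growth in r is what matters. -/
theorem meas_lineAvg_ne_zero_le {k : Euc N → ℝ} {R : ℝ} (hR : ∀ x, k x ≠ 0 → ‖x‖ < R)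
    {θ : Euc N} (hθ : ‖θ‖ = 1) {r : ℝ} (hr : 0 ≤ r) :
    volume {x | lineAvg k (r • θ) x ≠ 0} ≤
      ENNReal.ofReal (r + 1) * volume (Metric.ball (0 : Euc N) (R + 1)) := by
  calc _ ≤ volume (⋃ j ∈ Finset.range (⌊r⌋₊ + 1),
        Metric.ball (-((j : ℝ) • θ)) (R + 1)) := by
        refine measure_mono fun x hx => ?_
        have hx : lineAvg k (r • θ) x ≠ 0 := hx
        have : ∃ s ∈ Set.Ioc (0 : ℝ) 1, k (x + s • r • θ) ≠ 0 := by
          by_contra hcon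
          push Not at hcon
          refine hx ?_
          exact setIntegral_eq_zero_of_forall_eq_zero hcon
        obtain ⟨s, hs, hks⟩ := this
        have hsr : 0 ≤ s * r := mul_nonneg hs.1.le hr
        have h1 := hR _ hks
        simp only [Set.mem_iUnion, Finset.mem_range, exists_prop]
        refine ⟨⌊s * r⌋₊, Nat.lt_succ_of_le (Nat.floor_le_floor (by nlinarith [hs.2])), ?_⟩
        rw [mem_ball_iff_norm, sub_neg_eq_add]
        have h2 : x + (⌊s * r⌋₊ : ℝ) • θ =
            (x + s • r • θ) - (s * r - (⌊s * r⌋₊ : ℝ)) • θ := by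
          rw [smul_smul, sub_smul]; abel
        rw [h2]
        refine (norm_sub_le _ _).trans_lt ?_
        rw [norm_smul, hθ, mul_one, Real.norm_eq_abs,
          abs_of_nonneg (sub_nonneg.2 (Nat.floor_le hsr))]
        linarith [Nat.lt_floor_add_one (s * r)]
    _ ≤ ∑ j ∈ Finset.range (⌊r⌋₊ + 1), volume (Metric.ball (-((j : ℝ) • θ)) (R + 1)) :=
        measure_biUnion_finset_le _ _
    _ = ((⌊r⌋₊ + 1 : ℕ) : ℝ≥0∞) * volume (Metric.ball (0 : Euc N) (R + 1)) := by
        simp [Measure.addHaar_ball_center]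
    _ ≤ _ := by
        gcongr
        rw [← ENNReal.ofReal_natCast]
        refine ENNReal.ofReal_le_ofReal ?_
        push_cast
        linarith [Nat.floor_le hr]

/-- Heights above sup |k| contribute nothing, so only integrability at t = 0 is at stake. For p > 1,
Chebyshev leaves t^(p-2). For p = 1 the tube estimate leaves t^(1/γ) + 1, and 1/γ > -1 in the two
ranges allowed for γ. -/
theorem tendsto_lineFun_of_continuous {k : Euc N → ℝ} (hk : Continuous k)
    (hkc : HasCompactSupport k) {p γ : ℝ} (hγ : γ ≠ 0) (h : 1 < p ∨ p = 1 ∧ (0 < γ ∨ γ < -1))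
    {θ : Euc N} (hθ : ‖θ‖ = 1) {l : Filter ℝ} [l.NeBot] [l.IsCountablyGenerated]
    (hl : ScaleFilter p γ l) :
    Tendsto (lineFun p γ k θ) l (𝓝 (ENNReal.ofReal (1 / |γ|) * ∫⁻ x, ‖k x‖ₑ ^ p)) := by
  have hγ' : 0 < |γ| := abs_pos.2 hγ
  obtain ⟨M, hM⟩ := hk.bounded_above_of_compact_support hkc
  replace hM : ∀ x, |k x| ≤ M := hM
  have hM0 : 0 ≤ M := (abs_nonneg _).trans (hM 0)
  rcases h with hp | ⟨rfl, hγ1⟩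
  · have hkI : ∫⁻ x, ‖k x‖ₑ ≠ ⊤ := (hk.integrable_of_hasCompactSupport hkc).2.ne
    have hc : 0 ≤ p / |γ| := by positivity
    refine tendsto_lineFun_of_dominated hk hkc hp.le hγ θ hl.pos hl.tendsto_scale
      ((Set.Iic M).indicator fun t => (∫⁻ x, ‖k x‖ₑ) / ENNReal.ofReal t) ?_ ?_
    · refine Eventually.of_forall fun lam t ht => ?_
      by_cases htM : t ≤ M
      · rw [Set.indicator_of_mem (show t ∈ Set.Iic M from htM)]
        have h1 := meas_lt_abs_le (μ := volume)
          (measurable_lineAvg hk.measurable (scale p γ lam t • θ)) zero_le_one ht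
        have h2 := lintegral_lineAvg_rpow_le hk.measurable le_rfl (scale p γ lam t • θ)
        simp only [ENNReal.rpow_one, Real.rpow_one] at h1 h2
        exact h1.trans (by gcongr)
      · rw [meas_lineAvg_eq_zero hM _ (not_le.1 htM)]
        exact zero_le
    · refine ne_top_of_le_ne_top (b := ∫⁻ t in Set.Ioc 0 M, ((∫⁻ x, ‖k x‖ₑ) *
        ENNReal.ofReal (p / |γ|)) * ENNReal.ofReal (t ^ (p - 2))) ?_ ?_
      · rw [lintegral_const_mul' _ _ (ENNReal.mul_ne_top hkI ENNReal.ofReal_ne_top),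
          lintegral_Ioc_rpow (by linarith) hM0]
        exact ENNReal.mul_ne_top (ENNReal.mul_ne_top hkI ENNReal.ofReal_ne_top)
          ENNReal.ofReal_ne_top
      · rw [← lintegral_indicator measurableSet_Ioi, ← lintegral_indicator measurableSet_Ioc]
        refine lintegral_mono fun t => ?_
        by_cases ht : t ∈ Set.Ioc 0 M
        · have ht0 : 0 < t := ht.1
          rw [Set.indicator_of_mem ht, Set.indicator_of_mem (show t ∈ Set.Ioi 0 from ht.1),
            Set.indicator_of_mem (show t ∈ Set.Iic M from ht.2)]
          rw [show p - 1 = p - 2 + 1 by ring, Real.rpow_add_one ht0.ne', ENNReal.ofReal_mul hc,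
            ENNReal.ofReal_mul (by positivity), ENNReal.div_eq_inv_mul]
          have : ENNReal.ofReal t * (ENNReal.ofReal t)⁻¹ = 1 :=
            ENNReal.mul_inv_cancel (by simpa using ht0) ENNReal.ofReal_ne_top
          calc _ = (∫⁻ x, ‖k x‖ₑ) * ENNReal.ofReal (p / |γ|) * ENNReal.ofReal (t ^ (p - 2)) *
                (ENNReal.ofReal t * (ENNReal.ofReal t)⁻¹) := by ring
            _ ≤ _ := by rw [this, mul_one]
        · by_cases ht0 : 0 < t
          · have : t ∉ Set.Iic M := fun h => ht ⟨ht0, h⟩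
            rw [Set.indicator_of_mem (show t ∈ Set.Ioi 0 from ht0), Set.indicator_of_notMem this,
              mul_zero]
            exact zero_le
          · rw [Set.indicator_of_notMem (show t ∉ Set.Ioi 0 from ht0)]
            exact zero_le
  · obtain ⟨R, hR⟩ : ∃ R : ℝ, ∀ x, k x ≠ 0 → ‖x‖ < R := by
      obtain ⟨R, hR⟩ := hkc.isCompact.isBounded.subset_ball (0 : Euc N)
      exact ⟨R, fun x hx => by simpa using hR (subset_tsupport _ hx)⟩
    set V := volume (Metric.ball (0 : Euc N) (R + 1))
    have hV : V ≠ ⊤ := measure_ball_lt_top.ne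
    refine tendsto_lineFun_of_dominated hk hkc le_rfl hγ θ hl.pos hl.tendsto_scale
      ((Set.Iic M).indicator fun t => ENNReal.ofReal (t ^ (1 / γ) + 1) * V) ?_ ?_
    · filter_upwards [hl.scale_le, hl.pos] with lam hlam hlpos t ht
      by_cases htM : t ≤ M
      · rw [Set.indicator_of_mem (show t ∈ Set.Iic M from htM)]
        refine (measure_mono fun x hx => ?_).trans ((meas_lineAvg_ne_zero_le hR hθ
          (scale_pos (p := 1) (γ := γ) hlpos ht).le).trans ?_)
        · have hx : t < |lineAvg k (scale 1 γ lam t • θ) x| := hx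
          intro h0
          rw [h0, abs_zero] at hx
          linarith
        · gcongr
          exact hlam t ht
      · rw [meas_lineAvg_eq_zero hM _ (not_le.1 htM)]
        exact zero_le
    · have hq : -1 < 1 / γ := by
        rcases hγ1 with h | h
        · have : 0 < 1 / γ := by positivity
          linarith
        · rw [lt_div_iff_of_neg (by linarith)]; linarith
      refine ne_top_of_le_ne_top (b := ∫⁻ t in Set.Ioc 0 M, (ENNReal.ofReal (1 / |γ|) * V) *
        (ENNReal.ofReal (t ^ (1 / γ)) + 1)) ?_ ?_
      · rw [lintegral_const_mul' _ _ (ENNReal.mul_ne_top ENNReal.ofReal_ne_top hV),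
          lintegral_add_right _ measurable_const, lintegral_Ioc_rpow hq hM0]
        refine ENNReal.mul_ne_top (ENNReal.mul_ne_top ENNReal.ofReal_ne_top hV)
          (ENNReal.add_ne_top.2 ⟨ENNReal.ofReal_ne_top, by simp⟩)
      · rw [← lintegral_indicator measurableSet_Ioi, ← lintegral_indicator measurableSet_Ioc]
        refine lintegral_mono fun t => ?_
        by_cases ht : t ∈ Set.Ioc 0 M
        · have ht0 : 0 < t := ht.1
          rw [Set.indicator_of_mem ht, Set.indicator_of_mem (show t ∈ Set.Ioi 0 from ht.1),
            Set.indicator_of_mem (show t ∈ Set.Iic M from ht.2), sub_self, Real.rpow_zero, mul_one,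
            ENNReal.ofReal_add (by positivity) zero_le_one, ENNReal.ofReal_one]
          exact le_of_eq (by ring)
        · by_cases ht0 : 0 < t
          · have : t ∉ Set.Iic M := fun h => ht ⟨ht0, h⟩
            rw [Set.indicator_of_mem (show t ∈ Set.Ioi 0 from ht0), Set.indicator_of_notMem this,
              mul_zero]
            exact zero_le
          · rw [Set.indicator_of_notMem (show t ∉ Set.Ioi 0 from ht0)]
            exact zero_le

end Domination

/-! ### Approximation in L^p -/

section Density

variable {N : ℕ}

/-- The level is split as λ = (1 - δ)λ + δλ between `k` and `f - k`; the prefactors restore λ^p. -/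
theorem lineFun_le_add {f k : Euc N → ℝ} (hf : Measurable f) (hk : Measurable k) {p γ : ℝ}
    (hp : 1 ≤ p) (hfk : ∫⁻ x, ‖f x - k x‖ₑ ^ p ≠ ⊤) (hkp : ∫⁻ x, ‖k x‖ₑ ^ p ≠ ⊤) (θ : Euc N)
    {δ : ℝ} (hδ0 : 0 < δ) (hδ1 : δ < 1) {lam : ℝ} (hl : 0 < lam) :
    lineFun p γ f θ lam ≤
      ENNReal.ofReal ((1 - δ) ^ (-p)) * lineFun p γ k θ ((1 - δ) * lam) +
      ENNReal.ofReal (δ ^ (-p)) * lineFun p γ (fun x => f x - k x) θ (δ * lam) := by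
  have hδ : 0 < 1 - δ := by linarith
  have hd : Measurable fun x => f x - k x := hf.sub hk
  have hm : ∀ (q : Euc N → ℝ), Measurable q → ∀ c : ℝ, Measurable fun r : ℝ =>
      ENNReal.ofReal ((c * lam) ^ p * r ^ (γ - 1)) *
        volume {x | c * lam * r ^ (γ / p) < |lineAvg q (r • θ) x|} := by
    intro q hq c
    have hS : MeasurableSet {z : ℝ × Euc N |
        c * lam * z.1 ^ (γ / p) < |lineAvg q (z.1 • θ) z.2|} := by
      refine measurableSet_lt (by fun_prop) (Measurable.abs ?_)
      exact (measurable_lineAvg_uncurry hq).comp (by fun_prop :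
        Measurable fun z : ℝ × Euc N => (z.1 • θ, z.2))
    exact (by fun_prop : Measurable fun r : ℝ =>
      ENNReal.ofReal ((c * lam) ^ p * r ^ (γ - 1))).mul (measurable_measure_prodMk_left hS)
  have hcoef : ∀ c : ℝ, 0 < c → ∀ r : ℝ, 0 < r → ENNReal.ofReal (c ^ (-p)) *
      ENNReal.ofReal ((c * lam) ^ p * r ^ (γ - 1)) = ENNReal.ofReal (lam ^ p * r ^ (γ - 1)) := by
    intro c hc r hr
    rw [← ENNReal.ofReal_mul (by positivity), Real.mul_rpow hc.le hl.le, Real.rpow_neg hc.le]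
    congr 1
    have : c ^ p ≠ 0 := (Real.rpow_pos_of_pos hc p).ne'
    field_simp
  unfold lineFun
  rw [← lintegral_const_mul' _ _ ENNReal.ofReal_ne_top,
    ← lintegral_const_mul' _ _ ENNReal.ofReal_ne_top,
    ← lintegral_add_left ((hm k hk _).const_mul _)]
  refine setLIntegral_mono' measurableSet_Ioi fun r hr => ?_
  have hr : 0 < r := hr
  rw [← mul_assoc, ← mul_assoc, hcoef _ hδ r hr, hcoef _ hδ0 r hr, ← mul_add]
  gcongr
  refine (measure_mono_ae ?_).trans (measure_union_le _ _)
  filter_upwards [ae_lineAvg_add hd hk hp hfk hkp (r • θ)] with x hx hlt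
  have hlt : lam * r ^ (γ / p) < |lineAvg f (r • θ) x| := hlt
  simp only [sub_add_cancel] at hx
  by_contra hcon
  have h1 : ¬ ((1 - δ) * lam * r ^ (γ / p) < |lineAvg k (r • θ) x|) := fun h => hcon (Or.inl h)
  have h2 : ¬ (δ * lam * r ^ (γ / p) < |lineAvg (fun x => f x - k x) (r • θ) x|) :=
    fun h => hcon (Or.inr h)
  rw [hx] at hlt
  have h3 := abs_add_le (lineAvg (fun x => f x - k x) (r • θ) x) (lineAvg k (r • θ) x)
  push Not at h1 h2
  nlinarith

/-- Returns from the energy of `k` to that of `f` with a constant close to one: pointwise, either (1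
- δ)|k| ≤ |f| or δ|k| ≤ |f - k|. -/
theorem lintegral_rpow_le_add {f k : Euc N → ℝ} (hf : Measurable f) {p : ℝ}
    (hp : 0 < p) {δ : ℝ} (hδ0 : 0 < δ) (hδ1 : δ < 1) :
    ∫⁻ x, ‖k x‖ₑ ^ p ≤ ENNReal.ofReal ((1 - δ) ^ (-p)) * (∫⁻ x, ‖f x‖ₑ ^ p) +
      ENNReal.ofReal (δ ^ (-p)) * ∫⁻ x, ‖f x - k x‖ₑ ^ p := by
  have hδ : 0 < 1 - δ := by linarith
  rw [← lintegral_const_mul' _ _ ENNReal.ofReal_ne_top,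
    ← lintegral_const_mul' _ _ ENNReal.ofReal_ne_top, ← lintegral_add_left (by fun_prop)]
  refine lintegral_mono fun x => ?_
  have key : ∀ c : ℝ, 0 < c → ∀ a : ℝ, c * |k x| ≤ |a| →
      ‖k x‖ₑ ^ p ≤ ENNReal.ofReal (c ^ (-p)) * ‖a‖ₑ ^ p := by
    intro c hc a ha
    rw [Real.enorm_eq_ofReal_abs, Real.enorm_eq_ofReal_abs,
      ENNReal.ofReal_rpow_of_nonneg (abs_nonneg _) hp.le,
      ENNReal.ofReal_rpow_of_nonneg (abs_nonneg _) hp.le, ← ENNReal.ofReal_mul (by positivity)]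
    refine ENNReal.ofReal_le_ofReal ?_
    have h1 : (c * |k x|) ^ p ≤ |a| ^ p := Real.rpow_le_rpow (by positivity) ha hp.le
    rw [Real.mul_rpow hc.le (abs_nonneg _)] at h1
    rw [Real.rpow_neg hc.le, inv_mul_eq_div, le_div_iff₀ (Real.rpow_pos_of_pos hc p)]
    linarith
  by_cases h : (1 - δ) * |k x| ≤ |f x|
  · exact (key _ hδ _ h).trans le_self_add
  · refine (key _ hδ0 (f x - k x) ?_).trans le_add_self
    have := abs_sub_abs_le_abs_sub (k x) (f x)
    rw [abs_sub_comm] at this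
    linarith

/-- The directional contributions converge to the directional energy. -/
theorem tendsto_lineFun (hN : 1 ≤ N) {f : Euc N → ℝ} (hf : Measurable f) {p γ : ℝ} (hγ : γ ≠ 0)
    (h : 1 < p ∨ p = 1 ∧ (0 < γ ∨ γ < -1)) (hfp : ∫⁻ x, ‖f x‖ₑ ^ p ≠ ⊤)
    {θ : Euc N} (hθ : ‖θ‖ = 1) {l : Filter ℝ} [l.NeBot] [l.IsCountablyGenerated]
    (hl : ScaleFilter p γ l) :
    Tendsto (lineFun p γ f θ) l (𝓝 (ENNReal.ofReal (1 / |γ|) * ∫⁻ x, ‖f x‖ₑ ^ p)) := by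
  have hp : 1 ≤ p := by rcases h with h | h <;> linarith
  have h0 : 0 < p := by linarith
  obtain ⟨C, hC, hCb⟩ := exists_lineFun_le hN hγ h
  set c := ENNReal.ofReal (1 / |γ|)
  have hc : c ≠ ⊤ := ENNReal.ofReal_ne_top
  set I := ∫⁻ x, ‖f x‖ₑ ^ p
  refine tendsto_of_le_liminf_of_limsup_le
    (le_liminf_lineFun hf hp hγ hfp θ hl.pos hl.tendsto_scale) ?_
  -- Here η bounds the L^p error of the approximation. It must vanish before δ does, since its
  -- coefficients contain δ^(-p).
  have hlimsup_add : ∀ δ : ℝ, 0 < δ → δ < 1 → ∀ η : ℝ≥0∞, 0 < η → η ≠ ⊤ →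
      limsup (lineFun p γ f θ) l ≤ ENNReal.ofReal ((1 - δ) ^ (-p)) *
        (c * (ENNReal.ofReal ((1 - δ) ^ (-p)) * I + ENNReal.ofReal (δ ^ (-p)) * η)) +
        ENNReal.ofReal (δ ^ (-p)) * (C * η) := by
    intro δ hδ0 hδ1 η hη0 hη
    have hδ : 0 < 1 - δ := by linarith
    obtain ⟨k, hk, hkc, hkp, hfk⟩ := exists_continuous_lintegral_sub_le hf hp hfp hη0.ne'
    have hd : Measurable fun x => f x - k x := hf.sub hk.measurable
    have hlim : Tendsto (fun lam => ENNReal.ofReal ((1 - δ) ^ (-p)) *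
        lineFun p γ k θ ((1 - δ) * lam) + ENNReal.ofReal (δ ^ (-p)) * (C * η)) l
        (𝓝 (ENNReal.ofReal ((1 - δ) ^ (-p)) * (c * ∫⁻ x, ‖k x‖ₑ ^ p) +
          ENNReal.ofReal (δ ^ (-p)) * (C * η))) := by
      refine Tendsto.add_const _ (ENNReal.Tendsto.const_mul ?_ (Or.inr ENNReal.ofReal_ne_top))
      exact (tendsto_lineFun_of_continuous hk hkc hγ h hθ hl).comp (hl.tendsto_mul _ hδ)
    calc _ ≤ limsup (fun lam => ENNReal.ofReal ((1 - δ) ^ (-p)) *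
          lineFun p γ k θ ((1 - δ) * lam) + ENNReal.ofReal (δ ^ (-p)) * (C * η)) l := by
          refine limsup_le_limsup ?_ (by isBoundedDefault) (by isBoundedDefault)
          filter_upwards [hl.pos] with lam hlam
          refine (lineFun_le_add hf hk.measurable hp (ne_top_of_le_ne_top hη hfk) hkp θ hδ0 hδ1
            hlam).trans ?_
          gcongr
          exact (hCb _ hd θ hθ _ (mul_pos hδ0 hlam)).trans (by gcongr)
      _ = _ := hlim.limsup_eq
      _ ≤ _ := by
          gcongr
          exact (lintegral_rpow_le_add hf h0 hδ0 hδ1).trans (by gcongr)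
  have hlimsup_scaled : ∀ δ : ℝ, 0 < δ → δ < 1 → limsup (lineFun p γ f θ) l ≤
      ENNReal.ofReal ((1 - δ) ^ (-p)) * (c * (ENNReal.ofReal ((1 - δ) ^ (-p)) * I)) := by
    intro δ hδ0 hδ1
    set A := ENNReal.ofReal ((1 - δ) ^ (-p))
    set D := ENNReal.ofReal (δ ^ (-p))
    have hA : A ≠ ⊤ := ENNReal.ofReal_ne_top
    have hD : D ≠ ⊤ := ENNReal.ofReal_ne_top
    have hcont : Continuous fun η : ℝ≥0∞ => A * (c * (A * I + D * η)) + D * (C * η) :=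
      ((ENNReal.continuous_const_mul hA).comp ((ENNReal.continuous_const_mul hc).comp
        (continuous_const.add (ENNReal.continuous_const_mul hD)))).add
        ((ENNReal.continuous_const_mul hD).comp (ENNReal.continuous_const_mul hC))
    have hlim := (hcont.tendsto 0).mono_left (nhdsWithin_le_nhds (s := Set.Ioi 0))
    simp only [mul_zero, add_zero] at hlim
    refine ge_of_tendsto hlim ?_
    have h1 : ∀ᶠ η : ℝ≥0∞ in 𝓝[>] 0, η < 1 :=
      nhdsWithin_le_nhds (gt_mem_nhds one_pos)
    filter_upwards [h1, self_mem_nhdsWithin] with η hη1 hη0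
    exact hlimsup_add δ hδ0 hδ1 η hη0 (ne_top_of_lt hη1)
  have hlim : Tendsto (fun δ : ℝ => ENNReal.ofReal ((1 - δ) ^ (-p)) *
      (c * (ENNReal.ofReal ((1 - δ) ^ (-p)) * I))) (𝓝[>] 0) (𝓝 (1 * (c * (1 * I)))) := by
    have hA : Tendsto (fun δ : ℝ => ENNReal.ofReal ((1 - δ) ^ (-p))) (𝓝[>] 0) (𝓝 1) := by
      have h1 : ContinuousAt (fun δ : ℝ => (1 - δ) ^ (-p)) 0 :=
        ContinuousAt.rpow_const (by fun_prop) (Or.inl (by norm_num))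
      have h2 := ENNReal.tendsto_ofReal (h1.tendsto.mono_left (nhdsWithin_le_nhds (s := Set.Ioi 0)))
      simpa using h2
    refine ENNReal.Tendsto.mul hA (Or.inl one_ne_zero) ?_ (Or.inr ENNReal.one_ne_top)
    refine ENNReal.Tendsto.const_mul ?_ (Or.inr hc)
    exact ENNReal.Tendsto.mul_const hA (Or.inl one_ne_zero)
  simp only [one_mul] at hlim
  refine ge_of_tendsto hlim ?_
  filter_upwards [Ioo_mem_nhdsGT one_pos] with δ hδ
  exact hlimsup_scaled δ hδ.1 hδ.2

end Density

/-! ### From directions back to the level functional -/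

section LevelFunctional

variable {N : ℕ}

theorem MemHomSobolev.exists_measurable {p : ℝ} (hp : 1 ≤ p) {u : Euc N → ℝ}
    (hu : MemHomSobolev (ENNReal.ofReal p) u) :
    ∃ (v : Euc N → ℝ) (g : Euc N → Euc N), Measurable v ∧ Measurable g ∧ u =ᵐ[volume] v ∧
      HasWeakGradient u g ∧ HasWeakGradient v g ∧ ∫⁻ x, ‖g x‖ₑ ^ p ≠ ⊤ ∧
      gradNorm (ENNReal.ofReal p) u ^ p = ∫⁻ x, ‖g x‖ₑ ^ p := by
  have h0 : 0 < p := by linarith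
  have hq0 : ENNReal.ofReal p ≠ 0 := by simpa using h0
  obtain ⟨g, hg, hgp⟩ := hu
  have hum := hg.1.aestronglyMeasurable
  have hgm := hg.2.aestronglyMeasurable
  have hg' : HasWeakGradient u (hgm.mk g) := hg.congr (ae_eq_refl u) hgm.ae_eq_mk
  have hgp' : MemLp (hgm.mk g) (ENNReal.ofReal p) volume := hgp.ae_eq hgm.ae_eq_mk
  refine ⟨hum.mk u, hgm.mk g, hum.stronglyMeasurable_mk.measurable,
    hgm.stronglyMeasurable_mk.measurable, hum.ae_eq_mk, hg',
    hg.congr hum.ae_eq_mk hgm.ae_eq_mk, ?_, ?_⟩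
  · have := hgp'.2
    rw [eLpNorm_lt_top_iff_lintegral_rpow_enorm_lt_top hq0 (by simp),
      ENNReal.toReal_ofReal h0.le] at this
    exact this.ne
  · rw [hg'.gradNorm_eq, eLpNorm_eq_lintegral_rpow_enorm_toReal hq0 (by simp),
      ENNReal.toReal_ofReal h0.le, ← ENNReal.rpow_mul, one_div_mul_cancel h0.ne',
      ENNReal.rpow_one]

theorem lintegral_inner_rpow_le (g : Euc N → Euc N) {p : ℝ} (hp : 0 ≤ p) {θ : Euc N}
    (hθ : ‖θ‖ = 1) : ∫⁻ x, ‖(inner ℝ (g x) θ : ℝ)‖ₑ ^ p ≤ ∫⁻ x, ‖g x‖ₑ ^ p := by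
  refine lintegral_mono fun x => ?_
  gcongr
  refine (enorm_inner_le _ _).trans (le_of_eq ?_)
  rw [← enorm_norm θ, hθ]
  simp

/-- Tonelli, then rotation invariance at each `x`; this is where κ appears. -/
theorem lintegral_sphere_energy (hN : 1 ≤ N) {p : ℝ} (hp : 0 < p) (γ : ℝ) {e : Euc N}
    (he : ‖e‖ = 1) {g : Euc N → Euc N} (hg : Measurable g) :
    ∫⁻ θ : Metric.sphere (0 : Euc N) 1, (ENNReal.ofReal (1 / |γ|) *
      ∫⁻ x, ‖(inner ℝ (g x) (θ : Euc N) : ℝ)‖ₑ ^ p) ∂((volume : Measure (Euc N)).toSphere) =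
    ENNReal.ofReal (kappa p e / |γ|) * ∫⁻ x, ‖g x‖ₑ ^ p := by
  rw [lintegral_const_mul' _ _ ENNReal.ofReal_ne_top, lintegral_lintegral_swap (Measurable.aemeasurable (by fun_prop))]
  simp_rw [lintegral_sphere_inner hN hp he]
  rw [lintegral_const_mul' _ _ ENNReal.ofReal_ne_top, ← mul_assoc,
    ← ENNReal.ofReal_mul (by positivity)]
  congr 2
  ring

/-- Dominated convergence on the sphere, whose finite surface measure makes a constant an admissible
bound. -/
theorem tendsto_levelFunctional_of_lineFun (hN : 1 ≤ N) {u : Euc N → ℝ} {g : Euc N → Euc N}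
    (hg : HasWeakGradient u g) (hu : Measurable u) (hgm : Measurable g) {p γ : ℝ} (hp : 1 ≤ p)
    (hgp : ∫⁻ x, ‖g x‖ₑ ^ p ≠ ⊤) {e : Euc N} (he : ‖e‖ = 1) {l : Filter ℝ}
    [l.IsCountablyGenerated] (hpos : ∀ᶠ lam in l, 0 < lam) {C : ℝ≥0∞} (hC : C ≠ ⊤)
    (hbound : ∀ᶠ lam in l, ∀ θ : Euc N, ‖θ‖ = 1 →
      lineFun p γ (fun y => inner ℝ (g y) θ) θ lam ≤ C)
    (hlim : ∀ θ : Euc N, ‖θ‖ = 1 → Tendsto (lineFun p γ (fun y => inner ℝ (g y) θ) θ) l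
      (𝓝 (ENNReal.ofReal (1 / |γ|) * ∫⁻ x, ‖(inner ℝ (g x) θ : ℝ)‖ₑ ^ p))) :
    Tendsto (levelFunctional p γ u) l
      (𝓝 (ENNReal.ofReal (kappa p e / |γ|) * ∫⁻ x, ‖g x‖ₑ ^ p)) := by
  have h0 : 0 < p := by linarith
  have hev : levelFunctional p γ u =ᶠ[l] fun lam => ∫⁻ θ : Metric.sphere (0 : Euc N) 1,
      lineFun p γ (fun y => inner ℝ (g y) (θ : Euc N)) θ lam
      ∂((volume : Measure (Euc N)).toSphere) := by
    filter_upwards [hpos] with lam hl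
    exact levelFunctional_eq_lineFun hN hg hu hgm hp hgp γ hl.le
  refine Tendsto.congr' hev.symm ?_
  rw [← lintegral_sphere_energy hN h0 γ he hgm]
  refine tendsto_lintegral_filter_of_dominated_convergence (fun _ => C)
    (Eventually.of_forall fun lam => measurable_lineFun hg hu hgm hp hgp γ lam) ?_ ?_ ?_
  · filter_upwards [hbound] with lam hlam
    exact ae_of_all _ fun θ => hlam θ (norm_eq_of_mem_sphere θ)
  · rw [lintegral_const]
    exact ENNReal.mul_ne_top hC (measure_ne_top _ _)
  · exact ae_of_all _ fun θ => hlim θ (norm_eq_of_mem_sphere θ)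

/-- The limit formula in the range where the level functional is bounded by the energy. -/
theorem tendsto_levelFunctional (hN : 1 ≤ N) {p γ : ℝ} (hγ : γ ≠ 0)
    (h : 1 < p ∨ p = 1 ∧ (0 < γ ∨ γ < -1)) {e : Euc N} (he : ‖e‖ = 1) {l : Filter ℝ} [l.NeBot]
    [l.IsCountablyGenerated] (hl : ScaleFilter p γ l) {u : Euc N → ℝ}
    (hu : MemHomSobolev (ENNReal.ofReal p) u) :
    Tendsto (levelFunctional p γ u) l
      (𝓝 (ENNReal.ofReal (kappa p e / |γ|) * gradNorm (ENNReal.ofReal p) u ^ p)) := by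
  have hp : 1 ≤ p := by rcases h with h | h <;> linarith
  have h0 : 0 < p := by linarith
  obtain ⟨v, g, hv, hgm, huv, -, hg, hgp, hnorm⟩ := hu.exists_measurable hp
  obtain ⟨C, hC, hCb⟩ := exists_lineFun_le hN hγ h
  rw [levelFunctional_congr huv, hnorm]
  have hfm : ∀ θ : Euc N, Measurable fun y => (inner ℝ (g y) θ : ℝ) := fun θ => by fun_prop
  refine tendsto_levelFunctional_of_lineFun hN hg hv hgm hp hgp he hl.pos
    (ENNReal.mul_ne_top hC hgp) ?_ ?_
  · filter_upwards [hl.pos] with lam hlam θ hθ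
    exact (hCb _ (hfm θ) θ hθ lam hlam).trans
      (mul_le_mul' le_rfl (lintegral_inner_rpow_le g h0.le hθ))
  · intro θ hθ
    exact tendsto_lineFun hN (hfm θ) hγ h
      (ne_top_of_le_ne_top hgp (lintegral_inner_rpow_le g h0.le hθ)) hθ hl

/-- The lower bound, which holds without restriction on the parameters. -/
theorem le_liminf_levelFunctional (hN : 1 ≤ N) {p γ : ℝ} (hp : 1 ≤ p) (hγ : γ ≠ 0)
    {e : Euc N} (he : ‖e‖ = 1) {l : Filter ℝ} [l.NeBot]
    [l.IsCountablyGenerated] (hl : ScaleFilter p γ l) {u : Euc N → ℝ}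
    (hu : MemHomSobolev (ENNReal.ofReal p) u) :
    ENNReal.ofReal (kappa p e / |γ|) * gradNorm (ENNReal.ofReal p) u ^ p ≤
      liminf (levelFunctional p γ u) l := by
  have h0 : 0 < p := by linarith
  obtain ⟨v, g, hv, hgm, huv, -, hg, hgp, hnorm⟩ := hu.exists_measurable hp
  rw [levelFunctional_congr huv, hnorm]
  have hfm : ∀ θ : Euc N, Measurable fun y => (inner ℝ (g y) θ : ℝ) := fun θ => by fun_prop
  have hev : levelFunctional p γ v =ᶠ[l] fun lam => ∫⁻ θ : Metric.sphere (0 : Euc N) 1,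
      lineFun p γ (fun y => inner ℝ (g y) (θ : Euc N)) θ lam
      ∂((volume : Measure (Euc N)).toSphere) := by
    filter_upwards [hl.pos] with lam hl
    exact levelFunctional_eq_lineFun hN hg hv hgm hp hgp γ hl.le
  rw [liminf_congr hev, ← lintegral_sphere_energy hN h0 γ he hgm]
  refine le_trans (lintegral_mono fun θ => ?_)
    (lintegral_liminf_le fun lam => measurable_lineFun hg hv hgm hp hgp γ lam)
  exact le_liminf_lineFun (hfm θ) hp hγ (ne_top_of_le_ne_top hgp
    (lintegral_inner_rpow_le g h0.le (norm_eq_of_mem_sphere θ))) θ hl.pos hl.tendsto_scale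

/-! ### Compactly supported C¹ functions -/

section Smooth

theorem continuous_gradient_of_contDiff_one {u : Euc N → ℝ} (hu : ContDiff ℝ 1 u) :
    Continuous (gradient u) :=
  (InnerProductSpace.toDual ℝ (Euc N)).symm.continuous.comp (hu.continuous_fderiv (by simp))

theorem inner_gradient (u : Euc N → ℝ) (x v : Euc N) :
    inner ℝ v (gradient u x) = fderiv ℝ u x v := by
  rw [real_inner_comm, gradient, InnerProductSpace.toDual_symm_apply]

/-- The classical gradient of a `C¹` function is its weak gradient. -/
theorem hasWeakGradient_gradient {u : Euc N → ℝ} (hu : ContDiff ℝ 1 u) :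
    HasWeakGradient u (gradient u) := by
  have hgc := continuous_gradient_of_contDiff_one hu
  refine ⟨hu.continuous.locallyIntegrable, hgc.locallyIntegrable, fun φ hφ hφc => ?_⟩
  refine ext_inner_left ℝ fun v => ?_
  have h1 := integrable_smul_gradient hu.continuous.locallyIntegrable hφ hφc
  have h2 := integrable_smul_field hgc.locallyIntegrable hφ hφc
  have h3 : Integrable fun x => u x • φ x := by
    simpa [mul_comm] using
      hu.continuous.locallyIntegrable.integrable_smul_left_of_hasCompactSupport hφ.continuous hφc
  have i1 := h1.const_inner (𝕜 := ℝ) v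
  have i2 := h2.const_inner (𝕜 := ℝ) v
  simp only [inner_smul_right, inner_gradient] at i1 i2
  rw [inner_neg_right, ← integral_inner h1, ← integral_inner h2]
  simp only [inner_smul_right, inner_gradient]
  have := integral_smul_fderiv_eq_neg_fderiv_smul_of_integrable (μ := volume) (f := u) (g := φ)
    (v := v) (by simpa [mul_comm] using i2) (by simpa using i1) h3
    (fun x _ => hu.differentiable (by simp) x) (fun x _ => hφ.differentiable (by simp) x)
  simpa [mul_comm] using this

/-- The average of the directional derivative over a segment of length r is an increment of `u`
divided by r, and vanishes unless an endpoint lies in the support. Superlevel sets thus have measure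
at most twice that of the support, whatever r is. This cancellation replaces the tube estimate and
works for every γ ≠ 0. -/
theorem tendsto_levelFunctional_of_contDiff (hN : 1 ≤ N) {γ : ℝ} (hγ : γ ≠ 0)
    {e : Euc N} (he : ‖e‖ = 1) {l : Filter ℝ} [l.NeBot] [l.IsCountablyGenerated]
    (hl : ScaleFilter 1 γ l) {u : Euc N → ℝ} (hu : ContDiff ℝ 1 u) (hc : HasCompactSupport u) :
    Tendsto (levelFunctional 1 γ u) l
      (𝓝 (ENNReal.ofReal (kappa 1 e / |γ|) * gradNorm 1 u)) := by
  have hg := hasWeakGradient_gradient hu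
  have hgc := continuous_gradient_of_contDiff_one hu
  have hgs : HasCompactSupport (gradient u) := hasCompactSupport_gradient hc
  have hgp : ∫⁻ x, ‖gradient u x‖ₑ ^ (1 : ℝ) ≠ ⊤ := by
    simpa using (hgc.integrable_of_hasCompactSupport hgs).2.ne
  have hnorm : gradNorm 1 u = ∫⁻ x, ‖gradient u x‖ₑ ^ (1 : ℝ) := by
    rw [hg.gradNorm_eq, eLpNorm_one_eq_lintegral_enorm]; simp
  rw [hnorm]
  obtain ⟨M, hM⟩ := hgc.bounded_above_of_compact_support hgs
  have hM0 : 0 ≤ M := (norm_nonneg _).trans (hM 0)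
  set V := volume (tsupport u)
  have hV : V ≠ ⊤ := hc.isCompact.measure_lt_top.ne
  set B : ℝ → ℝ≥0∞ := (Set.Iic M).indicator fun _ => V + V
  have hBint : ∫⁻ t in Set.Ioi (0 : ℝ), ENNReal.ofReal (1 / |γ| * t ^ ((1 : ℝ) - 1)) * B t ≠ ⊤ := by
    refine ne_top_of_le_ne_top (b := ∫⁻ t in Set.Ioc 0 M, ENNReal.ofReal (1 / |γ|) * (V + V)) ?_ ?_
    · rw [setLIntegral_const]
      exact ENNReal.mul_ne_top (ENNReal.mul_ne_top ENNReal.ofReal_ne_top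
        (ENNReal.add_ne_top.2 ⟨hV, hV⟩)) (by simp)
    · rw [← lintegral_indicator measurableSet_Ioi, ← lintegral_indicator measurableSet_Ioc]
      refine lintegral_mono fun t => ?_
      by_cases ht0 : 0 < t
      · by_cases htM : t ≤ M
        · simp [B, ht0, htM]
        · simp [B, ht0, htM]
      · simp [ht0]
  have hkey : ∀ θ : Euc N, ‖θ‖ = 1 → ∀ r : ℝ, 0 < r → ∀ t : ℝ, 0 < t →
      volume {x | t < |lineAvg (fun y => inner ℝ (gradient u y) θ) (r • θ) x|} ≤ B t := by
    intro θ hθ r hr t ht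
    by_cases htM : t ≤ M
    · rw [show B t = V + V from Set.indicator_of_mem (show t ∈ Set.Iic M from htM) _]
      have hpre : volume ((fun x => x + r • θ) ⁻¹' tsupport u) = V :=
        (measurePreserving_add_right volume (r • θ)).measure_preimage_emb
          (measurableEmbedding_addRight _) _
      have hVV : V + V = volume ((fun x => x + r • θ) ⁻¹' tsupport u) + V := by rw [hpre]
      rw [hVV]
      refine le_trans (measure_mono_ae ?_) (measure_union_le _ _)
      filter_upwards [hg.ae_sub_eq hgc.measurable le_rfl hgp (r • θ)] with x hx hxt
      have hxt : t < |lineAvg (fun y => inner ℝ (gradient u y) θ) (r • θ) x| := hxt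
      simp only [real_inner_smul_right] at hx
      rw [lineAvg_const_mul] at hx
      by_contra hcon
      have h1 : x + r • θ ∉ tsupport u := fun h => hcon (Or.inl h)
      have h2 : x ∉ tsupport u := fun h => hcon (Or.inr h)
      rw [image_eq_zero_of_notMem_tsupport h1, image_eq_zero_of_notMem_tsupport h2, sub_self] at hx
      have h3 := (mul_eq_zero.1 hx.symm).resolve_left hr.ne'
      rw [h3, abs_zero] at hxt
      linarith
    · rw [meas_lineAvg_eq_zero (M := M) (fun x => ?_) _ (not_le.1 htM)]
      · exact zero_le
      · refine (abs_real_inner_le_norm _ _).trans ?_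
        rw [hθ, mul_one]
        exact hM x
  refine tendsto_levelFunctional_of_lineFun hN hg hu.continuous.measurable hgc.measurable le_rfl
    hgp he hl.pos hBint ?_ ?_
  · filter_upwards [hl.pos] with lam hlam θ hθ
    rw [lineFun_eq one_pos hγ hlam]
    refine setLIntegral_mono' measurableSet_Ioi fun t ht => ?_
    gcongr
    exact hkey θ hθ _ (scale_pos hlam ht) t ht
  · intro θ hθ
    refine tendsto_lineFun_of_dominated (by fun_prop)
      (hgs.comp_left (g := fun v => (inner ℝ v θ : ℝ)) (by simp)) le_rfl hγ θ hl.pos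
      hl.tendsto_scale B ?_ hBint
    filter_upwards [hl.pos] with lam hlam t ht
    exact hkey θ hθ _ (scale_pos hlam ht) t ht

end Smooth

end LevelFunctional

/-! ### The category argument -/

section Baire

variable {N : ℕ}

/-- The seminorm does not see constants, but it controls increments in L¹; this is the only
continuity that semicontinuity of the level functional needs. -/
theorem MemHomSobolev.lintegral_sub_le {w : Euc N → ℝ} (hw : MemHomSobolev 1 w) (h : Euc N) :
    ∫⁻ x, ‖w (x + h) - w x‖ₑ ≤ gradNorm 1 w * ‖h‖ₑ := by
  have hw' : MemHomSobolev (ENNReal.ofReal 1) w := by simpa using hw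
  obtain ⟨-, g, -, hgm, -, hg, -, hgp, hnorm⟩ := hw'.exists_measurable le_rfl
  simp only [ENNReal.ofReal_one, ENNReal.rpow_one] at hnorm
  have hfm : Measurable fun y => (inner ℝ (g y) h : ℝ) := by fun_prop
  have h1 := lintegral_lineAvg_rpow_le hfm le_rfl h
  simp only [ENNReal.rpow_one] at h1
  calc ∫⁻ x, ‖w (x + h) - w x‖ₑ = ∫⁻ x, ‖lineAvg (fun y => inner ℝ (g y) h) h x‖ₑ := by
        refine lintegral_congr_ae ?_
        filter_upwards [hg.ae_sub_eq hgm le_rfl hgp h] with x hx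
        rw [hx]
    _ ≤ ∫⁻ x, ‖(inner ℝ (g x) h : ℝ)‖ₑ := h1
    _ ≤ ∫⁻ x, ‖g x‖ₑ * ‖h‖ₑ := lintegral_mono fun x => enorm_inner_le _ _
    _ = _ := by rw [lintegral_mul_const' _ _ (by simp), hnorm]

theorem levelFunctional_eq_translations {u : Euc N → ℝ} (hu : Measurable u) (γ : ℝ) {lam : ℝ}
    (hl : 0 ≤ lam) :
    levelFunctional 1 γ u lam = ENNReal.ofReal lam * ∫⁻ h : Euc N,
      ENNReal.ofReal (‖h‖ ^ (γ - (N : ℝ))) *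
        volume {x | lam * ‖h‖ ^ (1 + γ) < |u (x + h) - u x|} := by
  rw [levelFunctional, nu_superlevel_eq hu _ _ hl, Real.rpow_one, div_one]

theorem measurable_translations {u : Euc N → ℝ} (hu : Measurable u) (γ lam : ℝ) :
    Measurable fun h : Euc N => ENNReal.ofReal (‖h‖ ^ (γ - (N : ℝ))) *
      volume {x | lam * ‖h‖ ^ (1 + γ) < |u (x + h) - u x|} := by
  have hS : MeasurableSet {z : Euc N × Euc N |
      lam * ‖z.1‖ ^ (1 + γ) < |u (z.2 + z.1) - u z.2|} :=
    measurableSet_lt (by fun_prop) (by fun_prop)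
  exact (by fun_prop : Measurable fun h : Euc N => ENNReal.ofReal (‖h‖ ^ (γ - (N : ℝ)))).mul
    (measurable_measure_prodMk_left hS)

/-- The level functional is lower semicontinuous in the seminorm topology. -/
theorem isClosed_levelFunctional_le (γ : ℝ) {lam : ℝ} (hl : 0 < lam) (c : ℝ≥0∞) :
    IsClosed {u : HomSobolev N 1 | levelFunctional 1 γ u.toFun lam ≤ c} := by
  refine IsSeqClosed.isClosed fun U u hU hlim => ?_
  have hmeas : ∀ v : HomSobolev N 1, AEStronglyMeasurable v.toFun volume := fun v => by
    obtain ⟨g, hg, -⟩ := v.mem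
    exact hg.1.aestronglyMeasurable
  set V : ℕ → Euc N → ℝ := fun n => (hmeas (U n)).mk _
  set v : Euc N → ℝ := (hmeas u).mk _
  have hV : ∀ n, Measurable (V n) := fun n => (hmeas (U n)).stronglyMeasurable_mk.measurable
  have hv : Measurable v := (hmeas u).stronglyMeasurable_mk.measurable
  have hVU : ∀ n, (U n).toFun =ᵐ[volume] V n := fun n => (hmeas (U n)).ae_eq_mk
  have hvu : u.toFun =ᵐ[volume] v := (hmeas u).ae_eq_mk
  have hnorm : Tendsto (fun n => gradNorm 1 (U n - u).toFun) atTop (𝓝 0) := by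
    have h1 : Tendsto (fun n => ‖U n - u‖) atTop (𝓝 0) := tendsto_iff_norm_sub_tendsto_zero.1 hlim
    have h2 := ENNReal.tendsto_ofReal h1
    rw [ENNReal.ofReal_zero] at h2
    refine h2.congr fun n => ?_
    exact ENNReal.ofReal_toReal (U n - u).mem.gradNorm_ne_top
  have hconv : ∀ h : Euc N, ∀ ε : ℝ, 0 < ε → Tendsto (fun n =>
      volume {x | ε < |(V n (x + h) - V n x) - (v (x + h) - v x)|}) atTop (𝓝 0) := by
    intro h ε hε
    have hb : Tendsto (fun n => gradNorm 1 (U n - u).toFun * ‖h‖ₑ / ENNReal.ofReal ε) atTop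
        (𝓝 0) := by
      have h1 := ENNReal.Tendsto.mul_const (b := ‖h‖ₑ) hnorm (Or.inr (by simp))
      have h2 := ENNReal.Tendsto.div_const (b := ENNReal.ofReal ε) h1
        (Or.inr (by simpa using hε))
      simpa using h2
    refine tendsto_of_tendsto_of_tendsto_of_le_of_le tendsto_const_nhds hb (fun _ => zero_le) ?_
    intro n
    have h1 := meas_lt_abs_le (μ := volume)
      (F := fun x => (V n (x + h) - V n x) - (v (x + h) - v x))
      (((hV n).comp (measurable_add_const h)).sub (hV n) |>.sub
        ((hv.comp (measurable_add_const h)).sub hv)) zero_le_one hε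
    simp only [ENNReal.rpow_one, Real.rpow_one] at h1
    refine h1.trans (ENNReal.div_le_div_right ?_ _)
    refine le_trans (le_of_eq ?_) ((U n - u).mem.lintegral_sub_le h)
    refine lintegral_congr_ae ?_
    have q := (measurePreserving_add_right (volume : Measure (Euc N)) h).quasiMeasurePreserving
    filter_upwards [hVU n, hvu, q.ae (hVU n), q.ae hvu] with x e1 e2 e3 e4
    rw [← e1, ← e2, ← e3, ← e4]
    change _ = ‖((U n).toFun (x + h) - u.toFun (x + h)) - ((U n).toFun x - u.toFun x)‖ₑ
    congr 1; ring
  change levelFunctional 1 γ u.toFun lam ≤ c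
  rw [levelFunctional_congr hvu, levelFunctional_eq_translations hv γ hl.le]
  -- For each `h` the increments converge in measure, so their superlevel measures are lower
  -- semicontinuous; Fatou in `h` does the rest.
  calc _ ≤ ENNReal.ofReal lam * liminf (fun n => ∫⁻ h : Euc N,
        ENNReal.ofReal (‖h‖ ^ (γ - (N : ℝ))) *
          volume {x | lam * ‖h‖ ^ (1 + γ) < |V n (x + h) - V n x|}) atTop := by
        gcongr
        refine le_trans (lintegral_mono fun h => ?_)
          (lintegral_liminf_le fun n => measurable_translations (hV n) γ lam)
        rw [ENNReal.liminf_const_mul_of_ne_top ENNReal.ofReal_ne_top]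
        gcongr
        exact meas_lt_abs_le_liminf (hconv h) _
    _ = liminf (fun n => levelFunctional 1 γ (U n).toFun lam) atTop := by
        rw [← ENNReal.liminf_const_mul_of_ne_top ENNReal.ofReal_ne_top]
        congr 1 with n
        rw [levelFunctional_congr (hVU n), levelFunctional_eq_translations (hV n) γ hl.le]
    _ ≤ c := by
        refine liminf_le_of_le (by isBoundedDefault) fun b hb => ?_
        obtain ⟨n, hn⟩ := hb.exists
        exact hn.trans (hU n)

theorem levelFunctional_const_smul (γ : ℝ) (w : Euc N → ℝ) {c : ℝ} (hc : 0 < c) (lam : ℝ) :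
    levelFunctional 1 γ (c • w) (c * lam) = ENNReal.ofReal c * levelFunctional 1 γ w lam := by
  have : superlevel (c * lam) (γ / 1) (c • w) = superlevel lam (γ / 1) w := by
    ext z
    have : diffQuot (γ / 1) (c • w) z.1 z.2 = c * diffQuot (γ / 1) w z.1 z.2 := by
      simp only [diffQuot, Pi.smul_apply, smul_eq_mul]; ring
    simp only [superlevel, Set.mem_ofPred_eq, this, abs_mul, abs_of_pos hc,
      mul_lt_mul_iff_right₀ hc]
  rw [levelFunctional, levelFunctional, this, Real.rpow_one, Real.rpow_one,
    ENNReal.ofReal_mul hc.le, mul_assoc]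

/-- A quasi-triangle inequality: a difference quotient of `w` above 2λ forces that of `u + w` or of
`u` above λ. It transfers largeness from `w` to `u + w`. -/
theorem levelFunctional_two_mul_le (γ : ℝ) (u w : Euc N → ℝ) (lam : ℝ) :
    levelFunctional 1 γ w (2 * lam) ≤
      2 * (levelFunctional 1 γ (u + w) lam + levelFunctional 1 γ u lam) := by
  have hsub : superlevel (2 * lam) (γ / 1) w ⊆
      superlevel lam (γ / 1) (u + w) ∪ superlevel lam (γ / 1) u := by
    rintro z ⟨hz, hlt⟩
    by_contra hcon
    have h1 : ¬ lam < |diffQuot (γ / 1) (u + w) z.1 z.2| := fun h => hcon (Or.inl ⟨hz, h⟩)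
    have h2 : ¬ lam < |diffQuot (γ / 1) u z.1 z.2| := fun h => hcon (Or.inr ⟨hz, h⟩)
    have h3 : diffQuot (γ / 1) w z.1 z.2 =
        diffQuot (γ / 1) (u + w) z.1 z.2 - diffQuot (γ / 1) u z.1 z.2 := by
      simp only [diffQuot, Pi.add_apply]; ring
    rw [h3] at hlt
    have := abs_sub (diffQuot (γ / 1) (u + w) z.1 z.2) (diffQuot (γ / 1) u z.1 z.2)
    linarith
  simp only [levelFunctional, Real.rpow_one]
  rw [ENNReal.ofReal_mul (by norm_num), ← mul_add, mul_assoc]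
  simp only [ENNReal.ofReal_ofNat]
  gcongr
  exact (measure_mono hsub).trans (measure_union_le _ _)

/-- If the level functional is not bounded by the energy at small levels, then it is generically
unbounded as the level tends to zero. -/
theorem isMeagre_bounded_levelFunctional {γ : ℝ} {K : ℝ} (hK : 0 < K)
    (hw : ∀ C δ : ℝ, 0 < C → 0 < δ → ∃ w : Euc N → ℝ, MemHomSobolev 1 w ∧
      gradNorm 1 w ≤ ENNReal.ofReal K ∧ ∃ lam : ℝ, 0 < lam ∧ lam < δ ∧
        ENNReal.ofReal C ≤ levelFunctional 1 γ w lam) :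
    IsMeagre {u : HomSobolev N 1 | ∃ n : ℕ, ∀ lam : ℝ, 0 < lam → lam < 1 / ((n : ℝ) + 1) →
      levelFunctional 1 γ u.toFun lam ≤ n} := by
  set A : ℕ → Set (HomSobolev N 1) := fun n => {u | ∀ lam : ℝ, 0 < lam → lam < 1 / ((n : ℝ) + 1) →
      levelFunctional 1 γ u.toFun lam ≤ n}
  have hA : ∀ n, IsClosed (A n) := by
    intro n
    have : A n = ⋂ lam : ℝ, ⋂ _ : 0 < lam, ⋂ _ : lam < 1 / ((n : ℝ) + 1),
        {u : HomSobolev N 1 | levelFunctional 1 γ u.toFun lam ≤ n} := by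
      ext u; simp [A]
    rw [this]
    exact isClosed_iInter fun lam => isClosed_iInter fun h0 => isClosed_iInter fun _ =>
      isClosed_levelFunctional_le γ h0 _
  have hint : ∀ n, interior (A n) = ∅ := by
    intro n
    refine Set.eq_empty_of_forall_notMem fun u hu => ?_
    obtain ⟨ε, hε, hball⟩ := Metric.isOpen_iff.1 isOpen_interior u hu
    have huA : u ∈ A n := interior_subset hu
    set c : ℝ := ε / (2 * K)
    have hc : 0 < c := by positivity
    -- The perturbation c w has norm at most ε/2. The first constant makes its functional at least
    -- 4n + 1, above the bound 2(n + n) that membership of both `u` and `u + c w` in `A n` would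
    -- impose; the second makes the common level cλ/2 smaller than 1/(n + 1).
    obtain ⟨w, hwS, hwK, lam, hl0, hlδ, hCw⟩ := hw ((4 * n + 1) / c) (2 / (c * (n + 1)))
      (by positivity) (by positivity)
    set w' : HomSobolev N 1 := (⟨w, hwS⟩ : homSobolevSubmodule N 1)
    have hnorm : ‖c • w'‖ < ε := by
      have h1 : ‖c • w'‖ = (gradNorm 1 (c • w)).toReal := rfl
      obtain ⟨g, hg, -⟩ := id hwS
      rw [h1, (hg.const_smul c).gradNorm_eq, eLpNorm_const_smul, ← hg.gradNorm_eq,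
        ENNReal.toReal_mul]
      have h2 : (gradNorm 1 w).toReal ≤ K := ENNReal.toReal_le_of_le_ofReal hK.le hwK
      have h3 : ‖c‖ₑ.toReal = c := by simp [abs_of_pos hc]
      rw [h3]
      calc c * (gradNorm 1 w).toReal ≤ c * K := by gcongr
        _ = ε / 2 := by simp only [c]; field_simp
        _ < ε := by linarith
    have hmem : u + c • w' ∈ A n := by
      refine interior_subset (hball ?_)
      rw [mem_ball_iff_norm]
      simpa using hnorm
    set μ : ℝ := c * lam / 2
    have hμ0 : 0 < μ := by positivity
    have hμ1 : μ < 1 / ((n : ℝ) + 1) := by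
      have h1 : c * lam < c * (2 / (c * (n + 1))) := by gcongr
      have h2 : c * (2 / (c * ((n : ℝ) + 1))) = 2 * (1 / (n + 1)) := by field_simp
      simp only [μ]
      linarith
    have h1 := levelFunctional_two_mul_le γ u.toFun (c • w) μ
    have h2 : levelFunctional 1 γ u.toFun μ ≤ n := huA μ hμ0 hμ1
    have h3 : levelFunctional 1 γ (u.toFun + c • w) μ ≤ n := hmem μ hμ0 hμ1
    have h4 : 2 * μ = c * lam := by simp only [μ]; ring
    rw [h4, levelFunctional_const_smul γ w hc] at h1
    have h5 : ENNReal.ofReal (4 * n + 1) ≤ 2 * ((n : ℝ≥0∞) + n) := by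
      calc ENNReal.ofReal (4 * n + 1) = ENNReal.ofReal c * ENNReal.ofReal ((4 * n + 1) / c) := by
            rw [← ENNReal.ofReal_mul hc.le]; congr 1; field_simp
        _ ≤ _ := by gcongr
        _ ≤ _ := h1
        _ ≤ _ := by gcongr
    have h6 : (2 * ((n : ℝ≥0∞) + n)) = ENNReal.ofReal (4 * n) := by
      rw [ENNReal.ofReal_mul (by norm_num), ENNReal.ofReal_natCast, ENNReal.ofReal_ofNat]; ring
    rw [h6, ENNReal.ofReal_le_ofReal_iff (by positivity)] at h5
    linarith
  have hunion : {u : HomSobolev N 1 | ∃ n : ℕ, ∀ lam : ℝ, 0 < lam → lam < 1 / ((n : ℝ) + 1) →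
      levelFunctional 1 γ u.toFun lam ≤ n} = ⋃ n, A n := by
    ext u; simp [A]
  rw [hunion]
  exact isMeagre_iUnion fun n => IsNowhereDense.isMeagre (by
    rw [IsNowhereDense, (hA n).closure_eq]; exact hint n)

theorem exists_bound_of_tendsto {γ : ℝ} {u : Euc N → ℝ} {L : ℝ≥0∞} (hL : L ≠ ⊤)
    (h : Tendsto (levelFunctional 1 γ u) (𝓝[>] 0) (𝓝 L)) :
    ∃ n : ℕ, ∀ lam : ℝ, 0 < lam → lam < 1 / ((n : ℝ) + 1) → levelFunctional 1 γ u lam ≤ n := by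
  obtain ⟨m, hm⟩ := ENNReal.exists_nat_gt hL
  obtain ⟨δ, hδ, hδm⟩ := mem_nhdsGT_iff_exists_Ioo_subset.1 (h.eventually (gt_mem_nhds hm))
  obtain ⟨k, hk⟩ := exists_nat_one_div_lt (show (0 : ℝ) < δ from hδ)
  refine ⟨max m k, fun lam h0 h1 => ?_⟩
  have h2 : lam < δ := by
    refine h1.trans (lt_of_le_of_lt ?_ hk)
    gcongr
    exact le_max_right m k
  have h3 : levelFunctional 1 γ u lam < m := hδm ⟨h0, h2⟩
  exact h3.le.trans (by exact_mod_cast le_max_left m k)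

end Baire

/-! ### Scaling of integrals -/

theorem lintegral_comp_smul {E : Type*} [NormedAddCommGroup E] [NormedSpace ℝ E]
    [MeasurableSpace E] [BorelSpace E] [FiniteDimensional ℝ E] (μ : Measure E)
    [μ.IsAddHaarMeasure] (f : E → ℝ≥0∞) {c : ℝ} (hc : 0 < c) :
    ∫⁻ x, f (c • x) ∂μ = ENNReal.ofReal ((c ^ Module.finrank ℝ E)⁻¹) * ∫⁻ x, f x ∂μ := by
  have h1 := (Homeomorph.smulOfNeZero c hc.ne' (α := E)).measurableEmbedding.lintegral_map
    (μ := μ) f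
  have h2 : Measure.map (Homeomorph.smulOfNeZero c hc.ne' (α := E)) μ = _ :=
    Measure.map_addHaar_smul μ hc.ne'
  rw [h2, lintegral_smul_measure, abs_of_pos (by positivity)] at h1
  exact h1.symm

theorem lintegral_Ioi_comp_div (f : ℝ → ℝ≥0∞) {ρ : ℝ} (hρ : 0 < ρ) :
    ∫⁻ r in Set.Ioi (0 : ℝ), f (r / ρ) = ENNReal.ofReal ρ * ∫⁻ r in Set.Ioi (0 : ℝ), f r := by
  have h := lintegral_comp_smul volume ((Set.Ioi (0 : ℝ)).indicator f) (inv_pos.2 hρ)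
  rw [lintegral_indicator measurableSet_Ioi] at h
  rw [← lintegral_indicator measurableSet_Ioi]
  simp only [Module.finrank_self, pow_one, inv_inv] at h
  rw [← h]
  refine lintegral_congr fun r => ?_
  by_cases hr : 0 < r
  · rw [Set.indicator_of_mem (show r ∈ Set.Ioi 0 from hr),
      Set.indicator_of_mem (show ρ⁻¹ • r ∈ Set.Ioi 0 from mul_pos (inv_pos.2 hρ) hr),
      smul_eq_mul, div_eq_inv_mul]
  · rw [Set.indicator_of_notMem (show r ∉ Set.Ioi 0 from hr),
      Set.indicator_of_notMem]
    intro h2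
    have h2 : 0 < ρ⁻¹ * r := h2
    exact hr (pos_of_mul_pos_right h2 (inv_pos.2 hρ).le)

theorem volume_setOf_sub_div_mem (S : Set ℝ) (c : ℝ) {ρ : ℝ} (hρ : 0 < ρ) :
    volume {x | (x - c) / ρ ∈ S} = ENNReal.ofReal ρ * volume S := by
  have h1 : {x | (x - c) / ρ ∈ S} = (fun x => x - c) ⁻¹' ((fun x => x * ρ⁻¹) ⁻¹' S) := by
    ext x; simp [div_eq_mul_inv]
  rw [h1, (measurePreserving_sub_right volume c).measure_preimage_emb
    (MeasurableEquiv.subRight c).measurableEmbedding,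
    Real.volume_preimage_mul_right (inv_ne_zero hρ.ne'), inv_inv, abs_of_pos hρ]

/-! ### Monotone profiles on the line -/

/-- A `C¹` monotone transition from `0` to `1` taking place in `[0, 1]`. -/
structure IsRamp (W : ℝ → ℝ) : Prop where
  contDiff : ContDiff ℝ 1 W
  mono : Monotone W
  eq_zero : ∀ x ≤ 0, W x = 0
  eq_one : ∀ x, 1 ≤ x → W x = 1

theorem isRamp_smoothTransition : IsRamp Real.smoothTransition :=
  ⟨Real.smoothTransition.contDiff, Real.smoothTransition.monotone,
    fun _ => Real.smoothTransition.zero_of_nonpos, fun _ => Real.smoothTransition.one_of_one_le⟩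

theorem IsRamp.comp_div {W : ℝ → ℝ} (hW : IsRamp W) {ε : ℝ} (hε : 0 < ε) (hε1 : ε ≤ 1) :
    IsRamp fun x => W (x / ε) := by
  refine ⟨hW.1.comp (contDiff_id.div_const ε), fun x y h => hW.2 (by gcongr),
    fun x hx => hW.3 _ (div_nonpos_of_nonpos_of_nonneg hx hε.le), fun x hx => hW.4 _ ?_⟩
  rw [one_le_div hε]; linarith

theorem IsRamp.nonneg {W : ℝ → ℝ} (hW : IsRamp W) (x : ℝ) : 0 ≤ W x := by
  rcases le_total x 0 with h | h
  · exact (hW.3 x h).ge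
  · exact (hW.3 0 le_rfl).ge.trans (hW.2 h)

theorem IsRamp.le_one {W : ℝ → ℝ} (hW : IsRamp W) (x : ℝ) : W x ≤ 1 := by
  rcases le_total 1 x with h | h
  · exact (hW.4 x h).le
  · exact (hW.2 h).trans (hW.4 1 le_rfl).le

/-- The points of `(-a, 1 + a - r)` at which the increment of `W` over a step `r` exceeds
`θ r^(1 + γ)`. -/
def jumpSet (γ a θ : ℝ) (W : ℝ → ℝ) (r : ℝ) : Set ℝ :=
  {x | -a < x ∧ x + r < 1 + a ∧ θ * r ^ (1 + γ) < W (x + r) - W x}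

/-- The one-dimensional functional at level `θ`, localized to `(-a, 1 + a)`. -/
def jumpEnergy (γ a θ : ℝ) (W : ℝ → ℝ) : ℝ≥0∞ :=
  ∫⁻ r in Set.Ioi (0 : ℝ), ENNReal.ofReal (r ^ (γ - 1)) * volume (jumpSet γ a θ W r)

theorem measurableSet_jumpSet {γ a θ : ℝ} {W : ℝ → ℝ} (hW : Measurable W) :
    MeasurableSet {z : ℝ × ℝ | z.2 ∈ jumpSet γ a θ W z.1} := by
  have h1 : MeasurableSet {z : ℝ × ℝ | -a < z.2} := measurableSet_lt (by fun_prop) (by fun_prop)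
  have h2 : MeasurableSet {z : ℝ × ℝ | z.2 + z.1 < 1 + a} :=
    measurableSet_lt (by fun_prop) (by fun_prop)
  have h3 : MeasurableSet {z : ℝ × ℝ | θ * z.1 ^ (1 + γ) < W (z.2 + z.1) - W z.2} :=
    measurableSet_lt (by fun_prop) (by fun_prop)
  exact h1.inter (h2.inter h3)

/-! ### Self-similar doubling of a profile -/

section Doubling

variable {γ ρ a θ : ℝ} {W : ℝ → ℝ}

/-- Two half-size copies of `W`, contracted by `ρ` to the ends of `[0, 1]`. -/
def doubleRamp (ρ : ℝ) (W : ℝ → ℝ) (x : ℝ) : ℝ :=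
  (W (x / ρ) + W ((x - (1 - ρ)) / ρ)) / 2

theorem IsRamp.doubleRamp (hW : IsRamp W) (hρ : 0 < ρ) (hρ1 : ρ < 1) :
    IsRamp (doubleRamp ρ W) := by
  refine ⟨?_, fun x y h => ?_, fun x hx => ?_, fun x hx => ?_⟩
  · exact ((hW.1.comp (contDiff_id.div_const ρ)).add
      (hW.1.comp ((contDiff_id.sub contDiff_const).div_const ρ))).div_const 2
  · have h1 : W (x / ρ) ≤ W (y / ρ) := hW.2 (by gcongr)
    have h2 : W ((x - (1 - ρ)) / ρ) ≤ W ((y - (1 - ρ)) / ρ) := hW.2 (by gcongr)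
    simp only [WeightedReverse.doubleRamp]; linarith
  · rw [WeightedReverse.doubleRamp, hW.3 _ (div_nonpos_of_nonpos_of_nonneg hx hρ.le),
      hW.3 _ (div_nonpos_of_nonpos_of_nonneg (by linarith) hρ.le)]
    simp
  · rw [WeightedReverse.doubleRamp, hW.4 _ (by rw [one_le_div hρ]; linarith),
      hW.4 _ (by rw [one_le_div hρ]; linarith)]
    norm_num

/-- Since ρ^(1+γ) = 1/2, contracting by ρ and halving the height preserves the jump condition. Since
ρ(1 + a) = 1/2, admissible jumps of the two copies stay on opposite sides of 1/2. The extra term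
counts jumps from below 0 to above 1: their increment is 1, which beats the threshold by the choice
of `θ`, and they belong to neither copy. -/
theorem volume_jumpSet_doubleRamp_ge (hW : IsRamp W) (hρ : 0 < ρ) (hρ2 : ρ < 1 / 2)
    (hργ : ρ ^ (1 + γ) = 1 / 2) (ha : 0 < a) (hρa : ρ * (1 + a) = 1 / 2) (hγ : -1 ≤ γ)
    (hθ0 : 0 < θ) (hθ : θ * (1 + a) ^ (1 + γ) < 1) {r : ℝ} (hr : 0 < r) :
    ENNReal.ofReal (2 * ρ) * volume (jumpSet γ a θ W (r / ρ)) +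
      (Set.Ioo 1 (1 + a)).indicator (fun r => ENNReal.ofReal (r - 1)) r ≤
      volume (jumpSet γ a θ (doubleRamp ρ W) r) := by
  have hWm := hW.contDiff.continuous.measurable
  set S := jumpSet γ a θ W (r / ρ)
  have hS : MeasurableSet S := (measurableSet_jumpSet hWm).preimage measurable_prodMk_left
  set A : Set ℝ := {x | (x - 0) / ρ ∈ S}
  set B : Set ℝ := {x | (x - (1 - ρ)) / ρ ∈ S}
  have hAm : MeasurableSet A := hS.preimage (by fun_prop)
  have hBm : MeasurableSet B := hS.preimage (by fun_prop)
  have hT := hW.doubleRamp hρ (by linarith)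
  have hrpow : θ * r ^ (1 + γ) = θ * (r / ρ) ^ (1 + γ) / 2 := by
    rw [Real.div_rpow hr.le hρ.le, hργ]; ring
  have hAr : ∀ x ∈ A, -a < x ∧ x + r < 1 / 2 ∧ x ∈ jumpSet γ a θ (doubleRamp ρ W) r := by
    rintro x ⟨h1, h2, h3⟩
    rw [sub_zero] at h1 h2 h3
    have e1 : -(a * ρ) < x := by rw [lt_div_iff₀ hρ] at h1; linarith
    have e2 : x + r < 1 / 2 := by
      rw [← add_div, div_lt_iff₀ hρ] at h2; linarith
    have e3 : a * ρ ≤ a := by nlinarith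
    refine ⟨by linarith, e2, by linarith, by linarith, ?_⟩
    rw [← add_div] at h3
    have h4 : W ((x - (1 - ρ)) / ρ) ≤ W ((x + r - (1 - ρ)) / ρ) := by
      apply hW.2; gcongr; linarith
    rw [hrpow]
    simp only [doubleRamp]; linarith
  have hBr : ∀ x ∈ B, 1 / 2 < x ∧ x ∈ jumpSet γ a θ (doubleRamp ρ W) r := by
    rintro x ⟨h1, h2, h3⟩
    have e1 : 1 / 2 < x := by rw [lt_div_iff₀ hρ] at h1; linarith
    have e0 : (x - (1 - ρ)) / ρ + r / ρ = (x + r - (1 - ρ)) / ρ := by rw [← add_div]; congr 1; ring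
    rw [e0] at h2 h3
    have e2 : x + r < 1 + a * ρ := by
      rw [div_lt_iff₀ hρ] at h2; linarith
    have e3 : a * ρ ≤ a := by nlinarith
    refine ⟨e1, by linarith, by linarith, ?_⟩
    have h4 : W (x / ρ) ≤ W ((x + r) / ρ) := by
      apply hW.2; gcongr; linarith
    rw [hrpow]
    simp only [doubleRamp]; linarith
  have hAB : Disjoint A B := Set.disjoint_left.2 fun x hxA hxB => by
    have := (hAr x hxA).2.1
    have := (hBr x hxB).1
    linarith
  have hAB' : ENNReal.ofReal (2 * ρ) * volume S = volume (A ∪ B) := by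
    rw [measure_union hAB hBm, volume_setOf_sub_div_mem S _ hρ, volume_setOf_sub_div_mem S _ hρ,
      ENNReal.ofReal_mul (by norm_num), ENNReal.ofReal_ofNat]
    ring
  rw [hAB']
  by_cases h : r ∈ Set.Ioo 1 (1 + a)
  · rw [Set.indicator_of_mem h]
    have hv : ENNReal.ofReal (r - 1) = volume (Set.Ioo (1 - r) 0) := by
      rw [Real.volume_Ioo]; congr 1; ring
    rw [hv, ← measure_union ?_ measurableSet_Ioo]
    · refine measure_mono (Set.union_subset (Set.union_subset (fun x hx => (hAr x hx).2.2)
        fun x hx => (hBr x hx).2) fun x hx => ?_)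
      have h1 := hx.1
      have h2 := hx.2
      have h3 := h.1
      have h4 := h.2
      refine ⟨by linarith, by linarith, ?_⟩
      rw [hT.4 _ (by linarith), hT.3 _ h2.le, sub_zero]
      refine lt_of_le_of_lt ?_ hθ
      gcongr
      linarith
    · refine Set.disjoint_left.2 fun x hx hx' => ?_
      have h1 := hx'.1
      have h2 := hx'.2
      rcases hx with hx | hx
      · have := (hAr x hx).2.1
        linarith
      · have := (hBr x hx).1
        linarith
  · rw [Set.indicator_of_notMem h, add_zero]
    exact measure_mono (Set.union_subset (fun x hx => (hAr x hx).2.2) fun x hx => (hBr x hx).2)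

/-- Two copies rescaled by ρ carry the factor 2ρ · ρ^(γ-1) · ρ = 2ρ^(1+γ) = 1, so they reproduce the
energy exactly, and the long jumps add an amount independent of `W`. -/
theorem jumpEnergy_doubleRamp_ge (hW : IsRamp W) (hρ : 0 < ρ) (hρ2 : ρ < 1 / 2)
    (hργ : ρ ^ (1 + γ) = 1 / 2) (ha : 0 < a) (hρa : ρ * (1 + a) = 1 / 2) (hγ : -1 ≤ γ)
    (hθ0 : 0 < θ) (hθ : θ * (1 + a) ^ (1 + γ) < 1) :
    jumpEnergy γ a θ W + ∫⁻ r in Set.Ioo 1 (1 + a), ENNReal.ofReal (r ^ (γ - 1) * (r - 1)) ≤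
      jumpEnergy γ a θ (doubleRamp ρ W) := by
  have h1 : jumpEnergy γ a θ W = ∫⁻ r in Set.Ioi (0 : ℝ),
      ENNReal.ofReal (r ^ (γ - 1)) * (ENNReal.ofReal (2 * ρ) * volume (jumpSet γ a θ W (r / ρ))) := by
    have h2 := lintegral_Ioi_comp_div
      (fun r => ENNReal.ofReal (r ^ (γ - 1)) * volume (jumpSet γ a θ W r)) hρ
    have h3 : ENNReal.ofReal (2 * ρ) * ENNReal.ofReal (ρ ^ (γ - 1)) * ENNReal.ofReal ρ = 1 := by
      rw [← ENNReal.ofReal_mul (by positivity), ← ENNReal.ofReal_mul (by positivity),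
        ← ENNReal.ofReal_one]
      congr 1
      have : ρ ^ (γ - 1) = ρ ^ (1 + γ) / (ρ * ρ) := by
        rw [show γ - 1 = 1 + γ - 1 - 1 by ring, Real.rpow_sub_one hρ.ne', Real.rpow_sub_one hρ.ne']
        field_simp
      rw [this, hργ]; field_simp
    calc jumpEnergy γ a θ W = ENNReal.ofReal (2 * ρ) * ENNReal.ofReal (ρ ^ (γ - 1)) *
          (ENNReal.ofReal ρ * jumpEnergy γ a θ W) := by rw [← mul_assoc, h3, one_mul]
      _ = _ := by
        rw [jumpEnergy, ← h2, ← lintegral_const_mul' _ _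
          (ENNReal.mul_ne_top ENNReal.ofReal_ne_top ENNReal.ofReal_ne_top)]
        refine setLIntegral_congr_fun measurableSet_Ioi fun r hr => ?_
        have hr : 0 < r := hr
        have e : r ^ (γ - 1) = ρ ^ (γ - 1) * (r / ρ) ^ (γ - 1) := by
          rw [← Real.mul_rpow hρ.le (by positivity)]; congr 1; field_simp
        rw [e, ENNReal.ofReal_mul (p := ρ ^ (γ - 1)) (by positivity)]
        ring
  have h2 : ∫⁻ r in Set.Ioo 1 (1 + a), ENNReal.ofReal (r ^ (γ - 1) * (r - 1)) =
      ∫⁻ r in Set.Ioi (0 : ℝ), ENNReal.ofReal (r ^ (γ - 1)) *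
        (Set.Ioo 1 (1 + a)).indicator (fun r => ENNReal.ofReal (r - 1)) r := by
    rw [← lintegral_indicator measurableSet_Ioo, ← lintegral_indicator measurableSet_Ioi]
    refine lintegral_congr fun r => ?_
    by_cases h : r ∈ Set.Ioo 1 (1 + a)
    · have h0 : 0 < r := by linarith [h.1]
      rw [Set.indicator_of_mem h, Set.indicator_of_mem (show r ∈ Set.Ioi 0 from h0),
        Set.indicator_of_mem h, ENNReal.ofReal_mul (by positivity)]
    · rw [Set.indicator_of_notMem h]
      simp [Set.indicator, h]
  rw [h1, h2, ← lintegral_add_right, jumpEnergy]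
  · refine setLIntegral_mono' measurableSet_Ioi fun r hr => ?_
    rw [← mul_add]
    gcongr
    exact volume_jumpSet_doubleRamp_ge hW hρ hρ2 hργ ha hρa hγ hθ0 hθ hr
  · exact Measurable.mul (by fun_prop) (Measurable.indicator (by fun_prop) measurableSet_Ioo)

end Doubling

/-! ### Profiles of arbitrarily large jump energy -/

theorem exists_large_jumpEnergy_of_gt {γ : ℝ} (hγ1 : -1 < γ) (hγ0 : γ < 0) :
    ∃ a θ : ℝ, 0 < a ∧ 0 < θ ∧ ∀ C : ℝ, ∃ W, IsRamp W ∧ ENNReal.ofReal C ≤ jumpEnergy γ a θ W := by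
  have hg : 0 < 1 + γ := by linarith
  -- The contraction ratio of the Cantor set of dimension 1 + γ; it is below 1/2 precisely because γ
  -- < 0. Each doubling step approaches the Cantor function and gains the fixed amount `c`.
  set ρ : ℝ := (1 / 2 : ℝ) ^ (1 / (1 + γ))
  have hρ : 0 < ρ := by positivity
  have hργ : ρ ^ (1 + γ) = 1 / 2 := by
    rw [← Real.rpow_mul (by norm_num), one_div_mul_cancel hg.ne', Real.rpow_one]
  have hρ2 : ρ < 1 / 2 := by
    calc ρ < (1 / 2 : ℝ) ^ (1 : ℝ) := by
          apply Real.rpow_lt_rpow_of_exponent_gt (by norm_num) (by norm_num)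
          rw [lt_div_iff₀ hg]; linarith
      _ = 1 / 2 := Real.rpow_one _
  set a : ℝ := 1 / (2 * ρ) - 1
  have ha : 0 < a := by
    have : 1 < 1 / (2 * ρ) := by rw [lt_div_iff₀ (by positivity)]; linarith
    simp only [a]; linarith
  have hρa : ρ * (1 + a) = 1 / 2 := by simp only [a]; field_simp; ring
  set θ : ℝ := 1 / (2 * (1 + a) ^ (1 + γ))
  have hθ0 : 0 < θ := by positivity
  have hθ : θ * (1 + a) ^ (1 + γ) < 1 := by
    have : 0 < (1 + a) ^ (1 + γ) := by positivity
    have e : θ * (1 + a) ^ (1 + γ) = 1 / 2 := by simp only [θ]; field_simp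
    rw [e]; norm_num
  refine ⟨a, θ, ha, hθ0, fun C => ?_⟩
  set c : ℝ≥0∞ := ∫⁻ r in Set.Ioo 1 (1 + a), ENNReal.ofReal (r ^ (γ - 1) * (r - 1))
  have hc : c ≠ 0 := by
    refine (setLIntegral_pos_iff (by fun_prop)).2 ?_ |>.ne'
    have : Set.Ioo 1 (1 + a) ⊆
        (Function.support fun r : ℝ => ENNReal.ofReal (r ^ (γ - 1) * (r - 1))) ∩
          Set.Ioo 1 (1 + a) := by
      intro r hr
      refine ⟨?_, hr⟩
      have h1 : 0 < r := by linarith [hr.1]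
      have h2 : 0 < r - 1 := by linarith [hr.1]
      have : 0 < r ^ (γ - 1) * (r - 1) := by positivity
      simp [this]
    refine lt_of_lt_of_le ?_ (measure_mono this)
    simp [ha]
  have key : ∀ k : ℕ, ∃ W, IsRamp W ∧ k * c ≤ jumpEnergy γ a θ W := by
    intro k
    induction k with
    | zero => exact ⟨_, isRamp_smoothTransition, by simp⟩
    | succ k ih =>
      obtain ⟨W, hW, h⟩ := ih
      refine ⟨doubleRamp ρ W, hW.doubleRamp hρ (by linarith), ?_⟩
      refine le_trans ?_ (jumpEnergy_doubleRamp_ge hW hρ hρ2 hργ ha hρa hγ1.le hθ0 hθ)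
      push_cast
      rw [add_mul, one_mul]
      gcongr
  obtain ⟨k, hk⟩ := ENNReal.exists_nat_mul_gt hc (ENNReal.ofReal_ne_top (r := C))
  obtain ⟨W, hW, h⟩ := key k
  exact ⟨W, hW, hk.le.trans h⟩

/-- The threshold no longer depends on r. A step of width ε is crossed from a set of starting points
of length at least r/2 for every r in (2ε, 1], giving at least ∫ r^(-1)/2 dr = (1/2) log(1/(2ε)),
which ε makes equal to |C|. -/
theorem exists_large_jumpEnergy_neg_one (C : ℝ) :
    ∃ W, IsRamp W ∧ ENNReal.ofReal C ≤ jumpEnergy (-1) 1 (1 / 2) W := by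
  set ε : ℝ := Real.exp (-(2 * |C|)) / 2
  have hε : 0 < ε := by positivity
  have hε1 : 2 * ε ≤ 1 := by
    have : Real.exp (-(2 * |C|)) ≤ 1 := Real.exp_le_one_iff.2 (by simp)
    simp only [ε]; linarith
  refine ⟨fun x => Real.smoothTransition (x / ε),
    isRamp_smoothTransition.comp_div hε (by linarith), ?_⟩
  calc ENNReal.ofReal C ≤ ENNReal.ofReal |C| := ENNReal.ofReal_le_ofReal (le_abs_self C)
    _ = ENNReal.ofReal (∫ r in (2 * ε)..1, r⁻¹ / 2) := by
        rw [intervalIntegral.integral_div, integral_inv_of_pos (by positivity) one_pos]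
        congr 1
        have : 2 * ε = Real.exp (-(2 * |C|)) := by simp only [ε]; ring
        rw [this, one_div, ← Real.exp_neg, Real.log_exp]; ring
    _ = ∫⁻ r in Set.Ioc (2 * ε) 1, ENNReal.ofReal (r⁻¹ / 2) := by
        rw [intervalIntegral.integral_of_le hε1, ofReal_integral_eq_lintegral_ofReal]
        · refine (ContinuousOn.integrableOn_Icc ?_).mono_set Set.Ioc_subset_Icc_self
          refine (continuousOn_inv₀.mono fun r hr => ?_).div_const 2
          have : 0 < r := by linarith [hr.1]
          exact this.ne'
        · filter_upwards [ae_restrict_mem measurableSet_Ioc] with r hr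
          have : 0 < r := by linarith [hr.1]
          positivity
    _ ≤ ∫⁻ r in Set.Ioc (2 * ε) 1, ENNReal.ofReal (r ^ ((-1 : ℝ) - 1)) *
          volume (jumpSet (-1) 1 (1 / 2) (fun x => Real.smoothTransition (x / ε)) r) := by
        refine setLIntegral_mono' measurableSet_Ioc fun r hr => ?_
        have h0 : 0 < r := by linarith [hr.1]
        have h1 := hr.1
        have h2 := hr.2
        have hsub : Set.Ioo (ε - r) 0 ⊆
            jumpSet (-1) 1 (1 / 2) (fun x => Real.smoothTransition (x / ε)) r := by
          intro x hx
          have h3 := hx.1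
          have h4 := hx.2
          refine ⟨by linarith, by linarith, ?_⟩
          dsimp only
          rw [Real.smoothTransition.one_of_one_le (by rw [one_le_div hε]; linarith),
            Real.smoothTransition.zero_of_nonpos
              (div_nonpos_of_nonpos_of_nonneg h4.le hε.le)]
          norm_num
        refine le_trans ?_ (mul_le_mul' le_rfl (measure_mono hsub))
        rw [Real.volume_Ioo, ← ENNReal.ofReal_mul (by positivity)]
        apply ENNReal.ofReal_le_ofReal
        have e : r ^ ((-1 : ℝ) - 1) = r⁻¹ * r⁻¹ := by
          rw [Real.rpow_sub_one h0.ne', Real.rpow_neg_one, div_eq_mul_inv]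
        rw [e]
        have h5 : r / 2 ≤ 0 - (ε - r) := by linarith
        calc r⁻¹ / 2 = r⁻¹ * r⁻¹ * (r / 2) := by field_simp
          _ ≤ _ := by gcongr
    _ ≤ _ := lintegral_mono_set fun r hr => by
        have : 0 < r := by linarith [hr.1]
        exact this

theorem exists_large_jumpEnergy {γ : ℝ} (hγ1 : -1 ≤ γ) (hγ0 : γ < 0) :
    ∃ a θ : ℝ, 0 < a ∧ 0 < θ ∧ ∀ C : ℝ, ∃ W, IsRamp W ∧ ENNReal.ofReal C ≤ jumpEnergy γ a θ W := by
  rcases hγ1.lt_or_eq with h | h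
  · exact exists_large_jumpEnergy_of_gt h hγ0
  · subst h
    exact ⟨1, 1 / 2, one_pos, by norm_num, exists_large_jumpEnergy_neg_one⟩

/-! ### Moving the level by dilation -/

section Dilation

variable {N : ℕ} {w : Euc N → ℝ}

theorem gradNorm_one_eq_lintegral (hw : ContDiff ℝ 1 w) :
    gradNorm 1 w = ∫⁻ x, ‖fderiv ℝ w x‖ₑ := by
  rw [(hasWeakGradient_gradient hw).gradNorm_eq, eLpNorm_one_eq_lintegral_enorm]
  refine lintegral_congr fun x => ?_
  rw [gradient, ← enorm_norm, LinearIsometryEquiv.norm_map, enorm_norm]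

theorem memHomSobolev_of_contDiff (hw : ContDiff ℝ 1 w) (hc : HasCompactSupport w) :
    MemHomSobolev 1 w :=
  ⟨gradient w, hasWeakGradient_gradient hw,
    (continuous_gradient_of_contDiff_one hw).memLp_of_hasCompactSupport
      (hasCompactSupport_gradient hc)⟩

/-- The dilation of `w` by the factor `R` that preserves the energy `‖∇w‖_{L¹}`. -/
def dilate (R : ℝ) (w : Euc N → ℝ) (x : Euc N) : ℝ := R / R ^ N * w (R⁻¹ • x)

theorem contDiff_dilate (hw : ContDiff ℝ 1 w) (R : ℝ) : ContDiff ℝ 1 (dilate R w) :=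
  contDiff_const.mul (hw.comp (contDiff_const_smul _))

theorem hasCompactSupport_dilate (hc : HasCompactSupport w) {R : ℝ} (hR : 0 < R) :
    HasCompactSupport (dilate R w) :=
  (hc.comp_homeomorph (Homeomorph.smulOfNeZero R⁻¹ (inv_ne_zero hR.ne'))).mul_left

theorem gradNorm_dilate (hw : ContDiff ℝ 1 w) {R : ℝ} (hR : 0 < R) :
    gradNorm 1 (dilate R w) = gradNorm 1 w := by
  rw [gradNorm_one_eq_lintegral hw, gradNorm_one_eq_lintegral (contDiff_dilate hw R)]
  have h1 : ∀ x, ‖fderiv ℝ (dilate R w) x‖ₑ =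
      ENNReal.ofReal ((R ^ N)⁻¹) * ‖fderiv ℝ w (R⁻¹ • x)‖ₑ := by
    intro x
    have hd : DifferentiableAt ℝ (fun x => w (R⁻¹ • x)) x :=
      ((hw.comp (contDiff_const_smul R⁻¹)).differentiable (by simp)) x
    have : fderiv ℝ (dilate R w) x = (R ^ N)⁻¹ • fderiv ℝ w (R⁻¹ • x) := by
      change fderiv ℝ (fun x => R / R ^ N * w (R⁻¹ • x)) x = _
      rw [fderiv_const_mul hd, fderiv_comp_smul, smul_smul]
      congr 1
      field_simp
    rw [this, enorm_smul, Real.enorm_eq_ofReal (by positivity)]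
  simp_rw [h1]
  rw [lintegral_const_mul' _ _ ENNReal.ofReal_ne_top,
    lintegral_comp_smul volume (fun x => ‖fderiv ℝ w x‖ₑ) (inv_pos.2 hR), ← mul_assoc,
    ← ENNReal.ofReal_mul (by positivity), finrank_euclideanSpace_fin, inv_pow, inv_inv,
    inv_mul_cancel₀ (by positivity), ENNReal.ofReal_one, one_mul]

/-- All powers of R from the amplitude, the threshold and the two integrations combine into the
level. As the energy is unchanged, a value at a fixed level is carried to arbitrarily small levels
as soon as N + γ > 0. -/
theorem levelFunctional_dilate (hw : Measurable w) (γ : ℝ) {R lam : ℝ} (hR : 0 < R)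
    (hl : 0 ≤ lam) :
    levelFunctional 1 γ (dilate R w) lam = levelFunctional 1 γ w (lam * R ^ ((N : ℝ) + γ)) := by
  have hdm : Measurable (dilate R w) := by unfold dilate; fun_prop
  rw [levelFunctional_eq_translations hdm γ hl, levelFunctional_eq_translations hw γ (by positivity)]
  set G : Euc N → ℝ≥0∞ := fun h => ENNReal.ofReal (‖h‖ ^ (γ - (N : ℝ))) *
        volume {x | lam * R ^ ((N : ℝ) + γ) * ‖h‖ ^ (1 + γ) < |w (x + h) - w x|}
  have hset : ∀ h : Euc N, {x | lam * ‖h‖ ^ (1 + γ) < |dilate R w (x + h) - dilate R w x|} =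
      (fun x => R⁻¹ • x) ⁻¹' {x | lam * R ^ ((N : ℝ) + γ) * ‖R⁻¹ • h‖ ^ (1 + γ) <
        |w (x + R⁻¹ • h) - w x|} := by
    intro h
    ext x
    have hc : 0 < R / R ^ N := by positivity
    have e1 : lam * ‖h‖ ^ (1 + γ) =
        R / R ^ N * (lam * R ^ ((N : ℝ) + γ) * ‖R⁻¹ • h‖ ^ (1 + γ)) := by
      rw [norm_smul, Real.norm_eq_abs, abs_of_pos (inv_pos.2 hR),
        Real.mul_rpow (by positivity) (by positivity), Real.inv_rpow hR.le, Real.rpow_add hR,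
        Real.rpow_add hR, Real.rpow_natCast, Real.rpow_one]
      have : 0 < R ^ γ := by positivity
      field_simp
    have e2 : |dilate R w (x + h) - dilate R w x| =
        R / R ^ N * |w (R⁻¹ • x + R⁻¹ • h) - w (R⁻¹ • x)| := by
      rw [dilate, dilate, smul_add, ← mul_sub, abs_mul, abs_of_pos hc]
    simp only [Set.mem_preimage, Set.mem_ofPred_eq, e1, e2, mul_lt_mul_iff_right₀ hc]
  have hG : ∀ h : Euc N, ENNReal.ofReal (‖h‖ ^ (γ - (N : ℝ))) *
      volume {x | lam * ‖h‖ ^ (1 + γ) < |dilate R w (x + h) - dilate R w x|} =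
      ENNReal.ofReal (R ^ γ) * G (R⁻¹ • h) := by
    intro h
    have e1 : ENNReal.ofReal (R ^ γ) * ENNReal.ofReal (‖R⁻¹ • h‖ ^ (γ - (N : ℝ))) =
        ENNReal.ofReal (‖h‖ ^ (γ - (N : ℝ))) * ENNReal.ofReal (R ^ N) := by
      rw [← ENNReal.ofReal_mul (by positivity), ← ENNReal.ofReal_mul (by positivity), norm_smul,
        Real.norm_eq_abs, abs_of_pos (inv_pos.2 hR), Real.mul_rpow (by positivity) (by positivity),
        Real.inv_rpow hR.le, Real.rpow_sub hR, Real.rpow_natCast]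
      congr 1
      have : 0 < R ^ γ := by positivity
      field_simp
    simp only [G]
    rw [hset, Measure.addHaar_preimage_smul volume (inv_ne_zero hR.ne'), ← mul_assoc, ← mul_assoc,
      e1, finrank_euclideanSpace_fin, inv_pow, inv_inv, abs_of_pos (by positivity)]
  simp_rw [hG]
  rw [lintegral_const_mul' _ _ ENNReal.ofReal_ne_top, lintegral_comp_smul volume G (inv_pos.2 hR),
    ← mul_assoc, ← mul_assoc, ← ENNReal.ofReal_mul hl, ← ENNReal.ofReal_mul (by positivity),
    finrank_euclideanSpace_fin, inv_pow, inv_inv, Real.rpow_add hR, Real.rpow_natCast]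
  congr 2
  ring

/-- Superlevel sets grow as the level decreases; only the prefactor is lost. For N = 1 and γ = -1
dilation leaves the level fixed, and this comparison takes its place. -/
theorem levelFunctional_neg_one_ge (hw : Measurable w) {lam θ : ℝ} (hl : 0 < lam) (h : lam ≤ θ) :
    ENNReal.ofReal (lam / θ) * levelFunctional 1 (-1) w θ ≤ levelFunctional 1 (-1) w lam := by
  have hθ : 0 < θ := hl.trans_le h
  rw [levelFunctional_eq_translations hw _ hl.le, levelFunctional_eq_translations hw _ hθ.le,
    ← mul_assoc, ← ENNReal.ofReal_mul (by positivity), div_mul_cancel₀ _ hθ.ne']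
  gcongr with v x

end Dilation

/-! ### Lifting profiles to several variables -/

section Lift

variable {n : ℕ}

@[simp] theorem consCoord_zero (z : ℝ × (Fin n → ℝ)) : consCoord n z 0 = z.1 := rfl

@[simp] theorem consCoord_succ (z : ℝ × (Fin n → ℝ)) (i : Fin n) :
    consCoord n z i.succ = z.2 i := rfl

theorem consCoord_add (z z' : ℝ × (Fin n → ℝ)) :
    consCoord n (z + z') = consCoord n z + consCoord n z' := by
  ext i
  refine Fin.cases ?_ (fun j => ?_) i <;> simp

theorem norm_le_card_mul {N : ℕ} (x : Euc N) {B : ℝ} (hB : 0 ≤ B) (h : ∀ i, |x i| ≤ B) :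
    ‖x‖ ≤ N * B := by
  rw [EuclideanSpace.norm_eq]
  refine Real.sqrt_le_iff.2 ⟨by positivity, ?_⟩
  have hle : (N : ℝ) ≤ (N : ℝ) ^ 2 := by
    exact_mod_cast Nat.le_self_pow (by norm_num) N
  calc ∑ i, ‖x i‖ ^ 2 ≤ ∑ _i : Fin N, B ^ 2 := by
        refine Finset.sum_le_sum fun i _ => ?_
        have := h i
        rw [Real.norm_eq_abs]
        gcongr
    _ = N * B ^ 2 := by simp
    _ ≤ (N : ℝ) ^ 2 * B ^ 2 := by gcongr
    _ = _ := by ring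

/-- A function that depends only on the first coordinate on a large ball inherits a lower bound
from its one-dimensional profile. -/
theorem jumpEnergy_le_translations {γ a θ : ℝ} (hγ1 : -1 ≤ γ) (hγ0 : γ < 0) (ha : 0 < a)
    (hθ : 0 < θ) {W : ℝ → ℝ} {w : Euc (n + 1) → ℝ} (hwm : Measurable w)
    (hw : ∀ x : Euc (n + 1), ‖x‖ ≤ (n + 1) * (2 + 2 * a) → w x = W (x 0)) :
    ENNReal.ofReal (((n : ℝ) + 1) ^ (γ - (n + 1))) * jumpEnergy γ a θ W ≤
      ∫⁻ h : Euc (n + 1), ENNReal.ofReal (‖h‖ ^ (γ - ((n + 1 : ℕ) : ℝ))) *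
        volume {x | θ / ((n : ℝ) + 1) ^ (1 + γ) * ‖h‖ ^ (1 + γ) < |w (x + h) - w x|} := by
  set M : ℝ := (n : ℝ) + 1
  have hM : 0 < M := by positivity
  have hMc : ((n + 1 : ℕ) : ℝ) = M := by push_cast; rfl
  rw [hMc]
  set F : Euc (n + 1) → ℝ≥0∞ := fun h => ENNReal.ofReal (‖h‖ ^ (γ - M)) *
        volume {x | θ / M ^ (1 + γ) * ‖h‖ ^ (1 + γ) < |w (x + h) - w x|}
  have hF : Measurable F := by
    have := measurable_translations hwm γ (θ / M ^ (1 + γ))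
    rwa [hMc] at this
  -- Only steps with first coordinate t and the others in [0, t] are kept: there ‖h‖ is between t
  -- and Mt, and the factor M^(1+γ) in the level absorbs the loss. Base points range over the jump
  -- set times a unit cube.
  have hbound : ∀ t : ℝ, 0 < t → ∀ k ∈ Set.Icc (0 : Fin n → ℝ) (fun _ => t),
      ENNReal.ofReal ((M * t) ^ (γ - M)) * volume (jumpSet γ a θ W t) ≤ F (consCoord n (t, k)) := by
    intro t ht k hk
    set h : Euc (n + 1) := consCoord n (t, k)
    have hcoord : ∀ i, |h i| ≤ t := by
      intro i
      refine Fin.cases ?_ (fun j => ?_) i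
      · rw [consCoord_zero, abs_of_pos ht]
      · rw [consCoord_succ, abs_of_nonneg (hk.1 j)]; exact hk.2 j
    have hh : ‖h‖ ≤ M * t := by
      have := norm_le_card_mul h ht.le hcoord
      rwa [hMc] at this
    have hh0 : 0 < ‖h‖ := by
      have : ‖h 0‖ ≤ ‖h‖ := PiLp.norm_apply_le h 0
      rw [consCoord_zero, Real.norm_eq_abs, abs_of_pos ht] at this
      linarith
    refine mul_le_mul' (ENNReal.ofReal_le_ofReal
      (Real.rpow_le_rpow_of_nonpos hh0 hh (by linarith))) ?_
    rw [← (measurePreserving_consCoord n).measure_preimage_emb (measurableEmbedding_consCoord n)]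
    have hprod : volume (jumpSet γ a θ W t) =
        volume (jumpSet γ a θ W t ×ˢ Set.Icc (0 : Fin n → ℝ) 1) := by
      rw [Measure.volume_eq_prod, Measure.prod_prod, Real.volume_Icc_pi]
      simp
    rw [hprod]
    refine measure_mono ?_
    rintro ⟨s, y⟩ ⟨⟨h1, h2, h3⟩, hy⟩
    have h1 : -a < s := h1
    have h2 : s + t < 1 + a := h2
    have hx1 : ‖consCoord n (s, y)‖ ≤ (n + 1) * (2 + 2 * a) := by
      have := norm_le_card_mul (consCoord n (s, y)) (B := 2 + 2 * a) (by positivity) (fun i => ?_)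
      · rwa [hMc] at this
      · refine Fin.cases ?_ (fun j => ?_) i
        · rw [consCoord_zero, abs_le]; constructor <;> dsimp only <;> linarith
        · have e1 : 0 ≤ y j := hy.1 j
          have e2 : y j ≤ 1 := hy.2 j
          rw [consCoord_succ, abs_of_nonneg e1]; dsimp only; linarith
    have hx2 : ‖consCoord n (s, y) + h‖ ≤ (n + 1) * (2 + 2 * a) := by
      have := norm_le_card_mul (consCoord n (s, y) + h) (B := 2 + 2 * a) (by positivity)
        (fun i => ?_)
      · rwa [hMc] at this
      · rw [← consCoord_add]
        refine Fin.cases ?_ (fun j => ?_) i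
        · rw [consCoord_zero, abs_le]; constructor <;> dsimp only [Prod.fst_add] <;> linarith
        · have e1 : 0 ≤ y j := hy.1 j
          have e2 : y j ≤ 1 := hy.2 j
          have e3 : 0 ≤ k j := hk.1 j
          have e4 : k j ≤ t := hk.2 j
          rw [consCoord_succ]
          dsimp only [Prod.snd_add, Pi.add_apply]
          rw [abs_of_nonneg (by linarith)]; linarith
    change θ / M ^ (1 + γ) * ‖h‖ ^ (1 + γ) <
      |w (consCoord n (s, y) + h) - w (consCoord n (s, y))|
    rw [hw _ hx1, hw _ hx2, ← consCoord_add, consCoord_zero, consCoord_zero]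
    have hM1 : 0 < M ^ (1 + γ) := by positivity
    calc θ / M ^ (1 + γ) * ‖h‖ ^ (1 + γ) ≤ θ / M ^ (1 + γ) * (M * t) ^ (1 + γ) := by
          have : 0 ≤ 1 + γ := by linarith
          gcongr
      _ = θ * t ^ (1 + γ) := by
          rw [Real.mul_rpow hM.le ht.le]; field_simp
      _ < W (s + t) - W s := h3
      _ ≤ _ := le_abs_self _
  have hFm : Measurable fun z : ℝ × (Fin n → ℝ) => F (consCoord n z) :=
    hF.comp (measurableEmbedding_consCoord n).measurable
  calc ENNReal.ofReal (M ^ (γ - M)) * jumpEnergy γ a θ W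
      = ∫⁻ t in Set.Ioi (0 : ℝ), ∫⁻ _ in Set.Icc (0 : Fin n → ℝ) (fun _ => t),
          ENNReal.ofReal ((M * t) ^ (γ - M)) * volume (jumpSet γ a θ W t) := by
        rw [jumpEnergy, ← lintegral_const_mul' _ _ ENNReal.ofReal_ne_top]
        refine setLIntegral_congr_fun measurableSet_Ioi fun t ht => ?_
        have ht : 0 < t := ht
        -- The cross-section volume t^n lowers the weight to the one-dimensional t^(γ-1).
        have e : M ^ (γ - M) * t ^ (γ - 1) = (M * t) ^ (γ - M) * t ^ n := by
          rw [Real.mul_rpow hM.le ht.le, ← Real.rpow_natCast t n, mul_assoc, ← Real.rpow_add ht]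
          congr 2
          simp only [M]; ring
        rw [setLIntegral_const, Real.volume_Icc_pi, ← mul_assoc,
          ← ENNReal.ofReal_mul (by positivity), e, ENNReal.ofReal_mul (by positivity),
          ENNReal.ofReal_pow ht.le]
        simp only [Pi.zero_apply, sub_zero, Finset.prod_const, Finset.card_univ, Fintype.card_fin]
        ring
    _ ≤ ∫⁻ t in Set.Ioi (0 : ℝ), ∫⁻ k in Set.Icc (0 : Fin n → ℝ) (fun _ => t),
          F (consCoord n (t, k)) :=
        setLIntegral_mono' measurableSet_Ioi fun t ht =>
          setLIntegral_mono' measurableSet_Icc fun k hk => hbound t ht k hk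
    _ ≤ ∫⁻ t : ℝ, ∫⁻ k : Fin n → ℝ, F (consCoord n (t, k)) :=
        (setLIntegral_le_lintegral _ _).trans
          (lintegral_mono fun t => setLIntegral_le_lintegral _ _)
    _ = ∫⁻ z : ℝ × (Fin n → ℝ), F (consCoord n z) := by
        rw [Measure.volume_eq_prod, lintegral_prod _ hFm.aemeasurable]
    _ = _ := (measurePreserving_consCoord n).lintegral_comp_emb (measurableEmbedding_consCoord n) F

/-- Monotonicity bounds the variation by 1, however steep the profile; this keeps the energies
bounded. -/
theorem IsRamp.lintegral_deriv_le {W : ℝ → ℝ} (hW : IsRamp W) : ∫⁻ t, ‖deriv W t‖ₑ ≤ 1 := by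
  have hcont : Continuous (deriv W) := hW.contDiff.continuous_deriv (by simp)
  have hnn : ∀ t, 0 ≤ deriv W t := fun t => hW.mono.deriv_nonneg
  have hzero : ∀ t ∉ Set.Icc (0 : ℝ) 1, deriv W t = 0 := by
    intro t ht
    rcases lt_or_ge t 0 with h | h
    · have : W =ᶠ[𝓝 t] fun _ => 0 := by
        filter_upwards [gt_mem_nhds h] with s hs using hW.eq_zero s hs.le
      rw [this.deriv_eq, deriv_const]
    · have h1 : 1 < t := by
        by_contra h2
        exact ht ⟨h, not_lt.1 h2⟩
      have : W =ᶠ[𝓝 t] fun _ => 1 := by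
        filter_upwards [lt_mem_nhds h1] with s hs using hW.eq_one s hs.le
      rw [this.deriv_eq, deriv_const]
  calc ∫⁻ t, ‖deriv W t‖ₑ = ∫⁻ t in Set.Icc (0 : ℝ) 1, ‖deriv W t‖ₑ := by
        rw [← lintegral_indicator measurableSet_Icc]
        refine lintegral_congr fun t => ?_
        by_cases ht : t ∈ Set.Icc (0 : ℝ) 1
        · rw [Set.indicator_of_mem ht]
        · rw [Set.indicator_of_notMem ht, hzero t ht, enorm_zero]
    _ = ∫⁻ t in Set.Ioc (0 : ℝ) 1, ENNReal.ofReal (deriv W t) := by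
        rw [restrict_Ioc_eq_restrict_Icc]
        exact lintegral_congr fun t => Real.enorm_eq_ofReal (hnn t)
    _ = ENNReal.ofReal (∫ t in (0 : ℝ)..1, deriv W t) := by
        rw [intervalIntegral.integral_of_le zero_le_one, ofReal_integral_eq_lintegral_ofReal]
        · exact (hcont.integrableOn_Icc).mono_set Set.Ioc_subset_Icc_self
        · exact Eventually.of_forall hnn
    _ ≤ 1 := by
        rw [intervalIntegral.integral_deriv_eq_sub' W rfl
          (fun x _ => hW.contDiff.differentiable (by simp) x) hcont.continuousOn,
          hW.eq_one 1 le_rfl, hW.eq_zero 0 le_rfl, sub_zero, ENNReal.ofReal_one]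

/-- Product rule. The term with W' lives in a cylinder of cross-section (2R)^n and integrates along
the axis to at most 1, so the bound does not depend on `W`. -/
theorem gradNorm_ramp_mul_le {W : ℝ → ℝ} (hW : IsRamp W) {ψ : Euc (n + 1) → ℝ}
    (hψ : ContDiff ℝ 1 ψ) (hψ1 : ∀ x, |ψ x| ≤ 1) {R : ℝ} (hψR : ∀ x, R ≤ ‖x‖ → ψ x = 0) :
    gradNorm 1 (fun x : Euc (n + 1) => W (x 0) * ψ x) ≤
      ENNReal.ofReal (2 * R) ^ n + gradNorm 1 ψ := by
  set π : Euc (n + 1) →L[ℝ] ℝ := EuclideanSpace.proj 0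
  have hW0 : ContDiff ℝ 1 fun x : Euc (n + 1) => W (x 0) := hW.contDiff.comp π.contDiff
  rw [gradNorm_one_eq_lintegral (hW0.mul hψ), gradNorm_one_eq_lintegral hψ]
  have hπ : ‖π‖ ≤ 1 := by
    refine ContinuousLinearMap.opNorm_le_bound _ zero_le_one fun x => ?_
    rw [one_mul]
    exact PiLp.norm_apply_le x 0
  set B : Set (Euc (n + 1)) := {x | ∀ i : Fin n, |x i.succ| ≤ R}
  have hpt : ∀ x : Euc (n + 1), ‖fderiv ℝ (fun x : Euc (n + 1) => W (x 0) * ψ x) x‖ₑ ≤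
      B.indicator (fun x => ‖deriv W (x 0)‖ₑ) x + ‖fderiv ℝ ψ x‖ₑ := by
    intro x
    have h1 : HasFDerivAt (fun x : Euc (n + 1) => W (x 0)) (deriv W (x 0) • π) x :=
      (hW.contDiff.differentiable (by simp) (π x)).hasDerivAt.comp_hasFDerivAt x π.hasFDerivAt
    have h2 := (h1.mul (hψ.differentiable (by simp) x).hasFDerivAt).fderiv
    have h2 : fderiv ℝ (fun x : Euc (n + 1) => W (x 0) * ψ x) x =
      W (x 0) • fderiv ℝ ψ x + ψ x • deriv W (x 0) • π := h2
    rw [h2]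
    refine (enorm_add_le (W (x 0) • fderiv ℝ ψ x) (ψ x • deriv W (x 0) • π)).trans ?_
    rw [add_comm]
    refine add_le_add ?_ ?_
    · by_cases hx : x ∈ B
      · rw [Set.indicator_of_mem hx, enorm_smul, enorm_smul]
        have e1 : ‖ψ x‖ₑ ≤ 1 := by
          rw [Real.enorm_eq_ofReal_abs]
          exact ENNReal.ofReal_le_one.2 (hψ1 x)
        have e2 : ‖π‖ₑ ≤ 1 := by
          rw [← enorm_norm, Real.enorm_eq_ofReal (norm_nonneg _)]
          exact ENNReal.ofReal_le_one.2 hπ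
        calc _ ≤ 1 * (‖deriv W (x 0)‖ₑ * 1) := by gcongr
          _ = _ := by ring
      · have : ψ x = 0 := by
          refine hψR x ?_
          by_contra h
          refine hx fun i => ?_
          have := PiLp.norm_apply_le x i.succ
          rw [Real.norm_eq_abs] at this
          linarith
        rw [enorm_smul, this, enorm_zero, zero_mul]
        exact zero_le
    · rw [enorm_smul]
      have e1 : ‖W (x 0)‖ₑ ≤ 1 := by
        rw [Real.enorm_eq_ofReal (hW.nonneg _)]
        exact ENNReal.ofReal_le_one.2 (hW.le_one _)
      calc _ ≤ 1 * ‖fderiv ℝ ψ x‖ₑ := by gcongr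
        _ = _ := one_mul _
  refine (lintegral_mono hpt).trans ?_
  have hfm : Measurable fun x => ‖fderiv ℝ ψ x‖ₑ := (hψ.continuous_fderiv (by simp)).enorm.measurable
  rw [lintegral_add_right _ hfm]
  gcongr
  rw [← (measurePreserving_consCoord n).lintegral_comp_emb (measurableEmbedding_consCoord n)]
  set Q : Set (Fin n → ℝ) := Set.Icc (fun _ => -R) (fun _ => R)
  have hQ : ∀ z : ℝ × (Fin n → ℝ), B.indicator (fun x => ‖deriv W (x 0)‖ₑ) (consCoord n z) =
      ‖deriv W z.1‖ₑ * Q.indicator 1 z.2 := by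
    intro z
    have hiff : consCoord n z ∈ B ↔ z.2 ∈ Q := by
      simp only [B, Q, Set.mem_ofPred_eq, consCoord_succ, abs_le, Set.mem_Icc, Pi.le_def]
      exact forall_and
    by_cases hz : z.2 ∈ Q
    · rw [Set.indicator_of_mem (hiff.2 hz), Set.indicator_of_mem hz]
      simp
    · rw [Set.indicator_of_notMem (fun h => hz (hiff.1 h)), Set.indicator_of_notMem hz, mul_zero]
  simp_rw [hQ]
  have hWm : Measurable (deriv W) := measurable_deriv W
  rw [Measure.volume_eq_prod, lintegral_prod_mul (f := fun t => ‖deriv W t‖ₑ) (by fun_prop)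
    (measurable_one.indicator measurableSet_Icc).aemeasurable,
    lintegral_indicator_one measurableSet_Icc, Real.volume_Icc_pi]
  simp only [sub_neg_eq_add, Finset.prod_const, Finset.card_univ, Fintype.card_fin]
  calc _ ≤ 1 * ENNReal.ofReal (R + R) ^ n := by gcongr; exact hW.lintegral_deriv_le
    _ = _ := by rw [one_mul, two_mul]

end Lift

/-! ### Bounded energy with large level functional -/

/-- Functions of bounded energy with large level functional at small levels. -/
theorem exists_large_levelFunctional {N : ℕ} (hN : 1 ≤ N) {γ : ℝ} (hγ1 : -1 ≤ γ) (hγ0 : γ < 0) :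
    ∃ K : ℝ, 0 < K ∧ ∀ C δ : ℝ, 0 < C → 0 < δ → ∃ w : Euc N → ℝ, MemHomSobolev 1 w ∧
      gradNorm 1 w ≤ ENNReal.ofReal K ∧ ∃ lam : ℝ, 0 < lam ∧ lam < δ ∧
        ENNReal.ofReal C ≤ levelFunctional 1 γ w lam := by
  obtain ⟨n, rfl⟩ : ∃ n, N = n + 1 := ⟨N - 1, by omega⟩
  obtain ⟨a, θ, ha, hθ, hlarge⟩ := exists_large_jumpEnergy hγ1 hγ0
  set r : ℝ := ((n : ℝ) + 1) * (2 + 2 * a)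
  have hr : 0 < r := by positivity
  set ψ : ContDiffBump (0 : Euc (n + 1)) := ⟨r, r + 1, hr, by linarith⟩
  have hψ : ContDiff ℝ 1 ψ := ψ.contDiff
  have hψK : gradNorm 1 ψ ≠ ⊤ := (memHomSobolev_of_contDiff hψ ψ.hasCompactSupport).gradNorm_ne_top
  have hψ1 : ∀ x, |ψ x| ≤ 1 := fun x => by rw [abs_of_nonneg ψ.nonneg]; exact ψ.le_one
  have hψR : ∀ x, r + 1 ≤ ‖x‖ → ψ x = 0 := fun x hx =>
    ψ.zero_of_le_dist (by rw [dist_zero_right]; exact hx)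
  have hψr : ∀ x, ‖x‖ ≤ r → ψ x = 1 := fun x hx =>
    ψ.one_of_mem_closedBall (by rw [mem_closedBall_zero_iff]; exact hx)
  set M : ℝ := (n : ℝ) + 1
  have hM : 0 < M := by positivity
  set θ' : ℝ := θ / M ^ (1 + γ)
  have hθ' : 0 < θ' := by positivity
  set K : ℝ := (2 * (r + 1)) ^ n + (gradNorm 1 ψ).toReal
  have hK : ENNReal.ofReal (2 * (r + 1)) ^ n + gradNorm 1 ψ = ENNReal.ofReal K := by
    rw [ENNReal.ofReal_add (by positivity) ENNReal.toReal_nonneg, ENNReal.ofReal_toReal hψK,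
      ENNReal.ofReal_pow (by positivity)]
  have hw : ∀ C : ℝ, 0 < C → ∃ w : Euc (n + 1) → ℝ, ContDiff ℝ 1 w ∧ HasCompactSupport w ∧
      gradNorm 1 w ≤ ENNReal.ofReal K ∧ ENNReal.ofReal C ≤ levelFunctional 1 γ w θ' := by
    intro C hC
    -- Compensates the level prefactor θ' and the factor M^(γ-M) lost in the lift.
    obtain ⟨W, hW, hWC⟩ := hlarge (C / (θ' * M ^ (γ - M)))
    have hWψ : ContDiff ℝ 1 fun x : Euc (n + 1) => W (x 0) * ψ x :=
      (hW.contDiff.comp (EuclideanSpace.proj (𝕜 := ℝ) (0 : Fin (n + 1))).contDiff).mul hψ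
    refine ⟨_, hWψ, ψ.hasCompactSupport.mul_left,
      (gradNorm_ramp_mul_le hW hψ hψ1 hψR).trans hK.le, ?_⟩
    rw [levelFunctional_eq_translations hWψ.continuous.measurable γ hθ'.le]
    refine le_trans ?_ (mul_le_mul' le_rfl (jumpEnergy_le_translations hγ1 hγ0 ha hθ (W := W)
      hWψ.continuous.measurable fun x hx => ?_))
    · refine le_trans (le_of_eq ?_) (mul_le_mul' le_rfl (mul_le_mul' le_rfl hWC))
      rw [← ENNReal.ofReal_mul (by positivity), ← ENNReal.ofReal_mul (by positivity)]
      congr 1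
      have : 0 < M ^ (γ - M) := by positivity
      change C = θ' * (M ^ (γ - M) * _)
      field_simp
    · dsimp only
      rw [hψr x hx, mul_one]
  refine ⟨K, by positivity, fun C δ hC hδ => ?_⟩
  -- If γ > -1, then M + γ > 0 and a large dilation lowers the level θ'. If γ = -1, the level is
  -- lowered directly; it is fixed before `w` is chosen, so the lost factor λ/θ' is absorbed in the
  -- demand on `w`.
  rcases hγ1.lt_or_eq with hγ | hγ
  · obtain ⟨w, hwc, hws, hwK, hwC⟩ := hw C hC
    have hs : 0 < M + γ := by
      have : (0 : ℝ) ≤ n := by positivity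
      simp only [M]; linarith
    have hlim : Tendsto (fun R : ℝ => θ' * R ^ (-(M + γ))) atTop (𝓝 0) := by
      simpa using (tendsto_rpow_neg_atTop hs).const_mul θ'
    obtain ⟨R, hRδ, hR⟩ := ((hlim.eventually (gt_mem_nhds hδ)).and (eventually_gt_atTop 0)).exists
    refine ⟨dilate R w, memHomSobolev_of_contDiff (contDiff_dilate hwc R)
      (hasCompactSupport_dilate hws hR), (gradNorm_dilate hwc hR).le.trans hwK,
      θ' * R ^ (-(M + γ)), by positivity, hRδ, ?_⟩
    rw [levelFunctional_dilate hwc.continuous.measurable γ hR (by positivity)]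
    have e : θ' * R ^ (-(M + γ)) * R ^ (((n + 1 : ℕ) : ℝ) + γ) = θ' := by
      push_cast
      rw [mul_assoc, ← Real.rpow_add hR, neg_add_cancel, Real.rpow_zero, mul_one]
    rwa [e]
  · subst hγ
    set lam : ℝ := min (δ / 2) θ'
    have hl : 0 < lam := by positivity
    obtain ⟨w, hwc, hws, hwK, hwC⟩ := hw (C * θ' / lam) (by positivity)
    refine ⟨w, memHomSobolev_of_contDiff hwc hws, hwK, lam, hl,
      (min_le_left _ _).trans_lt (by linarith), ?_⟩
    refine le_trans ?_ (levelFunctional_neg_one_ge hwc.continuous.measurable hl (min_le_right _ _))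
    refine le_trans (le_of_eq ?_) (mul_le_mul' le_rfl hwC)
    rw [← ENNReal.ofReal_mul (by positivity)]
    congr 1
    field_simp

end WeightedReverse

end

/-! ### The main theorem -/

open WeightedReverse in
theorem theorem1p1 (N : ℕ) (hN : 1 ≤ N) (p γ : ℝ) (hp : 1 ≤ p) (hγ : γ ≠ 0)
    (e : Euc N) (he : ‖e‖ = 1) :
    -- (a)
    (0 < γ → ∀ u : Euc N → ℝ, MemHomSobolev (ENNReal.ofReal p) u →
      Tendsto (levelFunctional p γ u) atTop
        (𝓝 (ENNReal.ofReal (kappa p e / |γ|) * gradNorm (ENNReal.ofReal p) u ^ p))) ∧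
    -- (b)
    ((γ < 0 ∧ 1 < p) ∨ (γ < -1 ∧ p = 1) → ∀ u : Euc N → ℝ, MemHomSobolev (ENNReal.ofReal p) u →
      Tendsto (levelFunctional p γ u) (𝓝[>] 0)
        (𝓝 (ENNReal.ofReal (kappa p e / |γ|) * gradNorm (ENNReal.ofReal p) u ^ p))) ∧
    -- (c)
    (p = 1 → -1 ≤ γ → γ < 0 →
      (∀ u : Euc N → ℝ, ContDiff ℝ 1 u → HasCompactSupport u →
        Tendsto (levelFunctional 1 γ u) (𝓝[>] 0)
          (𝓝 (ENNReal.ofReal (kappa 1 e / |γ|) * gradNorm 1 u))) ∧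
      IsMeagre {u : HomSobolev N 1 |
        Tendsto (levelFunctional 1 γ u.toFun) (𝓝[>] 0)
          (𝓝 (ENNReal.ofReal (kappa 1 e / |γ|) * gradNorm 1 u.toFun))} ∧
      (∀ u : Euc N → ℝ, MemHomSobolev 1 u →
        ENNReal.ofReal (kappa 1 e / |γ|) * gradNorm 1 u ≤
          liminf (levelFunctional 1 γ u) (𝓝[>] 0))) := by
  have h0 : 0 < p := by linarith
  refine ⟨fun h u hu => ?_, fun h u hu => ?_, fun _ h1 h2 => ⟨fun u hu hc => ?_, ?_,
    fun u hu => ?_⟩⟩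
  · refine tendsto_levelFunctional hN hγ ?_ he (scaleFilter_atTop h0 h) hu
    rcases hp.lt_or_eq with h1 | h1
    · exact Or.inl h1
    · exact Or.inr ⟨h1.symm, Or.inl h⟩
  · rcases h with ⟨h1, h2⟩ | ⟨h1, h2⟩
    · exact tendsto_levelFunctional hN hγ (Or.inl h2) he (scaleFilter_nhdsGT h0 h1) hu
    · exact tendsto_levelFunctional hN hγ (Or.inr ⟨h2, Or.inr h1⟩) he
        (scaleFilter_nhdsGT h0 (by linarith)) hu
  · simpa using tendsto_levelFunctional_of_contDiff hN hγ he (scaleFilter_nhdsGT one_pos h2) hu hc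
  · obtain ⟨K, hK, hw⟩ := exists_large_levelFunctional hN h1 h2
    -- A finite limit bounds the functional at all small levels, which is already a meager property.
    refine (isMeagre_bounded_levelFunctional hK hw).mono fun u hu => ?_
    exact exists_bound_of_tendsto
      (ENNReal.mul_ne_top ENNReal.ofReal_ne_top u.mem.gradNorm_ne_top) hu
  · have h3 : MemHomSobolev (ENNReal.ofReal 1) u := by simpa using hu
    simpa using le_liminf_levelFunctional hN le_rfl hγ he (scaleFilter_nhdsGT one_pos h2) h3
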